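/- Let $(\mathcal R,\mu)$ and $(\mathcal S,\nu)$ be nonatomic $\sigma$-finite measure spaces, and let $X(\mathcal R,\mu)$, $Y(\mathcal S,\nu)$ be rearrangement-invariant Banach function spaces with representation spaces $\bar X(0,\mu(\mathcal R))$, $\bar Y(0,\nu(\mathcal S))$, i.e. $\|f\|_X=\|f^*\|_{\bar X}$ and $\|g\|_Y=\|g^*\|_{\bar Y}$, where $^*$ is the nonincreasing rearrangement. Put $f^{**}(t)=\frac1t\int_0^t f^*(s)\,ds$. Functions are real- or complex-valued, measurable and finite a.e., and functions equal a.e. are identified; for a measure space $\mathfrak M_0$ denotes the space of all such functions. Let $\varphi_X(t)=\|\chi_{(0,t)}\|_{\bar X(0,\mu(\mathcal R))}$ be the fundamental function of $X$ and assume $\lim_{t\to0^+}\varphi_X(t)=0$. Let $1<p<q<\infty$ and $\lambda\in(0,1)$ with $\lambda p>1$. If $\mu(\mathcal R)=\infty$ and $\nu(\mathcal S)<\infty$, assume also that $X(\mathcal R,\mu)\subseteq (L^p+L^{q,\infty})(\mathcal R,\mu)$, with $\|f\|_{L^p+L^{q,\infty}}\lesssim\|f\|_X$. Assume that the operator $$R_{p,q}g(t)=\Big(\frac1t\int_0^{t^{r}}g^*(s)^p\,ds\Big)^{1/p},\qquad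 r=\frac q{q-p},$$ is bounded from $\bar X(0,\mu(\mathcal R))$ to $\bar Y(0,\nu(\mathcal S))$. Let $G$ be a quasilinear operator from $(L^{\lambda p}+L^{\lambda q,\infty})(\mathcal R,\mu)$ to $\mathfrak M_0(\mathcal S,\nu)$, that is, for some $k\ge1$ one has $|G(f+g)|\le k(|Gf|+|Gg|)$ and $|G(\alpha f)|=|\alpha||Gf|$ $\nu$-a.e. for all $f,g$ in the domain and all scalars $\alpha$. Assume that $G$ is $(\lambda p,\lambda q)$-sawyerable, that is, bounded from $L^{\lambda p}(\mathcal R,\mu)$ to $L^{\lambda p}(\mathcal S,\nu)$ and from $L^{\lambda q,\infty}(\mathcal R,\mu)$ to $L^\infty(\mathcal S,\nu)$. Let $B$ be a linear operator with values in $\mathfrak M_0(\mathcal S,\nu)$, defined on a linear space of functions on $\mathcal R$ that contains the characteristic functions of all measurable sets of finite measure, and suppose there is $C>0$ such that for every measurable $E\subseteq\mathcal R$ with $\mu(E)<\infty$ $$|B\chi_E(x)|\le C\,|G\chi_E(x)|^{\lambda}\quad\text{for $\nu$-a.e. }x\in\mathcal S.$$ Then $B\colon\Lambda_X(\mathcal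 R,\mu)\to Y^{\langle p\rangle}(\mathcal S,\nu)$ in the following sense. The set $\Lambda_X(\mathcal R,\mu)$ of all $f$ with $$\|f\|_{\Lambda_X}=\|f\|_{L^\infty}\varphi_X(0^+)+\int_0^\infty f^*(s)\varphi_X'(s)\,ds<\infty$$ (where $0\cdot\infty=0$) is a linear space that contains the characteristic functions of the sets of finite measure, and there is exactly one linear operator $T$ from $\Lambda_X(\mathcal R,\mu)$ to $\mathfrak M_0(\mathcal S,\nu)$ such that $T\chi_E=B\chi_E$ whenever $\mu(E)<\infty$ and such that, for some finite constant $K$, $$\|Tf\|_{Y^{\langle p\rangle}}=\big\|\big((|Tf|^p)^{**}\big)^{1/p}\big\|_{\bar Y(0,\nu(\mathcal S))}\le K\|f\|_{\Lambda_X}\quad\text{for all }f\in\Lambda_X(\mathcal R,\mu).$$ -/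

import Mathlib

open MeasureTheory Set Filter Topology
open scoped ENNReal NNReal

noncomputable section

namespace Sawyer

universe u v

/-- Every set of positive measure contains a measurable subset of strictly smaller positive
measure. (Mathlib's `NoAtoms` only says that singletons are null sets.) -/
def Nonatomic {α : Type u} [MeasurableSpace α] (μ : Measure α) : Prop :=
  ∀ A : Set α, MeasurableSet A → 0 < μ A →
    ∃ B : Set α, B ⊆ A ∧ MeasurableSet B ∧ 0 < μ B ∧ μ B < μ A

/-- Two nonnegative functions, possibly on different measure spaces, have the same
distribution function. -/
def Equimeasurable {α : Type u} {β : Type v} [MeasurableSpace α] [MeasurableSpace β]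
    (μ : Measure α) (f : α → ℝ≥0∞) (ν : Measure β) (g : β → ℝ≥0∞) : Prop :=
  ∀ s : ℝ≥0∞, 0 < s → s < ∞ → μ {x | s < f x} = ν {y | s < g y}

/-- The nonincreasing rearrangement `f^*_μ(t) = inf {s > 0 : μ {f > s} ≤ t}`, for `t > 0`. -/
def rearr {α : Type u} [MeasurableSpace α] (μ : Measure α) (f : α → ℝ≥0∞) (t : ℝ) : ℝ≥0∞ :=
  sInf {s : ℝ≥0∞ | 0 < s ∧ μ {x | s < f x} ≤ ENNReal.ofReal t}

/-- The maximal nonincreasing rearrangement `f^{**}_μ(t) = t⁻¹ ∫_0^t f^*_μ(s) ds`, for `t > 0`. -/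
def maxRearr {α : Type u} [MeasurableSpace α] (μ : Measure α) (f : α → ℝ≥0∞) (t : ℝ) : ℝ≥0∞ :=
  (ENNReal.ofReal t)⁻¹ * ∫⁻ s in Ioo 0 t, rearr μ f s

/-- Lebesgue measure on the interval `(0, a)`, where `a ∈ [0, ∞]`. -/
def intervalMeasure (a : ℝ≥0∞) : Measure ℝ :=
  volume.restrict {t : ℝ | 0 < t ∧ ENNReal.ofReal t < a}

/-- A rearrangement-invariant Banach function norm on the nonnegative measurable functions. Only
the values of `norm` at measurable functions matter. -/
structure RINorm {α : Type u} [MeasurableSpace α] (μ : Measure α) where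
  /-- the functional -/
  norm : (α → ℝ≥0∞) → ℝ≥0∞
  norm_eq_zero_iff : ∀ f, Measurable f → (norm f = 0 ↔ f =ᵐ[μ] 0)
  norm_smul : ∀ (c : ℝ≥0) (f), Measurable f → norm (fun x => c * f x) = c * norm f
  norm_add_le : ∀ f g, Measurable f → Measurable g → norm (fun x => f x + g x) ≤ norm f + norm g
  norm_mono : ∀ f g, Measurable f → Measurable g → f ≤ᵐ[μ] g → norm f ≤ norm g
  /-- Fatou property: `f_j ↗ f` a.e. implies `norm f_j ↗ norm f`. -/
  norm_tendsto : ∀ (f : ℕ → α → ℝ≥0∞) (g : α → ℝ≥0∞), (∀ j, Measurable (f j)) → Measurable g →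
    (∀ᵐ x ∂μ, Monotone (fun j => f j x) ∧ Tendsto (fun j => f j x) atTop (𝓝 (g x))) →
    Tendsto (fun j => norm (f j)) atTop (𝓝 (norm g))
  norm_indicator_lt_top : ∀ E, MeasurableSet E → μ E < ∞ → norm (E.indicator fun _ => 1) < ∞
  setLIntegral_le : ∀ E, MeasurableSet E → μ E < ∞ →
    ∃ C : ℝ≥0, ∀ f, Measurable f → ∫⁻ x in E, f x ∂μ ≤ C * norm f
  norm_congr : ∀ f g, Measurable f → Measurable g → Equimeasurable μ f μ g → norm f = norm g

section Spaces

variable {α : Type u} [MeasurableSpace α] {μ : Measure α} {𝕜 : Type v} [RCLike 𝕜]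

/-- The norm of the representation space `X̄(0, μ(R))`: a nonnegative function `h` on
`(0, μ(R))` is assigned the common value of `‖f‖_X` over all `f` on `R` equimeasurable with `h`.
(For a nonatomic σ-finite measure such `f` exist.) -/
def RINorm.repNorm (X : RINorm μ) (h : ℝ → ℝ≥0∞) : ℝ≥0∞ :=
  ⨅ (f : α → ℝ≥0∞) (_ : Measurable f)
    (_ : Equimeasurable μ f (intervalMeasure (μ univ)) h), X.norm f

/-- The value of `repNorm` does not depend on the choice of the equimeasurable function. -/
theorem RINorm.repNorm_eq (X : RINorm μ) {h : ℝ → ℝ≥0∞} {f : α → ℝ≥0∞} (hf : Measurable f)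
    (hfh : Equimeasurable μ f (intervalMeasure (μ univ)) h) : X.repNorm h = X.norm f := by
  apply le_antisymm
  · exact iInf₂_le_of_le f hf (iInf_le _ hfh)
  · refine le_iInf fun g => le_iInf fun hg => le_iInf fun hgh => ?_
    exact (X.norm_congr f g hf hg fun s h0 h1 => (hfh s h0 h1).trans (hgh s h0 h1).symm).le

/-- `‖f‖_X` for a measurable a.e. finite scalar function `f`. -/
def RINorm.fnorm (X : RINorm μ) (f : α →ₘ[μ] 𝕜) : ℝ≥0∞ :=
  X.norm fun x => ‖f x‖ₑ

/-- The fundamental function `φ_X(t) = ‖χ_{(0,t)}‖_X̄`. -/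
def RINorm.fundamental (X : RINorm μ) (t : ℝ) : ℝ≥0∞ :=
  X.repNorm ((Ioo 0 t).indicator fun _ => 1)

/-- The functional `‖f‖_{Λ_X} = ‖f‖_∞ φ_X(0+) + ∫_0^∞ f^*(s) φ_X'(s) ds`. The fundamental function
is nondecreasing and locally Lipschitz on `(0, ∞)`, so its derivative exists a.e. -/
def RINorm.lorentzNorm (X : RINorm μ) (f : α →ₘ[μ] 𝕜) : ℝ≥0∞ :=
  eLpNorm f ∞ μ * Function.rightLim X.fundamental 0 +
    ∫⁻ s in Ioi (0 : ℝ), rearr μ (fun x => ‖f x‖ₑ) s *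
      ENNReal.ofReal (deriv (fun t => (X.fundamental t).toReal) s)

/-- The functional `‖f‖_{X^⟨p⟩} = ‖((|f|^p)^{**})^{1/p}‖_X̄`. -/
def RINorm.powNorm (X : RINorm μ) (p : ℝ) (f : α →ₘ[μ] 𝕜) : ℝ≥0∞ :=
  X.repNorm fun t => maxRearr μ (fun x => ‖f x‖ₑ ^ p) t ^ (1 / p)

/-- The functional of the weak Lebesgue space: `‖f‖_{L^{q,∞}} = sup_{t>0} t^{1/q} f^*(t)`. -/
def weakNorm (q : ℝ) (f : α →ₘ[μ] 𝕜) : ℝ≥0∞ :=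
  ⨆ t : Ioi (0 : ℝ), ENNReal.ofReal (t : ℝ) ^ (1 / q) * rearr μ (fun x => ‖f x‖ₑ) t

/-- `‖f‖_{L^p + L^{q,∞}}`, the infimum of `‖g‖_{L^p} + ‖h‖_{L^{q,∞}}` over all decompositions
`f = g + h`. The function `f` belongs to `L^p + L^{q,∞}` when this is finite. -/
def sumNorm (p q : ℝ) (f : α →ₘ[μ] 𝕜) : ℝ≥0∞ :=
  ⨅ (g : α →ₘ[μ] 𝕜) (h : α →ₘ[μ] 𝕜) (_ : f = g + h),
    eLpNorm g (ENNReal.ofReal p) μ + weakNorm q h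

/-- The (bounded) inclusion `X ⊆ L^p + L^{q,∞}`. -/
def RINorm.SubsetSum (𝕜 : Type v) [RCLike 𝕜] (X : RINorm μ) (p q : ℝ) : Prop :=
  ∃ C : ℝ≥0, ∀ f : α →ₘ[μ] 𝕜, X.fnorm f < ∞ → sumNorm p q f ≤ C * X.fnorm f

/-- The characteristic function of `E`. -/
def chi (𝕜 : Type v) [RCLike 𝕜] (μ : Measure α) (E : Set α) (hE : MeasurableSet E) : α →ₘ[μ] 𝕜 :=
  AEEqFun.mk (E.indicator fun _ => 1) (stronglyMeasurable_const.indicator hE).aestronglyMeasurable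

end Spaces

section Operators

variable {α β : Type*} [MeasurableSpace α] [MeasurableSpace β]

/-- `T` is quasilinear on the set `V` of functions. -/
def QuasilinearOn {𝕜 : Type*} [RCLike 𝕜] {μ : Measure α} {ν : Measure β} (V : Set (α →ₘ[μ] 𝕜))
    (T : (α →ₘ[μ] 𝕜) → (β →ₘ[ν] 𝕜)) : Prop :=
  ∃ k : ℝ, 1 ≤ k ∧ ∀ f ∈ V, ∀ g ∈ V, ∀ c : 𝕜,
    (∀ᵐ x ∂ν, ‖T (f + g) x‖ ≤ k * (‖T f x‖ + ‖T g x‖)) ∧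
    ∀ᵐ x ∂ν, ‖T (c • f) x‖ = ‖c‖ * ‖T f x‖

/-- `T` is a `(p,q)`-sawyerable quasilinear operator: it is quasilinear on `L^p + L^{q,∞}` and is
bounded from `L^p` to `L^p` and from `L^{q,∞}` to `L^∞`. The values of `T` outside
`L^p + L^{q,∞}` are irrelevant. -/
def Sawyerable {𝕜 : Type*} [RCLike 𝕜] {μ : Measure α} {ν : Measure β} (p q : ℝ)
    (T : (α →ₘ[μ] 𝕜) → (β →ₘ[ν] 𝕜)) : Prop :=
  QuasilinearOn {f | sumNorm p q f < ∞} T ∧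
  (∃ C : ℝ≥0, ∀ f : α →ₘ[μ] 𝕜, eLpNorm f (ENNReal.ofReal p) μ < ∞ →
    eLpNorm (T f) (ENNReal.ofReal p) ν ≤ C * eLpNorm f (ENNReal.ofReal p) μ) ∧
  ∃ C : ℝ≥0, ∀ f : α →ₘ[μ] 𝕜, weakNorm q f < ∞ → eLpNorm (T f) ∞ ν ≤ C * weakNorm q f

/-- `R_{p,q} g(t) = (t⁻¹ ∫_0^{t^r} g^*(s)^p ds)^{1/p}` with `r = q / (q - p)`, for a nonnegative
function `g` on `(0, a)`. -/
def opR (p q : ℝ) (a : ℝ≥0∞) (g : ℝ → ℝ≥0∞) (t : ℝ) : ℝ≥0∞ :=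
  ((ENNReal.ofReal t)⁻¹ *
    ∫⁻ s in Ioo 0 (t ^ (q / (q - p))), rearr (intervalMeasure a) g s ^ p) ^ (1 / p)

/-- `R_{p,q}` is bounded from `X̄(0, μ(R))` to `Ȳ(0, ν(S))`. -/
def OpRBounded {μ : Measure α} {ν : Measure β} (p q : ℝ) (X : RINorm μ) (Y : RINorm ν) : Prop :=
  ∃ C : ℝ≥0, ∀ g : ℝ → ℝ≥0∞, Measurable g → X.repNorm g < ∞ →
    Y.repNorm (opR p q (μ univ) g) ≤ C * X.repNorm g

end Operators

end Sawyer

end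

noncomputable section

namespace Sawyer

/-! ### Nonatomic measures: intermediate values and a measure-preserving map onto an interval. -/

section Nonatomic

variable {α : Type*} [MeasurableSpace α] {μ : Measure α}

/-! Let `μ E = a` and `b = |B χ_E|`. The endpoint bounds of `G` at `χ_E`, raised to the power `λ`,
give `‖b‖_p ≲ a^{1/p}` and `‖b‖_∞ ≲ a^{1/q}`, hence `((b^p)^{**}(t))^{1/p} ≲ min ((a/t)^{1/p},
a^{1/q})`. With `τ = a^{(q-p)/q}`, the function `R_{p,q} χ_{(0,a)}` equals `t^{1/(q-p)}` up to `τ`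
and `(a/t)^{1/p}` beyond it, so it dominates this minimum for `t ≥ τ/2`. On `(0, τ/2)` it does not,
but rearrangement invariance of `Y` moves that interval to `[τ/2, τ)`, where it does. Boundedness of
`R_{p,q}` then gives `‖B χ_E‖_{Y^⟨p⟩} ≲ φ_X(a)` (`exists_maxNorm_le`). When `τ > ν(S)` there is no
room for the move; what is needed instead is `a^{1/q} ≲ φ_X(a)` for `a` bounded below, which is
elementary if `μ` is finite and follows from the assumed inclusion otherwise.

A nonnegative simple function is a sum of nested layers. The functional of `Λ_X` does not lose
anything on such a sum and `Y^⟨p⟩` is normed, so the bound passes from sets to these functions with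
the same constant (`ofNNRealSimple_bound`), and to all simple functions with a factor 4.

Finally, simple functions are dense in `Λ_X`, and `Y^⟨p⟩` is complete, so `existsUnique_extension`
applies. Density uses `φ_X(0+) = 0` and, if `μ` is infinite, that `φ_X'` has infinite integral;
otherwise constants would lie in `Λ_X`. The latter follows from `a^{1/q} ≲ φ_X(a)` for `a ≥ 1`
(`exists_rpow_le_norm_of_infinite`).

Two devices are used throughout. A measure-preserving map onto `(0, μ(R))`
(`Nonatomic.exists_map_eq`) transfers the axioms of `X` to its representation space. Since `φ_X`
need not be concave, its absolute continuity away from 0 comes from an averaging argument, and `Λ_X`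
is only treated as a quasinormed space. -/

theorem Nonatomic.exists_small (hμ : Nonatomic μ) {A : Set α} (hA : MeasurableSet A)
    (h0 : 0 < μ A) (hfin : μ A ≠ ∞) {ε : ℝ≥0∞} (hε : 0 < ε) :
    ∃ B ⊆ A, MeasurableSet B ∧ 0 < μ B ∧ μ B ≤ ε := by
  have key : ∀ n : ℕ, ∃ B ⊆ A, MeasurableSet B ∧ 0 < μ B ∧ μ B ≤ μ A / 2 ^ n := by
    intro n
    induction n with
    | zero => exact ⟨A, Subset.rfl, hA, h0, by simp⟩
    | succ n ih =>
      obtain ⟨B, hBA, hB, hB0, hBn⟩ := ih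
      obtain ⟨C, hCB, hC, hC0, hClt⟩ := hμ B hB hB0
      have hsum : μ (B \ C) + μ C = μ B := by
        rw [← measure_union disjoint_sdiff_left hC, sdiff_union_of_subset hCB]
      have hhalf : μ B / 2 ≤ μ A / 2 ^ (n + 1) := by
        rw [pow_succ, div_eq_mul_inv, div_eq_mul_inv (μ A),
          ENNReal.mul_inv (by simp) (by simp), ← mul_assoc, ← div_eq_mul_inv (μ A)]
        gcongr
      -- One of `C` and `B \ C` carries at most half of the measure of `B`.
      by_cases hc : μ C ≤ μ B / 2
      · exact ⟨C, hCB.trans hBA, hC, hC0, hc.trans hhalf⟩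
      · refine ⟨B \ C, sdiff_subset.trans hBA, hB.diff hC, ?_, le_trans ?_ hhalf⟩
        · rw [pos_iff_ne_zero]
          intro h
          rw [h, zero_add] at hsum
          exact hClt.ne hsum
        · by_contra hd
          push Not at hc hd
          have := ENNReal.add_lt_add hd hc
          rw [ENNReal.add_halves, hsum] at this
          exact this.false
  obtain ⟨n, hn⟩ : ∃ n : ℕ, μ A / 2 ^ n < ε := by
    have : Tendsto (fun n : ℕ => μ A * (2⁻¹ : ℝ≥0∞) ^ n) atTop (𝓝 (μ A * 0)) :=
      ENNReal.Tendsto.const_mul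
        (ENNReal.tendsto_pow_atTop_nhds_zero_of_lt_one (by simp)) (Or.inr hfin)
    rw [mul_zero] at this
    obtain ⟨n, hn⟩ := (this.eventually (gt_mem_nhds hε)).exists
    exact ⟨n, by rwa [div_eq_mul_inv, ENNReal.inv_pow]⟩
  obtain ⟨B, h1, h2, h3, h4⟩ := key n
  exact ⟨B, h1, h2, h3, h4.trans hn.le⟩

/-- Sierpiński's theorem: a finite nonatomic measure takes all intermediate values. -/
theorem Nonatomic.exists_subset_measure_eq (hμ : Nonatomic μ) {A : Set α} (hA : MeasurableSet A)
    (hfin : μ A ≠ ∞) {c : ℝ≥0∞} (hc : c ≤ μ A) :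
    ∃ B ⊆ A, MeasurableSet B ∧ μ B = c := by
  have step : ∀ B : {B : Set α // B ⊆ A ∧ MeasurableSet B ∧ μ B ≤ c},
      ∃ B' : {B : Set α // B ⊆ A ∧ MeasurableSet B ∧ μ B ≤ c}, B.1 ⊆ B'.1 ∧
        ∀ D ⊆ A \ B.1, MeasurableSet D → μ B.1 + μ D ≤ c → μ B.1 + μ D / 2 ≤ μ B'.1 := by
    rintro ⟨B, hBA, hB, hBc⟩
    -- Greedy exhaustion: add a set of more than half the largest measure that can still be added
    -- without exceeding `c`.
    set S : ℝ≥0∞ := ⨆ (D : Set α) (_ : D ⊆ A \ B ∧ MeasurableSet D ∧ μ B + μ D ≤ c), μ D with hS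
    have hSle : S ≤ μ A := iSup₂_le fun D hD => measure_mono (hD.1.trans sdiff_subset)
    have hle : ∀ D ⊆ A \ B, MeasurableSet D → μ B + μ D ≤ c → μ D ≤ S := fun D h1 h2 h3 =>
      le_iSup₂_of_le D ⟨h1, h2, h3⟩ le_rfl
    rcases eq_or_ne S 0 with h0 | h0
    · refine ⟨⟨B, hBA, hB, hBc⟩, Subset.rfl, fun D h1 h2 h3 => ?_⟩
      have := hle D h1 h2 h3
      rw [h0, nonpos_iff_eq_zero] at this
      simp [this]
    · have hlt : S / 2 < S := ENNReal.half_lt_self h0 (ne_top_of_le_ne_top hfin hSle)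
      conv_rhs at hlt => rw [hS]
      simp only [lt_iSup_iff] at hlt
      obtain ⟨D, ⟨hD1, hD2, hD3⟩, hD⟩ := hlt
      have hdisj : Disjoint B D := disjoint_left.2 fun x hx hxD => (hD1 hxD).2 hx
      have hun : μ (B ∪ D) = μ B + μ D := measure_union hdisj hD2
      refine ⟨⟨B ∪ D, union_subset hBA (hD1.trans sdiff_subset), hB.union hD2, hun ▸ hD3⟩,
        subset_union_left, fun D' h1 h2 h3 => ?_⟩
      change μ B + μ D' / 2 ≤ μ (B ∪ D)
      rw [hun]
      gcongr
      exact le_trans (ENNReal.div_le_div_right (hle D' h1 h2 h3) 2) hD.le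
  choose next hnext1 hnext2 using step
  let F : ℕ → {B : Set α // B ⊆ A ∧ MeasurableSet B ∧ μ B ≤ c} := fun n =>
    next^[n] ⟨∅, empty_subset _, MeasurableSet.empty, by simp⟩
  have hF : ∀ n, F (n + 1) = next (F n) := fun n => Function.iterate_succ_apply' _ _ _
  have hmono : Monotone fun n => (F n).1 := monotone_nat_of_le_succ fun n => by
    rw [hF]; exact hnext1 _
  set B : Set α := ⋃ n, (F n).1 with hBdef
  have hB : MeasurableSet B := MeasurableSet.iUnion fun n => (F n).2.2.1
  have hBA : B ⊆ A := iUnion_subset fun n => (F n).2.1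
  have hBc : μ B ≤ c := by
    rw [hBdef, hmono.measure_iUnion]
    exact iSup_le fun n => (F n).2.2.2
  refine ⟨B, hBA, hB, hBc.antisymm ?_⟩
  by_contra hlt
  push Not at hlt
  have hBfin : μ B ≠ ∞ := ne_top_of_le_ne_top hfin (measure_mono hBA)
  have hdiff : 0 < μ (A \ B) := by
    rw [measure_sdiff hBA hB.nullMeasurableSet hBfin]
    exact tsub_pos_of_lt (hlt.trans_le hc)
  obtain ⟨D, hD1, hD2, hD3, hD4⟩ := hμ.exists_small (hA.diff hB) hdiff
    (ne_top_of_le_ne_top hfin (measure_mono sdiff_subset)) (tsub_pos_of_lt hlt)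
  have hBn : ∀ n, (F n).1 ⊆ B := fun n => subset_iUnion (fun n => (F n).1) n
  -- If the union fell short of `c`, one fixed set `D` outside it would be admissible at every
  -- stage, so every stage would gain at least `μ D / 2`, against finiteness.
  have hgrow : ∀ n : ℕ, n * (μ D / 2) ≤ μ (F n).1 := by
    intro n
    induction n with
    | zero => simp
    | succ n ih =>
      have h := hnext2 (F n) D (hD1.trans (sdiff_subset_sdiff_right (hBn n))) hD2 (by
        calc μ (F n).1 + μ D ≤ μ B + (c - μ B) := add_le_add (measure_mono (hBn n)) hD4
          _ = c := add_tsub_cancel_of_le hlt.le)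
      rw [hF]
      refine le_trans ?_ h
      push_cast
      rw [add_mul, one_mul]
      gcongr
  obtain ⟨n, hn⟩ := ENNReal.exists_nat_mul_gt (a := μ D / 2) (b := μ B)
    (by simpa using hD3.ne') hBfin
  exact absurd ((hgrow n).trans (measure_mono (hBn n))) (not_le.2 hn)

theorem Nonatomic.exists_between_measure_eq (hμ : Nonatomic μ) {A B : Set α}
    (hA : MeasurableSet A) (hB : MeasurableSet B) (hAB : A ⊆ B) (hfin : μ B ≠ ∞) :
    ∃ C, A ⊆ C ∧ C ⊆ B ∧ MeasurableSet C ∧ μ C = μ A + μ (B \ A) / 2 := by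
  obtain ⟨D, hD1, hD2, hD3⟩ := hμ.exists_subset_measure_eq (hB.diff hA)
    (ne_top_of_le_ne_top hfin (measure_mono sdiff_subset)) (c := μ (B \ A) / 2) ENNReal.half_le_self
  refine ⟨A ∪ D, subset_union_left, union_subset hAB (hD1.trans sdiff_subset), hA.union hD2, ?_⟩
  rw [measure_union (disjoint_left.2 fun x hx hxD => (hD1 hxD).2 hx) hD2, hD3]

/-- A monotone sequence of measurable sets of finite measure can be refined by halving the
measure of all its increments. -/
theorem Nonatomic.exists_refinement (hμ : Nonatomic μ)
    (s : {s : ℕ → Set α // Monotone s ∧ ∀ k, MeasurableSet (s k) ∧ μ (s k) ≠ ∞}) :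
    ∃ s' : {s : ℕ → Set α // Monotone s ∧ ∀ k, MeasurableSet (s k) ∧ μ (s k) ≠ ∞},
      ∀ k, s'.1 (2 * k) = s.1 k ∧
        μ (s'.1 (2 * k + 1) \ s'.1 (2 * k)) = μ (s.1 (k + 1) \ s.1 k) / 2 ∧
        μ (s'.1 (2 * k + 2) \ s'.1 (2 * k + 1)) = μ (s.1 (k + 1) \ s.1 k) / 2 := by
  obtain ⟨s, hs, hm⟩ := s
  have h : ∀ k, ∃ C, s k ⊆ C ∧ C ⊆ s (k + 1) ∧ MeasurableSet C ∧
      μ C = μ (s k) + μ (s (k + 1) \ s k) / 2 := fun k =>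
    hμ.exists_between_measure_eq (hm k).1 (hm (k + 1)).1 (hs k.le_succ) (hm (k + 1)).2
  choose C h1 h2 h3 h4 using h
  let s' : ℕ → Set α := fun j => if j % 2 = 0 then s (j / 2) else C (j / 2)
  have he : ∀ k, s' (2 * k) = s k := fun k => by simp [s']
  have ho : ∀ k, s' (2 * k + 1) = C k := fun k => by
    have h1 : (2 * k + 1) % 2 = 1 := by omega
    have h2 : (2 * k + 1) / 2 = k := by omega
    simp [s', h1, h2]
  have hCfin : ∀ k, μ (C k) ≠ ∞ := fun k => ne_top_of_le_ne_top (hm _).2 (measure_mono (h2 k))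
  refine ⟨⟨s', monotone_nat_of_le_succ fun j => ?_, fun j => ?_⟩, fun k => ⟨he k, ?_, ?_⟩⟩
  · obtain ⟨k, rfl | rfl⟩ : ∃ k, j = 2 * k ∨ j = 2 * k + 1 := ⟨j / 2, by omega⟩
    · rw [he, ho]; exact h1 k
    · rw [ho, show 2 * k + 1 + 1 = 2 * (k + 1) by ring, he]; exact h2 k
  · obtain ⟨k, rfl | rfl⟩ : ∃ k, j = 2 * k ∨ j = 2 * k + 1 := ⟨j / 2, by omega⟩
    · rw [he]; exact hm k
    · rw [ho]; exact ⟨h3 k, hCfin k⟩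
  · change μ (s' (2 * k + 1) \ s' (2 * k)) = _
    rw [he, ho, measure_sdiff (h1 k) (hm k).1.nullMeasurableSet (hm k).2, h4,
      ENNReal.add_sub_cancel_left (hm k).2]
  · change μ (s' (2 * k + 2) \ s' (2 * k + 1)) = _
    rw [show 2 * k + 2 = 2 * (k + 1) by ring, he, ho]
    have hd : μ (s (k + 1) \ s k) ≠ ∞ := ne_top_of_le_ne_top (hm _).2 (measure_mono sdiff_subset)
    have hsum : μ (s (k + 1)) = μ (s k) + μ (s (k + 1) \ s k) := by
      rw [add_comm (μ (s k)), ← measure_union disjoint_sdiff_left (hm k).1,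
        sdiff_union_of_subset (hs k.le_succ)]
    rw [measure_sdiff (h2 k) (h3 k).nullMeasurableSet (hCfin k), h4, hsum,
      ENNReal.add_sub_add_eq_sub_left (hm k).2, ENNReal.sub_half hd]

/-- In a nonatomic `σ`-finite measure space there is a countable chain of measurable sets of finite
measure whose measures are dense in `[0, μ univ]`. -/
theorem Nonatomic.exists_chain [SigmaFinite μ] (hμ : Nonatomic μ) :
    ∃ D : ℕ × ℕ → Set α, (∀ i, MeasurableSet (D i) ∧ μ (D i) ≠ ∞) ∧ (∀ i j, D i ⊆ D j ∨ D j ⊆ D i) ∧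
      (⋃ i, D i = univ) ∧
      ∀ r t : ℝ≥0∞, r < t → r < μ univ → ∃ i, r < μ (D i) ∧ μ (D i) < t := by
  choose next hnext using hμ.exists_refinement
  -- Starting from the empty set ensures that the first set of measure above `r`, chosen below, has
  -- a predecessor.
  let S0 : ℕ → Set α := fun k => Nat.casesOn k ∅ (spanningSets μ)
  have hS0 : Monotone S0 := monotone_nat_of_le_succ fun k => by
    cases k with
    | zero => exact empty_subset _
    | succ k => exact monotone_spanningSets μ k.le_succ
  have hS0m : ∀ k, MeasurableSet (S0 k) ∧ μ (S0 k) ≠ ∞ := fun k => by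
    cases k with
    | zero => simp [S0]
    | succ k => exact ⟨measurableSet_spanningSets μ k, (measure_spanningSets_lt_top μ k).ne⟩
  have hS0u : ⋃ k, S0 k = univ := by
    refine eq_univ_of_univ_subset ?_
    rw [← iUnion_spanningSets μ]
    exact iUnion_subset fun k => subset_iUnion S0 (k + 1)
  let D : ℕ → {s : ℕ → Set α // Monotone s ∧ ∀ k, MeasurableSet (s k) ∧ μ (s k) ≠ ∞} := fun n =>
    next^[n] ⟨S0, hS0, hS0m⟩
  have hD : ∀ n, D (n + 1) = next (D n) := fun n => Function.iterate_succ_apply' _ _ _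
  -- Each level reappears inside all finer ones, so two sets from different levels can be compared
  -- on a common level.
  have hlev : ∀ n m k, (D n).1 k = (D (n + m)).1 (k * 2 ^ m) := by
    intro n m
    induction m with
    | zero => intro k; simp
    | succ m ih =>
      intro k
      rw [ih, ← add_assoc, hD, pow_succ, ← mul_assoc, mul_comm _ 2, ((hnext _) _).1]
  have htop : ∀ n k, (D n).1 (k * 2 ^ n) = S0 k := fun n k => by
    have := hlev 0 n k
    rw [zero_add] at this
    exact this.symm
  -- The bound is local, inside `S0 K`: the increments of the spanning sets need not be uniformly
  -- bounded.
  have hgap : ∀ K n j, j < K * 2 ^ n → μ ((D n).1 (j + 1) \ (D n).1 j) ≤ μ (S0 K) / 2 ^ n := by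
    intro K n
    induction n with
    | zero =>
      intro j hj
      rw [pow_zero, div_one]
      exact measure_mono (sdiff_subset.trans (hS0 (show j + 1 ≤ K by omega)))
    | succ n ih =>
      intro j hj
      have hhalf : ∀ k, k < K * 2 ^ n → μ ((D n).1 (k + 1) \ (D n).1 k) / 2 ≤
          μ (S0 K) / 2 ^ (n + 1) := fun k hk => by
        rw [pow_succ, div_eq_mul_inv (μ (S0 K)), ENNReal.mul_inv (by simp) (by simp), ← mul_assoc,
          ← div_eq_mul_inv (μ (S0 K)), div_eq_mul_inv (μ (_ \ _))]
        gcongr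
        exact ih k hk
      rw [pow_succ, ← mul_assoc] at hj
      obtain ⟨k, rfl | rfl⟩ : ∃ k, j = 2 * k ∨ j = 2 * k + 1 := ⟨j / 2, by omega⟩
      · rw [hD, ((hnext _) _).2.1]
        exact hhalf k (by omega)
      · rw [hD, ((hnext _) _).2.2]
        exact hhalf k (by omega)
  refine ⟨fun i => (D i.1).1 i.2, fun i => (D i.1).2.2 i.2, fun i j => ?_, ?_, ?_⟩
  · change (D i.1).1 i.2 ⊆ (D j.1).1 j.2 ∨ (D j.1).1 j.2 ⊆ (D i.1).1 i.2
    rw [hlev i.1 j.1, hlev j.1 i.1, add_comm j.1 i.1]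
    exact (le_total _ _).imp (fun h => (D _).2.1 h) fun h => (D _).2.1 h
  · refine eq_univ_of_univ_subset ?_
    rw [← hS0u]
    refine iUnion_subset fun k => ?_
    have := htop 0 k
    rw [← this]
    exact subset_iUnion (fun i : ℕ × ℕ => (D i.1).1 i.2) (0, k * 2 ^ 0)
  · intro r t hrt hr
    obtain ⟨K, hK⟩ : ∃ K, r < μ (S0 K) := by
      rw [← hS0u, hS0.measure_iUnion] at hr
      exact lt_iSup_iff.1 hr
    have hfin := (hS0m K).2
    obtain ⟨n, hn⟩ : ∃ n : ℕ, μ (S0 K) / 2 ^ n < t - r := by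
      have : Tendsto (fun n : ℕ => μ (S0 K) * (2⁻¹ : ℝ≥0∞) ^ n) atTop (𝓝 (μ (S0 K) * 0)) :=
        ENNReal.Tendsto.const_mul
          (ENNReal.tendsto_pow_atTop_nhds_zero_of_lt_one (by simp)) (Or.inr hfin)
      rw [mul_zero] at this
      obtain ⟨n, hn⟩ := (this.eventually (gt_mem_nhds (tsub_pos_of_lt hrt))).exists
      exact ⟨n, by rwa [div_eq_mul_inv, ENNReal.inv_pow]⟩
    have hex : ∃ j, r < μ ((D n).1 j) := ⟨K * 2 ^ n, by rwa [htop]⟩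
    classical
    -- The predecessor of the first set with measure above `r` has measure at most `r`, and the gap
    -- is smaller than `t - r`.
    have hj := Nat.find_spec hex
    have hjmin : ∀ m < Nat.find hex, ¬ r < μ ((D n).1 m) := fun m => Nat.find_min hex
    have hjle : Nat.find hex ≤ K * 2 ^ n := Nat.find_min' hex (by rwa [htop])
    generalize Nat.find hex = j at hj hjmin hjle
    have h0 : (D n).1 0 = ∅ := by
      have := htop n 0
      rwa [zero_mul] at this
    cases j with
    | zero => simp [h0] at hj
    | succ j =>
      refine ⟨(n, j + 1), hj, ?_⟩
      have hle : μ ((D n).1 j) ≤ r := not_lt.1 (hjmin j j.lt_succ_self)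
      have hg := hgap K n j hjle
      calc μ ((D n).1 (j + 1)) = μ ((D n).1 j) + μ ((D n).1 (j + 1) \ (D n).1 j) := by
            rw [add_comm (μ _), ← measure_union disjoint_sdiff_left ((D n).2.2 j).1,
              sdiff_union_of_subset ((D n).2.1 j.le_succ)]
        _ < r + (t - r) := ENNReal.add_lt_add_of_le_of_lt
            (ne_top_of_le_ne_top ((D n).2.2 j).2 le_rfl) hle (hg.trans_lt hn)
        _ = t := add_tsub_cancel_of_le hrt.le

theorem measurableSet_interval (a : ℝ≥0∞) : MeasurableSet {t : ℝ | 0 < t ∧ ENNReal.ofReal t < a} :=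
  (measurableSet_lt measurable_const measurable_id).inter
    (measurableSet_lt ENNReal.measurable_ofReal measurable_const)

theorem intervalMeasure_Iio (a : ℝ≥0∞) (t : ℝ) :
    intervalMeasure a (Iio t) = min (ENNReal.ofReal t) a := by
  rw [intervalMeasure, Measure.restrict_apply measurableSet_Iio]
  rcases eq_or_ne a ∞ with rfl | ha
  · have : Iio t ∩ {t : ℝ | 0 < t ∧ ENNReal.ofReal t < ∞} = Ioo 0 t := by
      ext x; simp [and_comm]
    rw [this]; simp
  · have : Iio t ∩ {t : ℝ | 0 < t ∧ ENNReal.ofReal t < a} = Ioo 0 (min t a.toReal) := by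
      ext x
      simp only [mem_inter_iff, mem_Iio, mem_ofPred_eq, mem_Ioo, lt_min_iff]
      constructor
      · rintro ⟨h1, h2, h3⟩
        exact ⟨h2, h1, (ENNReal.ofReal_lt_iff_lt_toReal h2.le ha).1 h3⟩
      · rintro ⟨h1, h2, h3⟩
        exact ⟨h2, h1, (ENNReal.ofReal_lt_iff_lt_toReal h1.le ha).2 h3⟩
    rw [this, Real.volume_Ioo, sub_zero, ENNReal.ofReal_min, ENNReal.ofReal_toReal ha]

/-- A nonatomic `σ`-finite measure space maps onto the interval of the same length. -/
theorem Nonatomic.exists_map_eq [SigmaFinite μ] (hμ : Nonatomic μ) :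
    ∃ σ : α → ℝ, Measurable σ ∧ μ.map σ = intervalMeasure (μ univ) := by
  obtain ⟨D, hD, hchain, hcov, hdense⟩ := hμ.exists_chain
  classical
  -- The chain plays the part of the initial segments `(0, t)`: the sublevel set `{σ' < t}` is the
  -- union of the members of measure less than `t`, and density of the measures makes its measure
  -- `min t (μ univ)`.
  let σ' : α → ℝ≥0∞ := fun x => ⨅ i, if x ∈ D i then μ (D i) else ∞
  have hσ' : Measurable σ' := Measurable.iInf fun i =>
    Measurable.ite (hD i).1 measurable_const measurable_const
  have hσfin : ∀ x, σ' x ≠ ∞ := fun x => by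
    obtain ⟨i, hi⟩ := mem_iUnion.1 (hcov.symm ▸ mem_univ x : x ∈ ⋃ i, D i)
    refine ne_top_of_le_ne_top (hD i).2 ((iInf_le _ i).trans ?_)
    simp [hi]
  have hset : ∀ t : ℝ≥0∞, {x | σ' x < t} = ⋃ i : {i // μ (D i) < t}, D i := fun t => by
    ext x
    simp only [σ', mem_ofPred_eq, iInf_lt_iff, mem_iUnion, Subtype.exists, exists_prop]
    refine exists_congr fun i => ?_
    by_cases hx : x ∈ D i <;> simp [hx]
  have hlt : ∀ t : ℝ≥0∞, μ {x | σ' x < t} = min t (μ univ) := fun t => by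
    refine le_antisymm (le_min ?_ (measure_mono (subset_univ _))) ?_
    · rw [hset, Directed.measure_iUnion]
      · exact iSup_le fun i => i.2.le
      · intro i j
        rcases hchain i j with h | h
        · exact ⟨j, h, Subset.rfl⟩
        · exact ⟨i, Subset.rfl, h⟩
    · refine le_of_forall_lt fun r hr => ?_
      obtain ⟨i, hi1, hi2⟩ := hdense r t (hr.trans_le (min_le_left _ _))
        (hr.trans_le (min_le_right _ _))
      refine hi1.trans_le (measure_mono ?_)
      rw [hset]
      exact subset_iUnion (fun i : {i // μ (D i) < t} => D i) ⟨i, hi2⟩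
  have hσ : Measurable fun x => (σ' x).toReal := hσ'.ennreal_toReal
  have hIio : ∀ t : ℝ, μ.map (fun x => (σ' x).toReal) (Iio t) =
      intervalMeasure (μ univ) (Iio t) := fun t => by
    rw [Measure.map_apply hσ measurableSet_Iio, intervalMeasure_Iio, ← hlt]
    congr 1
    ext x
    simp [ENNReal.lt_ofReal_iff_toReal_lt (hσfin x)]
  have hfin : ∀ t : ℝ, intervalMeasure (μ univ) (Iio t) ≠ ∞ := fun t => by
    rw [intervalMeasure_Iio]
    exact ne_top_of_le_ne_top ENNReal.ofReal_ne_top (min_le_left _ _)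
  refine ⟨_, hσ, (Measure.ext_of_Ico' _ _ (fun a b _ => ?_) fun a b hab => ?_)⟩
  · refine ne_top_of_le_ne_top (hfin b) (le_of_le_of_eq ?_ (hIio b))
    exact measure_mono Ico_subset_Iio_self
  · have hIco : Ico a b = Iio b \ Iio a := by ext x; simp
    rw [hIco, measure_sdiff (Iio_subset_Iio hab.le) measurableSet_Iio.nullMeasurableSet
      (hIio a ▸ hfin a), measure_sdiff (Iio_subset_Iio hab.le) measurableSet_Iio.nullMeasurableSet
      (hfin a), hIio, hIio]

end Nonatomic

/-! ### The norm of the representation space. -/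

section RepNorm

variable {α : Type*} [MeasurableSpace α] {μ : Measure α}

/-- The pullback along a measure-preserving map is a representative equimeasurable with `h`. As the
same `σ` serves every `h`, the axioms of `X` for sums, multiples and limits carry over to the
representation space. -/
theorem RINorm.repNorm_eq_comp (X : RINorm μ) {σ : α → ℝ} (hσ : Measurable σ)
    (hmap : μ.map σ = intervalMeasure (μ univ)) {h : ℝ → ℝ≥0∞} (hh : Measurable h) :
    X.repNorm h = X.norm (h ∘ σ) := by
  refine X.repNorm_eq (hh.comp hσ) fun s _ _ => ?_
  rw [← hmap, Measure.map_apply hσ (measurableSet_lt measurable_const hh)]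
  rfl

theorem RINorm.repNorm_congr (X : RINorm μ) {h₁ h₂ : ℝ → ℝ≥0∞}
    (h : Equimeasurable (intervalMeasure (μ univ)) h₁ (intervalMeasure (μ univ)) h₂) :
    X.repNorm h₁ = X.repNorm h₂ := by
  have : ∀ f : α → ℝ≥0∞, Equimeasurable μ f (intervalMeasure (μ univ)) h₁ ↔
      Equimeasurable μ f (intervalMeasure (μ univ)) h₂ := fun f =>
    ⟨fun hf s h0 h1 => (hf s h0 h1).trans (h s h0 h1),
      fun hf s h0 h1 => (hf s h0 h1).trans (h s h0 h1).symm⟩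
  simp only [RINorm.repNorm, this]

variable [SigmaFinite μ]

theorem RINorm.repNorm_mono (X : RINorm μ) (hμ : Nonatomic μ) {h₁ h₂ : ℝ → ℝ≥0∞}
    (m₁ : Measurable h₁) (m₂ : Measurable h₂) (h : h₁ ≤ᵐ[intervalMeasure (μ univ)] h₂) :
    X.repNorm h₁ ≤ X.repNorm h₂ := by
  obtain ⟨σ, hσ, hmap⟩ := hμ.exists_map_eq
  rw [X.repNorm_eq_comp hσ hmap m₁, X.repNorm_eq_comp hσ hmap m₂]
  refine X.norm_mono _ _ (m₁.comp hσ) (m₂.comp hσ) ?_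
  rw [← hmap] at h
  exact ae_of_ae_map hσ.aemeasurable h

theorem RINorm.repNorm_add_le (X : RINorm μ) (hμ : Nonatomic μ) {h₁ h₂ : ℝ → ℝ≥0∞}
    (m₁ : Measurable h₁) (m₂ : Measurable h₂) :
    X.repNorm (fun t => h₁ t + h₂ t) ≤ X.repNorm h₁ + X.repNorm h₂ := by
  obtain ⟨σ, hσ, hmap⟩ := hμ.exists_map_eq
  rw [X.repNorm_eq_comp hσ hmap m₁, X.repNorm_eq_comp hσ hmap m₂,
    X.repNorm_eq_comp hσ hmap (h := fun t => h₁ t + h₂ t) (m₁.add m₂)]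
  exact X.norm_add_le _ _ (m₁.comp hσ) (m₂.comp hσ)

theorem RINorm.repNorm_smul (X : RINorm μ) (hμ : Nonatomic μ) (c : ℝ≥0) {h : ℝ → ℝ≥0∞}
    (m : Measurable h) : X.repNorm (fun t => c * h t) = c * X.repNorm h := by
  obtain ⟨σ, hσ, hmap⟩ := hμ.exists_map_eq
  rw [X.repNorm_eq_comp hσ hmap m, X.repNorm_eq_comp hσ hmap (m.const_mul _)]
  exact X.norm_smul c _ (m.comp hσ)

theorem RINorm.repNorm_tendsto (X : RINorm μ) (hμ : Nonatomic μ) {h : ℕ → ℝ → ℝ≥0∞}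
    {g : ℝ → ℝ≥0∞} (m : ∀ n, Measurable (h n)) (mg : Measurable g)
    (hm : ∀ t, Monotone fun n => h n t) (ht : ∀ t, Tendsto (fun n => h n t) atTop (𝓝 (g t))) :
    Tendsto (fun n => X.repNorm (h n)) atTop (𝓝 (X.repNorm g)) := by
  obtain ⟨σ, hσ, hmap⟩ := hμ.exists_map_eq
  rw [X.repNorm_eq_comp hσ hmap mg]
  simp only [fun n => X.repNorm_eq_comp hσ hmap (m n)]
  exact X.norm_tendsto _ _ (fun n => (m n).comp hσ) (mg.comp hσ)
    (Eventually.of_forall fun x => ⟨hm _, ht _⟩)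

theorem RINorm.ae_lt_top (X : RINorm μ) {f : α → ℝ≥0∞} (hf : Measurable f) (h : X.norm f < ∞) :
    ∀ᵐ x ∂μ, f x < ∞ := by
  refine ae_of_forall_measure_lt_top_ae_restrict _ fun s hs hfin => ?_
  obtain ⟨C, hC⟩ := X.setLIntegral_le s hs hfin
  exact MeasureTheory.ae_lt_top hf ((hC f hf).trans_lt (ENNReal.mul_lt_top ENNReal.coe_lt_top h)).ne

theorem RINorm.repNorm_ae_lt_top (X : RINorm μ) (hμ : Nonatomic μ) {h : ℝ → ℝ≥0∞}
    (m : Measurable h) (hfin : X.repNorm h < ∞) :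
    ∀ᵐ t ∂(intervalMeasure (μ univ)), h t < ∞ := by
  obtain ⟨σ, hσ, hmap⟩ := hμ.exists_map_eq
  rw [X.repNorm_eq_comp hσ hmap m] at hfin
  rw [← hmap, ae_map_iff hσ.aemeasurable (measurableSet_lt m measurable_const)]
  exact X.ae_lt_top (m.comp hσ) hfin

theorem RINorm.repNorm_eq_zero_iff (X : RINorm μ) (hμ : Nonatomic μ) {h : ℝ → ℝ≥0∞}
    (m : Measurable h) : X.repNorm h = 0 ↔ ∀ᵐ t ∂(intervalMeasure (μ univ)), h t = 0 := by
  obtain ⟨σ, hσ, hmap⟩ := hμ.exists_map_eq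
  rw [X.repNorm_eq_comp hσ hmap m, X.norm_eq_zero_iff _ (m.comp hσ), ← hmap,
    ae_map_iff hσ.aemeasurable (measurableSet_eq_fun m measurable_const)]
  rfl

end RepNorm

/-! ### Rearrangements and the subadditivity of their integrals. -/

section Rearrangement

variable {α : Type*} [MeasurableSpace α] {μ : Measure α} {f g : α → ℝ≥0∞}

/-- The rearrangement is the generalized inverse of the distribution function; the strict
inequalities match because the distribution function is right-continuous. Facts about rearrangements
are reduced to level sets through this equivalence. -/
theorem lt_rearr_iff {s : ℝ≥0∞} {t : ℝ} :
    s < rearr μ f t ↔ ENNReal.ofReal t < μ {x | s < f x} := by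
  constructor
  · intro h
    by_contra! hle
    obtain ⟨u, hsu, hu⟩ := exists_between h
    refine absurd hu (not_lt.2 (sInf_le ⟨bot_le.trans_lt hsu, le_trans (measure_mono ?_) hle⟩))
    exact fun x hx => hsu.trans hx
  · intro h
    have hs : s < ∞ := by
      by_contra! htop
      rw [top_le_iff.1 htop] at h
      simp at h
    obtain ⟨u, hu, hus, hut⟩ := exists_seq_strictAnti_tendsto' hs
    have hset : {x | s < f x} = ⋃ n, {x | u n < f x} := by
      ext x
      simp only [mem_ofPred_eq, mem_iUnion]
      exact ⟨fun hx => (hut.eventually (gt_mem_nhds hx)).exists, fun ⟨n, hn⟩ => (hus n).1.trans hn⟩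
    have hmono : Monotone fun n => {x | u n < f x} := fun m n hmn x (hx : u m < f x) =>
      (hu.antitone hmn).trans_lt hx
    rw [hset, hmono.measure_iUnion] at h
    obtain ⟨n, hn⟩ := lt_iSup_iff.1 h
    refine (hus n).1.trans_le (le_sInf fun v hv => ?_)
    by_contra! hvu
    exact absurd (hn.trans_le (measure_mono fun x (hx : u n < f x) => hvu.trans hx)) (not_lt.2 hv.2)

theorem rearr_antitone : Antitone (rearr μ f) := fun s t hst =>
  le_of_forall_lt fun u hu => by
    rw [lt_rearr_iff] at hu ⊢
    exact (ENNReal.ofReal_le_ofReal hst).trans_lt hu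

theorem measurable_rearr : Measurable (rearr μ f) := rearr_antitone.measurable

theorem rearr_mono (h : f ≤ᵐ[μ] g) (t : ℝ) : rearr μ f t ≤ rearr μ g t :=
  le_of_forall_lt fun u hu => by
    rw [lt_rearr_iff] at hu ⊢
    exact hu.trans_le (measure_mono_ae (h.mono fun x hx (hu : u < f x) => hu.trans_le hx))

theorem rearr_congr (h : f =ᵐ[μ] g) : rearr μ f = rearr μ g :=
  funext fun t => (rearr_mono h.le t).antisymm (rearr_mono h.symm.le t)

theorem rearr_const_mul {c : ℝ≥0∞} (h0 : c ≠ 0) (hc : c ≠ ∞) (t : ℝ) :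
    rearr μ (fun x => c * f x) t = c * rearr μ f t := by
  refine eq_of_forall_lt_iff fun u => ?_
  have : ∀ y, u < c * y ↔ u / c < y := fun y => by
    rw [ENNReal.div_lt_iff (Or.inl h0) (Or.inl hc), mul_comm]
  rw [lt_rearr_iff, this, lt_rearr_iff]
  simp only [this]

theorem rearr_iSup {f : ℕ → α → ℝ≥0∞} (hf : ∀ x, Monotone fun n => f n x) (t : ℝ) :
    rearr μ (fun x => ⨆ n, f n x) t = ⨆ n, rearr μ (f n) t := by
  refine eq_of_forall_lt_iff fun u => ?_
  have hmono : Monotone fun n => {x | u < f n x} := fun m n hmn x (hx : u < f m x) =>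
    hx.trans_le (hf x hmn)
  have hset : {x | u < ⨆ n, f n x} = ⋃ n, {x | u < f n x} := by
    ext x
    simp [lt_iSup_iff]
  rw [lt_rearr_iff, hset, hmono.measure_iUnion]
  simp only [lt_iSup_iff, lt_rearr_iff]

theorem intervalMeasure_univ (a : ℝ≥0∞) : intervalMeasure a univ = a := by
  have hm : Monotone fun n : ℕ => Iio (n : ℝ) := fun m n hmn =>
      Iio_subset_Iio (by exact_mod_cast hmn)
  have hu : (⋃ n : ℕ, Iio (n : ℝ)) = univ :=
    eq_univ_of_forall fun x => mem_iUnion.2 (exists_nat_gt x)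
  have ht := tendsto_measure_iUnion_atTop (μ := intervalMeasure a) hm
  rw [hu] at ht
  refine tendsto_nhds_unique ht ?_
  simp only [Function.comp_def, intervalMeasure_Iio, ENNReal.ofReal_natCast]
  have := ENNReal.tendsto_nat_nhds_top.min (tendsto_const_nhds (x := a))
  simpa using this

theorem volume_interval (a : ℝ≥0∞) : volume {t : ℝ | 0 < t ∧ ENNReal.ofReal t < a} = a := by
  simpa [intervalMeasure] using intervalMeasure_univ a

theorem volume_restrict_Ioi_lt (a : ℝ≥0∞) :
    volume.restrict (Ioi (0 : ℝ)) {s | ENNReal.ofReal s < a} = a := by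
  rw [Measure.restrict_apply (measurableSet_lt ENNReal.measurable_ofReal measurable_const)]
  convert volume_interval a using 2
  ext x
  simp [and_comm]

theorem lintegral_eq_lintegral_meas_ofReal_lt [SFinite μ] (hf : Measurable f) :
    ∫⁻ x, f x ∂μ = ∫⁻ s in Ioi (0 : ℝ), μ {x | ENNReal.ofReal s < f x} := by
  have hS : MeasurableSet {z : α × ℝ | ENNReal.ofReal z.2 < f z.1} :=
    measurableSet_lt (ENNReal.measurable_ofReal.comp measurable_snd) (hf.comp measurable_fst)
  have h := Measure.prod_apply_symm (μ := μ) (ν := volume.restrict (Ioi (0 : ℝ))) hS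
  rw [Measure.prod_apply hS] at h
  refine Eq.trans (lintegral_congr fun x => ?_) h
  exact (volume_restrict_Ioi_lt (f x)).symm

/-- Layer cake with respect to an arbitrary `ρ`: Lebesgue measure gives `∫ f^* = ∫ f`, and `φ_X'(t)
dt` gives the level-set form of the Lorentz functional. -/
theorem lintegral_rearr (ρ : Measure ℝ) [SFinite ρ] :
    ∫⁻ t, rearr μ f t ∂ρ =
      ∫⁻ s in Ioi (0 : ℝ), ρ {t | ENNReal.ofReal t < μ {x | ENNReal.ofReal s < f x}} := by
  rw [lintegral_eq_lintegral_meas_ofReal_lt measurable_rearr]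
  simp only [lt_rearr_iff]

theorem lintegral_rearr_Ioi [SFinite μ] (hf : Measurable f) :
    ∫⁻ t in Ioi (0 : ℝ), rearr μ f t = ∫⁻ x, f x ∂μ := by
  rw [lintegral_rearr, lintegral_eq_lintegral_meas_ofReal_lt hf]
  simp only [volume_restrict_Ioi_lt]

theorem rearr_le_add_rearr_tsub (c : ℝ≥0∞) (t : ℝ) :
    rearr μ f t ≤ c + rearr μ (fun x => f x - c) t := by
  refine le_of_forall_lt fun u hu => ?_
  rcases lt_or_ge u c with h | h
  · exact h.trans_le le_self_add
  · rcases eq_or_ne c ∞ with rfl | hc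
    · simpa using hu.trans_le le_top
    rw [← add_tsub_cancel_of_le h]
    refine ENNReal.add_lt_add_left hc (lt_rearr_iff.2 ((lt_rearr_iff.1 hu).trans_le ?_))
    refine measure_mono fun x (hx : u < f x) => ?_
    change u - c < f x - c
    rwa [lt_tsub_iff_left, add_tsub_cancel_of_le h]

theorem add_rearr_tsub_le {c : ℝ≥0∞} {t : ℝ} (h : c ≤ rearr μ f t) :
    c + rearr μ (fun x => f x - c) t ≤ rearr μ f t := by
  refine le_of_forall_lt fun v hv => ?_
  rcases lt_or_ge v c with hvc | hvc
  · exact hvc.trans_le h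
  · have hc : c ≠ ∞ := by
      rintro rfl
      simp [top_le_iff.1 hvc] at hv
    rw [← add_tsub_cancel_of_le hvc, ENNReal.add_lt_add_iff_left hc, lt_rearr_iff] at hv
    refine lt_rearr_iff.2 (hv.trans_le (measure_mono fun x (hx : v - c < f x - c) => ?_))
    rw [lt_tsub_iff_left, add_tsub_cancel_of_le hvc] at hx
    exact hx

/-- The integral of the rearrangement over `(0, t)`. -/
def rearrInt (μ : Measure α) (f : α → ℝ≥0∞) (t : ℝ) : ℝ≥0∞ := ∫⁻ s in Ioo 0 t, rearr μ f s

theorem rearrInt_monotone : Monotone (rearrInt μ f) := fun _ _ hst =>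
  lintegral_mono_set (Ioo_subset_Ioo_right hst)

/-- Together with `le_rearrInt` this is the variational formula `∫_0^t f^* = min_c (t c + ∫ (f -
c)_+)`, with the minimum attained at `c = f^*(t)`. -/
theorem rearrInt_le [SFinite μ] (hf : Measurable f) (c : ℝ≥0∞) (t : ℝ) :
    rearrInt μ f t ≤ ENNReal.ofReal t * c + ∫⁻ x, f x - c ∂μ := by
  calc rearrInt μ f t ≤ ∫⁻ s in Ioo 0 t, (c + rearr μ (fun x => f x - c) s) :=
        lintegral_mono fun s => rearr_le_add_rearr_tsub c s
    _ = c * ENNReal.ofReal t + ∫⁻ s in Ioo 0 t, rearr μ (fun x => f x - c) s := by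
        rw [lintegral_add_left measurable_const]; simp
    _ ≤ ENNReal.ofReal t * c + ∫⁻ s in Ioi (0 : ℝ), rearr μ (fun x => f x - c) s := by
        rw [mul_comm]
        gcongr
        exact Ioo_subset_Ioi_self
    _ = _ := by rw [lintegral_rearr_Ioi (hf.sub_const c)]

theorem le_rearrInt [SFinite μ] (hf : Measurable f) (t : ℝ) :
    ENNReal.ofReal t * rearr μ f t + ∫⁻ x, f x - rearr μ f t ∂μ ≤ rearrInt μ f t := by
  set c := rearr μ f t with hc
  rw [← lintegral_rearr_Ioi (hf.sub_const c)]
  have hzero : ∀ s, t ≤ s → rearr μ (fun x => f x - c) s = 0 := fun s hs => by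
    rw [← not_lt.trans nonpos_iff_eq_zero, lt_rearr_iff, not_lt]
    simp only [tsub_pos_iff_lt]
    have : ¬ c < rearr μ f t := by simp [hc]
    rw [lt_rearr_iff, not_lt] at this
    exact this.trans (ENNReal.ofReal_le_ofReal hs)
  have hind : ∫⁻ s in Ioi (0 : ℝ), rearr μ (fun x => f x - c) s =
      ∫⁻ s in Ioo 0 t, rearr μ (fun x => f x - c) s := by
    rw [← lintegral_indicator measurableSet_Ioi, ← lintegral_indicator measurableSet_Ioo]
    congr with s
    by_cases h0 : 0 < s <;> by_cases h1 : s < t <;> simp [h0, h1]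
    exact hzero s (not_lt.1 h1)
  rw [hind]
  calc ENNReal.ofReal t * c + ∫⁻ s in Ioo 0 t, rearr μ (fun x => f x - c) s
      = ∫⁻ s in Ioo 0 t, (c + rearr μ (fun x => f x - c) s) := by
        rw [lintegral_add_left measurable_const]; simp [mul_comm]
    _ ≤ rearrInt μ f t := setLIntegral_mono' measurableSet_Ioo fun s hs =>
        add_rearr_tsub_le (rearr_antitone hs.2.le)

/-- In the variational formula for the sum, test with `c = f^*(t) + g^*(t)`, for which `(f + g -
c)_+` is at most the sum of the separate excesses. -/
theorem rearrInt_add_le [SFinite μ] (hf : Measurable f) (hg : Measurable g) (t : ℝ) :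
    rearrInt μ (fun x => f x + g x) t ≤ rearrInt μ f t + rearrInt μ g t := by
  set a := rearr μ f t
  set b := rearr μ g t
  calc rearrInt μ (fun x => f x + g x) t
      ≤ ENNReal.ofReal t * (a + b) + ∫⁻ x, f x + g x - (a + b) ∂μ := rearrInt_le (hf.add hg) _ t
    _ ≤ ENNReal.ofReal t * (a + b) + ∫⁻ x, (f x - a) + (g x - b) ∂μ := by
        gcongr with x
        exact add_tsub_add_le_tsub_add_tsub
    _ = (ENNReal.ofReal t * a + ∫⁻ x, f x - a ∂μ) + (ENNReal.ofReal t * b + ∫⁻ x, g x - b ∂μ) := by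
        rw [lintegral_add_left (hf.sub_const a)]; ring
    _ ≤ _ := add_le_add (le_rearrInt hf t) (le_rearrInt hg t)

theorem rearrInt_const_mul {c : ℝ≥0∞} (h0 : c ≠ 0) (hc : c ≠ ∞) (t : ℝ) :
    rearrInt μ (fun x => c * f x) t = c * rearrInt μ f t := by
  simp only [rearrInt, rearr_const_mul h0 hc]
  exact lintegral_const_mul _ measurable_rearr

theorem rearrInt_mono (h : f ≤ᵐ[μ] g) (t : ℝ) : rearrInt μ f t ≤ rearrInt μ g t :=
  lintegral_mono fun s => rearr_mono h s

theorem rearrInt_iSup {f : ℕ → α → ℝ≥0∞} (hf : ∀ x, Monotone fun n => f n x) (t : ℝ) :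
    rearrInt μ (fun x => ⨆ n, f n x) t = ⨆ n, rearrInt μ (f n) t := by
  simp only [rearrInt, rearr_iSup hf]
  exact lintegral_iSup (fun n => measurable_rearr) fun m n hmn s =>
    rearr_mono (Eventually.of_forall fun x => hf x hmn) s

/-- Minkowski's inequality for `f ↦ (∫_0^t (f^p)^*)^{1/p}`. -/
theorem rearrInt_rpow_add_le [SFinite μ] (hf : Measurable f) (hg : Measurable g) {p : ℝ}
    (hp : 1 ≤ p) (t : ℝ) :
    rearrInt μ (fun x => (f x + g x) ^ p) t ^ (1 / p) ≤
      rearrInt μ (fun x => f x ^ p) t ^ (1 / p) + rearrInt μ (fun x => g x ^ p) t ^ (1 / p) := by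
  have hp0 : 0 < p := by linarith
  set a := rearrInt μ (fun x => f x ^ p) t ^ (1 / p) with ha
  set b := rearrInt μ (fun x => g x ^ p) t ^ (1 / p) with hb
  have hap : rearrInt μ (fun x => f x ^ p) t = a ^ p := by
    rw [ha, ← ENNReal.rpow_mul, one_div_mul_cancel hp0.ne', ENNReal.rpow_one]
  have hbp : rearrInt μ (fun x => g x ^ p) t = b ^ p := by
    rw [hb, ← ENNReal.rpow_mul, one_div_mul_cancel hp0.ne', ENNReal.rpow_one]
  rcases eq_or_ne a ∞ with hat | hat
  · simp [hat]
  rcases eq_or_ne b ∞ with hbt | hbt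
  · simp [hbt]
  -- Minkowski from convexity: `(f + g)/(a' + b')` is a convex combination of `f/a'` and `g/b'`. The
  -- strictly larger `a'`, `b'` permit division when `a` or `b` is zero, and are let tend to them at
  -- the end.
  have key : ∀ a' b' : ℝ≥0∞, a < a' → b < b' → a' ≠ ∞ → b' ≠ ∞ →
      rearrInt μ (fun x => (f x + g x) ^ p) t ^ (1 / p) ≤ a' + b' := by
    intro a' b' haa hbb ha' hb'
    have ha0 : a' ≠ 0 := (bot_le.trans_lt haa).ne'
    have hb0 : b' ≠ 0 := (bot_le.trans_lt hbb).ne'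
    have hs0 : a' + b' ≠ 0 := by simp [ha0]
    have hst : a' + b' ≠ ∞ := by simp [ha', hb']
    set w₁ := a' / (a' + b') with hw₁
    set w₂ := b' / (a' + b') with hw₂
    have hw : w₁ + w₂ = 1 := by rw [hw₁, hw₂, ENNReal.div_add_div_same, ENNReal.div_self hs0 hst]
    have hw₁0 : w₁ ≠ 0 := by simp [hw₁, ha0, ha', hb']
    have hw₂0 : w₂ ≠ 0 := by simp [hw₂, hb0, ha', hb']
    have hw₁t : w₁ ≠ ∞ := ne_top_of_le_ne_top ENNReal.one_ne_top (hw ▸ le_self_add)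
    have hw₂t : w₂ ≠ ∞ := ne_top_of_le_ne_top ENNReal.one_ne_top (hw ▸ le_add_self)
    have hpt : ∀ x, (f x + g x) ^ p ≤
        (a' + b') ^ p * (w₁ * (a'⁻¹ ^ p * f x ^ p) + w₂ * (b'⁻¹ ^ p * g x ^ p)) := fun x => by
      have hfg : f x + g x = (a' + b') * (w₁ * (a'⁻¹ * f x) + w₂ * (b'⁻¹ * g x)) := by
        rw [mul_add, ← mul_assoc _ w₁, ← mul_assoc _ w₂, hw₁, hw₂, ENNReal.mul_div_cancel hs0 hst,
          ENNReal.mul_div_cancel hs0 hst, ← mul_assoc, ← mul_assoc, ENNReal.mul_inv_cancel ha0 ha',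
          ENNReal.mul_inv_cancel hb0 hb', one_mul, one_mul]
      conv_lhs => rw [hfg]
      rw [ENNReal.mul_rpow_of_nonneg (a' + b') _ hp0.le,
        ← ENNReal.mul_rpow_of_nonneg a'⁻¹ (f x) hp0.le,
        ← ENNReal.mul_rpow_of_nonneg b'⁻¹ (g x) hp0.le]
      refine mul_le_mul_right ?_ _
      exact ENNReal.rpow_arith_mean_le_arith_mean2_rpow _ _ _ _ hw hp
    have hcancel : ∀ c d : ℝ≥0∞, c < d → d ≠ ∞ → d⁻¹ ^ p * c ^ p ≤ 1 := fun c d hcd hd => by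
      rw [← ENNReal.mul_rpow_of_nonneg _ _ hp0.le]
      refine ENNReal.rpow_le_one ?_ hp0.le
      rw [mul_comm, ← div_eq_mul_inv]
      exact ENNReal.div_le_of_le_mul (by simpa using hcd.le)
    have hne : ∀ d : ℝ≥0∞, d ≠ 0 → d ≠ ∞ → d ^ p ≠ 0 ∧ d ^ p ≠ ∞ := fun d h0 h1 =>
      ⟨(ENNReal.rpow_pos (pos_iff_ne_zero.2 h0) h1).ne', ENNReal.rpow_ne_top_of_nonneg hp0.le h1⟩
    have hfm := (hf.pow_const p)
    have hgm := (hg.pow_const p)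
    have hia := hne _ (ENNReal.inv_ne_zero.2 ha') (ENNReal.inv_ne_top.2 ha0)
    have hib := hne _ (ENNReal.inv_ne_zero.2 hb') (ENNReal.inv_ne_top.2 hb0)
    rw [one_div, ENNReal.rpow_inv_le_iff hp0]
    calc rearrInt μ (fun x => (f x + g x) ^ p) t
        ≤ rearrInt μ (fun x => (a' + b') ^ p *
            (w₁ * (a'⁻¹ ^ p * f x ^ p) + w₂ * (b'⁻¹ ^ p * g x ^ p))) t :=
          rearrInt_mono (Eventually.of_forall hpt) t
      _ = (a' + b') ^ p * rearrInt μ (fun x =>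
            (w₁ * (a'⁻¹ ^ p * f x ^ p) + w₂ * (b'⁻¹ ^ p * g x ^ p))) t :=
          rearrInt_const_mul (hne _ hs0 hst).1 (hne _ hs0 hst).2 t
      _ ≤ (a' + b') ^ p * (rearrInt μ (fun x => w₁ * (a'⁻¹ ^ p * f x ^ p)) t +
            rearrInt μ (fun x => w₂ * (b'⁻¹ ^ p * g x ^ p)) t) := by
          gcongr
          exact rearrInt_add_le ((hfm.const_mul _).const_mul _) ((hgm.const_mul _).const_mul _) t
      _ ≤ (a' + b') ^ p * (w₁ * 1 + w₂ * 1) := by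
          rw [rearrInt_const_mul hw₁0 hw₁t, rearrInt_const_mul hia.1 hia.2, hap,
            rearrInt_const_mul hw₂0 hw₂t, rearrInt_const_mul hib.1 hib.2, hbp]
          gcongr
          · exact hcancel _ _ haa ha'
          · exact hcancel _ _ hbb hb'
      _ = (a' + b') ^ p := by simp [hw]
  have hlim : Tendsto (fun n : ℕ => (a + ((n : ℝ≥0∞) + 1)⁻¹) + (b + ((n : ℝ≥0∞) + 1)⁻¹)) atTop
      (𝓝 ((a + 0) + (b + 0))) := by
    have h0 : Tendsto (fun n : ℕ => ((n : ℝ≥0∞) + 1)⁻¹) atTop (𝓝 0) := by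
      have := (tendsto_add_atTop_iff_nat 1).2 ENNReal.tendsto_inv_nat_nhds_zero
      simpa using this
    exact (tendsto_const_nhds.add h0).add (tendsto_const_nhds.add h0)
  rw [add_zero, add_zero] at hlim
  refine ge_of_tendsto' hlim fun n => key _ _ ?_ ?_ ?_ ?_
  · exact ENNReal.lt_add_right hat (by simp)
  · exact ENNReal.lt_add_right hbt (by simp)
  · simp [hat]
  · simp [hbt]

end Rearrangement

/-! ### The space `Y^⟨p⟩`: norm axioms and completeness. -/

section MaxNorm

variable {β : Type*} [MeasurableSpace β] {ν : Measure β}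

/-- The functional `‖((h^p)^{**})^{1/p}‖_Ȳ` on nonnegative functions. -/
def RINorm.maxNorm (Y : RINorm ν) (p : ℝ) (h : β → ℝ≥0∞) : ℝ≥0∞ :=
  Y.repNorm fun t => maxRearr ν (fun x => h x ^ p) t ^ (1 / p)

theorem RINorm.powNorm_eq_maxNorm {𝕜 : Type*} [RCLike 𝕜] (Y : RINorm ν) (p : ℝ) (f : β →ₘ[ν] 𝕜) :
    Y.powNorm p f = Y.maxNorm p fun x => ‖f x‖ₑ := rfl

theorem maxRearr_eq (h : β → ℝ≥0∞) (t : ℝ) :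
    maxRearr ν h t = (ENNReal.ofReal t)⁻¹ * rearrInt ν h t := rfl

theorem measurable_maxRearr (h : β → ℝ≥0∞) : Measurable (maxRearr ν h) :=
  ENNReal.measurable_ofReal.inv.mul rearrInt_monotone.measurable

theorem measurable_maxRearr_rpow (h : β → ℝ≥0∞) (p : ℝ) :
    Measurable fun t => maxRearr ν (fun x => h x ^ p) t ^ (1 / p) :=
  (measurable_maxRearr _).pow_const _

theorem exists_mem_interval {P : ℝ → Prop} (h0 : ν univ ≠ 0)
    (h : ∀ᵐ t ∂(intervalMeasure (ν univ)), P t) : ∃ t, 0 < t ∧ P t := by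
  have : (ae (intervalMeasure (ν univ))).NeBot := by
    rw [ae_neBot, ← Measure.measure_univ_ne_zero, intervalMeasure_univ]
    exact h0
  have hmem : ∀ᵐ t ∂(intervalMeasure (ν univ)), 0 < t ∧ ENNReal.ofReal t < ν univ :=
    ae_restrict_mem (measurableSet_interval (ν univ))
  obtain ⟨t, ht, hPt⟩ := (hmem.and h).exists
  exact ⟨t, ht.1, hPt⟩

variable [SigmaFinite ν] (Y : RINorm ν) (hν : Nonatomic ν) {p : ℝ}
include hν

theorem RINorm.maxNorm_mono (hp : 1 ≤ p) {g h : β → ℝ≥0∞} (hgh : g ≤ᵐ[ν] h) :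
    Y.maxNorm p g ≤ Y.maxNorm p h := by
  have hp0 : 0 < p := by linarith
  refine Y.repNorm_mono hν (measurable_maxRearr_rpow _ _) (measurable_maxRearr_rpow _ _)
    (Eventually.of_forall fun t => ?_)
  refine ENNReal.rpow_le_rpow (mul_le_mul_right (rearrInt_mono ?_ t) _) (by positivity)
  exact hgh.mono fun x hx => ENNReal.rpow_le_rpow hx hp0.le

theorem RINorm.maxNorm_add_le (hp : 1 ≤ p) {g h : β → ℝ≥0∞} (hg : Measurable g)
    (hh : Measurable h) : Y.maxNorm p (fun x => g x + h x) ≤ Y.maxNorm p g + Y.maxNorm p h := by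
  refine le_trans (Y.repNorm_mono hν (measurable_maxRearr_rpow _ _)
    ((measurable_maxRearr_rpow g p).add (measurable_maxRearr_rpow h p))
    (Eventually.of_forall fun t => ?_))
    (Y.repNorm_add_le hν (measurable_maxRearr_rpow _ _) (measurable_maxRearr_rpow _ _))
  simp only [maxRearr_eq, ENNReal.mul_rpow_of_nonneg _ _ (by positivity : 0 ≤ 1 / p), Pi.add_apply,
    ← mul_add]
  exact mul_le_mul_right (rearrInt_rpow_add_le hg hh hp t) _

theorem RINorm.maxNorm_zero (hp : 1 ≤ p) : Y.maxNorm p (fun _ => 0) = 0 := by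
  have hp0 : 0 < p := by linarith
  rw [RINorm.maxNorm, Y.repNorm_eq_zero_iff hν (measurable_maxRearr_rpow _ _)]
  refine Eventually.of_forall fun t => ?_
  have h0 : rearrInt ν (fun _ => 0) t = 0 := by
    refine nonpos_iff_eq_zero.1 ((rearrInt_le measurable_const 0 t).trans ?_)
    simp
  simp [maxRearr_eq, hp0, h0]

theorem RINorm.maxNorm_const_mul (hp : 1 ≤ p) (c : ℝ≥0) (h : β → ℝ≥0∞) :
    Y.maxNorm p (fun x => c * h x) = c * Y.maxNorm p h := by
  have hp0 : 0 < p := by linarith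
  rcases eq_or_ne c 0 with rfl | hc
  · simp [Y.maxNorm_zero hν hp]
  have hcp : (c : ℝ≥0∞) ^ p ≠ 0 := (ENNReal.rpow_pos (by positivity) ENNReal.coe_ne_top).ne'
  have hct : (c : ℝ≥0∞) ^ p ≠ ∞ := ENNReal.rpow_ne_top_of_nonneg hp0.le ENNReal.coe_ne_top
  rw [RINorm.maxNorm, RINorm.maxNorm, ← Y.repNorm_smul hν c (measurable_maxRearr_rpow _ _)]
  congr with t
  simp only [maxRearr_eq, ENNReal.mul_rpow_of_nonneg _ _ hp0.le, rearrInt_const_mul hcp hct]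
  rw [mul_left_comm, ENNReal.mul_rpow_of_nonneg _ _ (by positivity), ← ENNReal.rpow_mul,
    mul_one_div_cancel hp0.ne', ENNReal.rpow_one]

theorem RINorm.maxNorm_tendsto (hp : 1 ≤ p) {h : ℕ → β → ℝ≥0∞} (hm : ∀ x, Monotone fun n => h n x) :
    Tendsto (fun n => Y.maxNorm p (h n)) atTop (𝓝 (Y.maxNorm p fun x => ⨆ n, h n x)) := by
  have hp0 : 0 < p := by linarith
  have hmp : ∀ x, Monotone fun n => h n x ^ p := fun x m n hmn =>
    ENNReal.rpow_le_rpow (hm x hmn) hp0.le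
  have hsup : ∀ x, (⨆ n, h n x) ^ p = ⨆ n, h n x ^ p := fun x =>
    tendsto_nhds_unique ((ENNReal.continuous_rpow_const.tendsto _).comp
      (tendsto_atTop_iSup (hm x))) (tendsto_atTop_iSup (hmp x))
  have hJ : ∀ t, Monotone fun n => rearrInt ν (fun x => h n x ^ p) t := fun t m n hmn =>
    rearrInt_mono (Eventually.of_forall fun x => hmp x hmn) t
  refine Y.repNorm_tendsto hν (fun n => measurable_maxRearr_rpow _ _)
    (measurable_maxRearr_rpow _ _) (fun t m n hmn => ?_) fun t => ?_
  · exact ENNReal.rpow_le_rpow (mul_le_mul_right (hJ t hmn) _) (by positivity)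
  · simp only [hsup, maxRearr_eq, rearrInt_iSup hmp]
    refine (ENNReal.continuous_rpow_const.tendsto _).comp ?_
    rw [ENNReal.mul_iSup]
    exact tendsto_atTop_iSup fun m n hmn => mul_le_mul_right (hJ t hmn) _

/-- The finite triangle inequality passes to the limit of the partial sums by the Fatou property. -/
theorem RINorm.maxNorm_tsum_le (hp : 1 ≤ p) {u : ℕ → β → ℝ≥0∞} (hu : ∀ n, Measurable (u n)) :
    Y.maxNorm p (fun x => ∑' n, u n x) ≤ ∑' n, Y.maxNorm p (u n) := by
  have hfin : ∀ n, Y.maxNorm p (fun x => ∑ i ∈ Finset.range n, u i x) ≤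
      ∑ i ∈ Finset.range n, Y.maxNorm p (u i) := by
    intro n
    induction n with
    | zero => simp [Y.maxNorm_zero hν hp]
    | succ n ih =>
      simp only [Finset.sum_range_succ]
      refine (Y.maxNorm_add_le hν hp (Finset.measurable_fun_sum _ fun i _ => hu i) (hu n)).trans ?_
      gcongr
  simp only [ENNReal.tsum_eq_iSup_nat]
  refine le_of_tendsto' (Y.maxNorm_tendsto hν hp fun x => ?_) fun n =>
    (hfin n).trans (le_iSup (fun n => ∑ i ∈ Finset.range n, Y.maxNorm p (u i)) n)
  exact fun m n hmn => Finset.sum_le_sum_of_subset (Finset.range_mono hmn)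

/-- Finiteness of `(h^p)^{**}` at a single `t` suffices: if `h = ∞` on a set of positive measure,
then `(h^p)^*` is infinite near 0 and so is its integral over `(0, t)`. -/
theorem RINorm.ae_lt_top_of_maxNorm (hp : 1 ≤ p) {h : β → ℝ≥0∞} (hfin : Y.maxNorm p h < ∞) :
    ∀ᵐ x ∂ν, h x < ∞ := by
  have hp0 : 0 < p := by linarith
  rcases eq_or_ne (ν univ) 0 with h0 | h0
  · rw [Measure.measure_univ_eq_zero.1 h0]; simp
  obtain ⟨t, ht, hlt⟩ := exists_mem_interval h0
    (Y.repNorm_ae_lt_top hν (measurable_maxRearr_rpow _ _) hfin)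
  by_contra hcon
  have hpos : 0 < ν {x | h x = ∞} := by
    rw [pos_iff_ne_zero]
    intro h1
    refine hcon ?_
    rw [ae_iff]
    simpa using h1
  obtain ⟨t', ht', htt, hlt'⟩ : ∃ t', 0 < t' ∧ t' ≤ t ∧ ENNReal.ofReal t' < ν {x | h x = ∞} := by
    obtain ⟨r, hr0, hr⟩ := ENNReal.lt_iff_exists_nnreal_btwn.1 hpos
    refine ⟨min t r, lt_min ht (by exact_mod_cast hr0), min_le_left _ _, lt_of_le_of_lt ?_ hr⟩
    rw [← ENNReal.ofReal_coe_nnreal]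
    exact ENNReal.ofReal_le_ofReal (min_le_right _ _)
  have hre : ∀ s ∈ Ioo 0 t', rearr ν (fun x => h x ^ p) s = ∞ := fun s hs => by
    refine ENNReal.eq_top_of_forall_nnreal_le fun r => (lt_rearr_iff.2 ?_).le
    refine (ENNReal.ofReal_le_ofReal hs.2.le).trans_lt (hlt'.trans_le (measure_mono ?_))
    intro x (hx : h x = ∞)
    simp [hx, hp0]
  have htop : rearrInt ν (fun x => h x ^ p) t = ∞ := by
    refine top_le_iff.1 (le_trans ?_ (rearrInt_monotone htt))
    rw [rearrInt, setLIntegral_congr_fun measurableSet_Ioo hre]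
    simp [ht']
  rw [maxRearr_eq, htop, ENNReal.mul_top (by simp), ENNReal.top_rpow_of_pos (by positivity)] at hlt
  exact hlt.false

theorem RINorm.maxNorm_eq_zero (hp : 1 ≤ p) {h : β → ℝ≥0∞} (hz : Y.maxNorm p h = 0) :
    h =ᵐ[ν] 0 := by
  have hp0 : 0 < p := by linarith
  rcases eq_or_ne (ν univ) 0 with h0 | h0
  · rw [Measure.measure_univ_eq_zero.1 h0]; simp [EventuallyEq]
  obtain ⟨t, ht, hlt⟩ := exists_mem_interval h0
    ((Y.repNorm_eq_zero_iff hν (measurable_maxRearr_rpow _ _)).1 hz)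
  rw [ENNReal.rpow_eq_zero_iff_of_pos (by positivity), maxRearr_eq, mul_eq_zero] at hlt
  replace hlt := hlt.resolve_left (by simp)
  rw [rearrInt, lintegral_eq_zero_iff measurable_rearr] at hlt
  by_contra hcon
  have hpos : 0 < ν {x | 0 < h x ^ p} := by
    rw [pos_iff_ne_zero]
    intro h1
    refine hcon ?_
    rw [EventuallyEq, ae_iff]
    simpa [hp0, pos_iff_ne_zero, hp0.le] using h1
  obtain ⟨r, hr0, hr⟩ := ENNReal.lt_iff_exists_nnreal_btwn.1 hpos
  have hvol : volume (Ioo 0 (min t r)) = 0 := by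
    refine measure_mono_null (fun s hs => ?_)
      ((ae_restrict_iff' measurableSet_Ioo).1 hlt : volume {s | ¬ (s ∈ Ioo 0 t →
        rearr ν (fun x => h x ^ p) s = (0 : ℝ → ℝ≥0∞) s)} = 0)
    intro hs'
    refine absurd (hs' ⟨hs.1, hs.2.trans_le (min_le_left _ _)⟩)
      (lt_rearr_iff.2 (lt_of_le_of_lt ?_ hr)).ne'
    rw [← ENNReal.ofReal_coe_nnreal]
    exact ENNReal.ofReal_le_ofReal (hs.2.le.trans (min_le_right _ _))
  simp only [Real.volume_Ioo, sub_zero, ENNReal.ofReal_eq_zero] at hvol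
  exact absurd (lt_min ht (by exact_mod_cast hr0)) (not_lt.2 hvol)

variable {𝕜 : Type*} [RCLike 𝕜]

theorem RINorm.powNorm_add_le (hp : 1 ≤ p) (f g : β →ₘ[ν] 𝕜) :
    Y.powNorm p (f + g) ≤ Y.powNorm p f + Y.powNorm p g := by
  simp only [RINorm.powNorm_eq_maxNorm]
  refine le_trans (Y.maxNorm_mono hν hp ?_)
    (Y.maxNorm_add_le hν hp f.measurable.enorm g.measurable.enorm)
  filter_upwards [AEEqFun.coeFn_add f g] with x hx
  rw [hx]
  exact enorm_add_le _ _

theorem RINorm.powNorm_smul (hp : 1 ≤ p) (c : 𝕜) (f : β →ₘ[ν] 𝕜) :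
    Y.powNorm p (c • f) = ‖c‖ₑ * Y.powNorm p f := by
  simp only [RINorm.powNorm_eq_maxNorm]
  rw [enorm_eq_nnnorm, ← Y.maxNorm_const_mul hν hp]
  have : (fun x => ‖(c • f) x‖ₑ) =ᵐ[ν] fun x => (‖c‖₊ : ℝ≥0∞) * ‖f x‖ₑ := by
    filter_upwards [AEEqFun.coeFn_smul c f] with x hx
    rw [hx, Pi.smul_apply, enorm_smul, enorm_eq_nnnorm c]
  exact (Y.maxNorm_mono hν hp this.le).antisymm (Y.maxNorm_mono hν hp this.symm.le)

theorem RINorm.powNorm_zero (hp : 1 ≤ p) : Y.powNorm p (0 : β →ₘ[ν] 𝕜) = 0 := by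
  have h := Y.powNorm_smul hν hp (0 : 𝕜) 0
  have h0 : (0 : 𝕜) • (0 : β →ₘ[ν] 𝕜) = 0 := zero_smul 𝕜 (0 : β →ₘ[ν] 𝕜)
  rwa [h0, enorm_zero, zero_mul] at h

theorem RINorm.powNorm_sub_le (hp : 1 ≤ p) (f g : β →ₘ[ν] 𝕜) :
    Y.powNorm p (f - g) ≤ Y.powNorm p f + Y.powNorm p g := by
  have h := Y.powNorm_smul hν hp (-1 : 𝕜) g
  have hneg : (-1 : 𝕜) • g = -g := neg_one_smul 𝕜 g
  rw [hneg, enorm_neg, enorm_one, one_mul] at h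
  rw [sub_eq_add_neg, ← h]
  exact Y.powNorm_add_le hν hp f (-g)

theorem RINorm.powNorm_eq_zero (hp : 1 ≤ p) {f : β →ₘ[ν] 𝕜} (hf : Y.powNorm p f = 0) : f = 0 := by
  refine AEEqFun.ext ?_
  filter_upwards [Y.maxNorm_eq_zero hν hp hf, AEEqFun.coeFn_zero (μ := ν) (β := 𝕜)] with x hx h0
  rw [h0]
  simpa using hx

/-- Completeness of `Y^⟨p⟩`. -/
theorem RINorm.exists_powNorm_sub_le_tsum (hp : 1 ≤ p) (v : ℕ → β →ₘ[ν] 𝕜)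
    (hv : ∑' n, Y.powNorm p (v (n + 1) - v n) < ∞) :
    ∃ g : β →ₘ[ν] 𝕜, ∀ n, Y.powNorm p (g - v n) ≤
      ∑' m, Y.powNorm p (v (n + m + 1) - v (n + m)) := by
  have hm : ∀ n, Measurable fun x => ‖(v (n + 1) - v n) x‖ₑ := fun n =>
    (v (n + 1) - v n).measurable.enorm
  -- Riesz–Fischer: the sum of the absolute increments has finite norm, hence is finite almost
  -- everywhere, and the sequence converges pointwise.
  have hfin : ∀ᵐ x ∂ν, ∑' n, ‖(v (n + 1) - v n) x‖ₑ < ∞ :=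
    Y.ae_lt_top_of_maxNorm hν hp ((Y.maxNorm_tsum_le hν hp hm).trans_lt hv)
  have hsub : ∀ᵐ x ∂ν, ∀ n, (v (n + 1) - v n) x = v (n + 1) x - v n x :=
    ae_all_iff.2 fun n => AEEqFun.coeFn_sub _ _
  have hdist : ∀ᵐ x ∂ν, ∀ n, edist (v n x) (v n.succ x) ≤ ‖(v (n + 1) - v n) x‖ₑ := by
    filter_upwards [hsub] with x hx n
    rw [hx, edist_comm, edist_eq_enorm_sub]
  obtain ⟨g, hg, hlim⟩ := exists_stronglyMeasurable_limit_of_tendsto_ae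
    (fun n => (v n).aestronglyMeasurable) (by
      filter_upwards [hdist, hfin] with x hx hx'
      exact cauchySeq_tendsto_of_complete (cauchySeq_of_edist_le_of_tsum_ne_top _ hx hx'.ne))
  refine ⟨AEEqFun.mk g hg.aestronglyMeasurable, fun n => ?_⟩
  refine le_trans (Y.maxNorm_mono hν hp ?_) (Y.maxNorm_tsum_le hν hp fun m => hm (n + m))
  filter_upwards [hdist, hlim, AEEqFun.coeFn_sub (AEEqFun.mk g hg.aestronglyMeasurable) (v n),
    AEEqFun.coeFn_mk g hg.aestronglyMeasurable] with x hx hl h1 h2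
  rw [h1, Pi.sub_apply, h2, ← edist_eq_enorm_sub, edist_comm]
  exact edist_le_tsum_of_edist_le_of_tendsto _ hx hl n

end MaxNorm

/-! ### Absolute continuity of the fundamental function away from zero. -/

section Fundamental

variable {α : Type*} [MeasurableSpace α] {μ : Measure α}

theorem setOf_lt_indicator_one {γ : Type*} (A : Set γ) (s : ℝ≥0∞) :
    {x | s < A.indicator (fun _ => (1 : ℝ≥0∞)) x} = if s < 1 then A else ∅ := by
  ext x
  by_cases hx : x ∈ A <;> by_cases hs : s < 1 <;> simp [hx, hs]

theorem equimeasurable_indicator {γ δ : Type*} [MeasurableSpace γ] [MeasurableSpace δ]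
    {ρ : Measure γ} {τ : Measure δ} {A : Set γ} {B : Set δ} (h : ρ A = τ B) :
    Equimeasurable ρ (A.indicator fun _ => 1) τ (B.indicator fun _ => 1) := fun s _ _ => by
  rw [setOf_lt_indicator_one, setOf_lt_indicator_one]
  split_ifs
  · exact h
  · simp

theorem intervalMeasure_Ioo (m : ℝ≥0∞) (a : ℝ) :
    intervalMeasure m (Ioo 0 a) = min (ENNReal.ofReal a) m := by
  rw [← intervalMeasure_Iio, intervalMeasure, Measure.restrict_apply measurableSet_Ioo,
    Measure.restrict_apply measurableSet_Iio]
  congr 1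
  ext x
  simp only [mem_inter_iff, mem_Ioo, mem_Iio, mem_ofPred_eq]
  tauto

theorem intervalMeasure_apply_of_subset {m : ℝ≥0∞} {a : ℝ} (ha : ENNReal.ofReal a ≤ m) {A : Set ℝ}
    (hA : MeasurableSet A) (h : A ⊆ Ioo 0 a) : intervalMeasure m A = volume A := by
  rw [intervalMeasure, Measure.restrict_apply hA, inter_eq_left.2]
  exact fun x hx => ⟨(h hx).1,
    ((ENNReal.ofReal_lt_ofReal_iff ((h hx).1.trans (h hx).2)).2 (h hx).2).trans_le ha⟩

theorem measurable_indicator_one {γ : Type*} [MeasurableSpace γ] {A : Set γ}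
    (hA : MeasurableSet A) : Measurable (A.indicator fun _ => (1 : ℝ≥0∞)) :=
  measurable_const.indicator hA

theorem RINorm.fundamental_eq_norm (X : RINorm μ) {E : Set α} (hE : MeasurableSet E)
    (hfin : μ E ≠ ∞) : X.fundamental (μ E).toReal = X.norm (E.indicator fun _ => 1) := by
  refine X.repNorm_eq (measurable_indicator_one hE) (equimeasurable_indicator ?_)
  rw [intervalMeasure_Ioo, ENNReal.ofReal_toReal hfin, min_eq_left (measure_mono (subset_univ E))]

variable [SigmaFinite μ] (X : RINorm μ) (hμ : Nonatomic μ)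
include hμ

theorem RINorm.fundamental_mono : Monotone X.fundamental := fun _ _ hst =>
  X.repNorm_mono hμ (measurable_indicator_one measurableSet_Ioo)
    (measurable_indicator_one measurableSet_Ioo) (Eventually.of_forall fun x =>
      indicator_le_indicator_of_subset (Ioo_subset_Ioo_right hst) (fun _ => bot_le) x)

theorem RINorm.fundamental_lt_top (t : ℝ) : X.fundamental t < ∞ := by
  obtain ⟨σ, hσ, hmap⟩ := hμ.exists_map_eq
  rw [RINorm.fundamental, X.repNorm_eq_comp hσ hmap (measurable_indicator_one measurableSet_Ioo)]
  refine X.norm_indicator_lt_top (σ ⁻¹' Ioo 0 t) (hσ measurableSet_Ioo) ?_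
  rw [← Measure.map_apply hσ measurableSet_Ioo, hmap, intervalMeasure_Ioo]
  exact (min_le_left _ _).trans_lt ENNReal.ofReal_lt_top

theorem RINorm.repNorm_sum_le {ι : Type*} (s : Finset ι) {h : ι → ℝ → ℝ≥0∞}
    (hh : ∀ i, Measurable (h i)) :
    X.repNorm (fun t => ∑ i ∈ s, h i t) ≤ ∑ i ∈ s, X.repNorm (h i) := by
  classical
  induction s using Finset.induction_on with
  | empty =>
    simp [(X.repNorm_eq_zero_iff hμ (h := fun _ => 0) measurable_const).2
      (Eventually.of_forall fun _ => rfl)]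
  | insert i s hi ih =>
    simp only [Finset.sum_insert hi]
    refine (X.repNorm_add_le hμ (hh i) (Finset.measurable_fun_sum _ fun j _ => hh j)).trans ?_
    gcongr

/-- Averaging the characteristic functions of the sets that arise from `(0, t)` by removing one of
`n` intervals of equal length. -/
theorem RINorm.mul_fundamental_le {t : ℝ} (ht : 0 < t) (htμ : ENNReal.ofReal t ≤ μ univ) {n : ℕ}
    (hn : 0 < n) : n * X.fundamental t ≤ X.fundamental t + n * X.fundamental (t - t / n) := by
  let P : ℕ → Set ℝ := fun i => Ioo 0 t \ Ico (i * (t / n)) ((i + 1) * (t / n))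
  have hP : ∀ i, MeasurableSet (P i) := fun i => measurableSet_Ioo.diff measurableSet_Ico
  have hd : 0 < t / n := by positivity
  have hsubI : ∀ i < n, Ioo (i * (t / n)) ((i + 1) * (t / n)) ⊆ Ioo 0 t := fun i hi => by
    refine Ioo_subset_Ioo (by positivity) ?_
    have : ((i : ℝ) + 1) ≤ n := by exact_mod_cast hi
    calc ((i : ℝ) + 1) * (t / n) ≤ n * (t / n) := by gcongr
      _ = t := by field_simp
  have hvol : ∀ i < n, intervalMeasure (μ univ) (P i) =
      intervalMeasure (μ univ) (Ioo 0 (t - t / n)) := fun i hi => by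
    rw [intervalMeasure_apply_of_subset htμ (hP i) sdiff_subset,
      intervalMeasure_apply_of_subset htμ measurableSet_Ioo
        (Ioo_subset_Ioo_right (by linarith))]
    have hnull : volume (P i) = volume (Ioo 0 t \ Ioo (i * (t / n)) ((i + 1) * (t / n))) :=
      measure_congr (EventuallyEq.diff (ae_eq_refl _) Ioo_ae_eq_Ico.symm)
    rw [hnull, measure_sdiff (hsubI i hi) measurableSet_Ioo.nullMeasurableSet (by simp),
      Real.volume_Ioo, Real.volume_Ioo, Real.volume_Ioo, ← ENNReal.ofReal_sub _ (by linarith)]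
    congr 1
    ring
  have hrep : ∀ i < n, X.repNorm ((P i).indicator fun _ => 1) = X.fundamental (t - t / n) :=
    fun i hi => X.repNorm_congr (equimeasurable_indicator (hvol i hi))
  have hpt : ∀ x, (n : ℝ≥0∞) * (Ioo 0 t).indicator (fun _ => 1) x ≤
      (Ioo 0 t).indicator (fun _ => 1) x +
        ∑ i ∈ Finset.range n, (P i).indicator (fun _ => (1 : ℝ≥0∞)) x := fun x => by
    by_cases hx : x ∈ Ioo 0 t
    -- A point lies in at most one of the removed intervals, the one indexed by this floor, so at
    -- least `n - 1` of the sets `P i` contain it.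
    · have h1 : ∀ i ∈ (Finset.range n).erase ⌊x / (t / n)⌋₊,
          (P i).indicator (fun _ => (1 : ℝ≥0∞)) x = 1 := fun i hi => by
        have hmem : x ∈ P i := ⟨hx, fun hxi => (Finset.mem_erase.1 hi).1 (?_ : i = _)⟩
        · exact indicator_of_mem hmem _
        rw [eq_comm, Nat.floor_eq_iff (by have := hx.1; positivity)]
        exact ⟨(le_div_iff₀ hd).2 hxi.1, (div_lt_iff₀ hd).2 hxi.2⟩
      rw [indicator_of_mem hx, mul_one]
      calc (n : ℝ≥0∞) ≤ 1 + ((Finset.range n).erase ⌊x / (t / n)⌋₊).card := by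
            have := Finset.pred_card_le_card_erase (s := Finset.range n) (a := ⌊x / (t / n)⌋₊)
            rw [Finset.card_range] at this
            have h2 : n ≤ 1 + ((Finset.range n).erase ⌊x / (t / n)⌋₊).card := by omega
            exact_mod_cast h2
        _ = 1 + ∑ i ∈ (Finset.range n).erase ⌊x / (t / n)⌋₊,
              (P i).indicator (fun _ => (1 : ℝ≥0∞)) x := by
            rw [Finset.sum_congr rfl h1]; simp
        _ ≤ _ := by
            gcongr
            exact Finset.erase_subset _ _
    · simp [indicator_of_notMem hx]
  have hI : Measurable ((Ioo 0 t).indicator fun _ => (1 : ℝ≥0∞)) :=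
    measurable_indicator_one measurableSet_Ioo
  have hPm : ∀ i, Measurable ((P i).indicator fun _ => (1 : ℝ≥0∞)) := fun i =>
    measurable_indicator_one (hP i)
  have hsm : Measurable fun x => ∑ i ∈ Finset.range n, (P i).indicator (fun _ => (1 : ℝ≥0∞)) x :=
    Finset.measurable_fun_sum _ fun i _ => hPm i
  calc n * X.fundamental t = X.repNorm fun x => n * (Ioo 0 t).indicator (fun _ => 1) x := by
        have := X.repNorm_smul hμ (n : ℝ≥0) hI
        simpa [RINorm.fundamental] using this.symm
    _ ≤ X.repNorm fun x => (Ioo 0 t).indicator (fun _ => 1) x +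
          ∑ i ∈ Finset.range n, (P i).indicator (fun _ => (1 : ℝ≥0∞)) x :=
        X.repNorm_mono hμ (hI.const_mul _) (hI.add hsm) (Eventually.of_forall hpt)
    _ ≤ X.fundamental t + ∑ i ∈ Finset.range n, X.repNorm ((P i).indicator fun _ => 1) :=
        (X.repNorm_add_le hμ hI hsm).trans (by gcongr; exacts [le_rfl, X.repNorm_sum_le hμ _ hPm])
    _ = X.fundamental t + n * X.fundamental (t - t / n) := by
        rw [Finset.sum_congr rfl fun i hi => hrep i (Finset.mem_range.1 hi)]
        simp

theorem RINorm.fundamental_toReal_mono : Monotone fun t => (X.fundamental t).toReal :=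
  fun _ _ hst => ENNReal.toReal_mono (X.fundamental_lt_top hμ _).ne (X.fundamental_mono hμ hst)

/-- For `n = ⌊t/h⌋` the averaging estimate gives `φ(t) - φ(t - h) ≤ φ(t)/n`, and `t/h < n + 1 ≤ 2n`
accounts for the factor 2. -/
theorem RINorm.fundamental_toReal_sub_le {t h : ℝ} (hh : 0 < h) (hht : h ≤ t)
    (htμ : ENNReal.ofReal t ≤ μ univ) :
    (X.fundamental t).toReal - (X.fundamental (t - h)).toReal ≤
      2 * (X.fundamental t).toReal / t * h := by
  have ht : 0 < t := hh.trans_le hht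
  set n := ⌊t / h⌋₊ with hn
  have hn0 : 0 < n := Nat.floor_pos.2 ((one_le_div hh).2 hht)
  have hn0' : (1 : ℝ) ≤ n := by exact_mod_cast hn0
  have hnle : (n : ℝ) ≤ t / h := Nat.floor_le (by positivity)
  have hnlt : t / h < n + 1 := Nat.lt_floor_add_one _
  have h1 := X.mul_fundamental_le hμ ht htμ hn0
  have hfin := fun s => (X.fundamental_lt_top hμ s).ne
  have h2 : X.fundamental (t - t / n) ≤ X.fundamental (t - h) := by
    refine X.fundamental_mono hμ ?_
    have : h ≤ t / n := by
      rw [le_div_iff₀ (by positivity), mul_comm]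
      exact (le_div_iff₀ hh).1 hnle
    linarith
  have h3 : n * X.fundamental t ≤ X.fundamental t + n * X.fundamental (t - h) :=
    h1.trans (by gcongr)
  have h4 := ENNReal.toReal_mono (by simp [hfin, ENNReal.mul_eq_top]) h3
  rw [ENNReal.toReal_add (hfin _) (by simp [hfin, ENNReal.mul_eq_top]), ENNReal.toReal_mul,
    ENNReal.toReal_mul, ENNReal.toReal_natCast] at h4
  set A := (X.fundamental t).toReal with hA
  set B := (X.fundamental (t - h)).toReal
  have h5 : t / h ≤ 2 * n := by linarith
  have h6 : n * (A - B) ≤ A := by linarith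
  have h7 : A ≤ 2 * n * (A / t * h) := by
    calc A = t / h * (A / t * h) := by field_simp
      _ ≤ 2 * n * (A / t * h) := by gcongr
  have h8 : (n : ℝ) * (A - B) ≤ n * (2 * A / t * h) := by
    refine h6.trans (h7.trans (le_of_eq ?_))
    ring
  exact le_of_mul_le_mul_left h8 (by positivity)

/-- On `[δ, a]` the fundamental function is Lipschitz, hence absolutely continuous. The constant `2
φ(a)/δ` blows up at 0, which is why the interval stays away from it. -/
theorem RINorm.integral_deriv_fundamental {δ a : ℝ} (hδ : 0 < δ) (hδa : δ ≤ a)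
    (haμ : ENNReal.ofReal a ≤ μ univ) :
    ∫⁻ s in Ioo δ a, ENNReal.ofReal (deriv (fun t => (X.fundamental t).toReal) s) =
      ENNReal.ofReal ((X.fundamental a).toReal - (X.fundamental δ).toReal) := by
  set φ : ℝ → ℝ := fun t => (X.fundamental t).toReal with hφ
  have hmono : Monotone φ := X.fundamental_toReal_mono hμ
  have hK : 0 ≤ 2 * φ a / δ := by
    have : 0 ≤ φ a := ENNReal.toReal_nonneg
    positivity
  have hstep : ∀ x y, δ ≤ x → x < y → y ≤ a → φ y - φ x ≤ 2 * φ a / δ * (y - x) := by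
    intro x y hx hxy hy
    have h := X.fundamental_toReal_sub_le hμ (t := y) (h := y - x) (by linarith) (by linarith)
      ((ENNReal.ofReal_le_ofReal hy).trans haμ)
    rw [sub_sub_cancel] at h
    refine h.trans ?_
    have : 0 ≤ φ a := ENNReal.toReal_nonneg
    have h2 : φ y ≤ φ a := hmono hy
    have h4 : δ ≤ y := by linarith
    change 2 * φ y / y * (y - x) ≤ _
    gcongr
  have hlip : LipschitzOnWith (2 * φ a / δ).toNNReal φ (uIcc δ a) := by
    refine LipschitzOnWith.of_dist_le_mul fun x hx y hy => ?_
    rw [uIcc_of_le hδa] at hx hy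
    rw [Real.coe_toNNReal _ hK, Real.dist_eq, Real.dist_eq]
    rcases lt_trichotomy x y with h | h | h
    · rw [abs_sub_comm, abs_sub_comm x, abs_of_nonneg (sub_nonneg.2 (hmono h.le)),
        abs_of_nonneg (sub_nonneg.2 h.le)]
      exact hstep x y hx.1 h hy.2
    · simp [h]
    · rw [abs_of_nonneg (sub_nonneg.2 (hmono h.le)), abs_of_nonneg (sub_nonneg.2 h.le)]
      exact hstep y x hy.1 h hx.2
  have hac := hlip.absolutelyContinuousOnInterval
  have hint := hac.integral_deriv_eq_sub
  rw [intervalIntegral.integral_of_le hδa] at hint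
  rw [restrict_Ioo_eq_restrict_Ioc, ← hint]
  exact (ofReal_integral_eq_lintegral_ofReal
    ((intervalIntegrable_iff_integrableOn_Ioc_of_le hδa).1 hac.intervalIntegrable_deriv)
    (Eventually.of_forall fun s => hmono.deriv_nonneg)).symm

end Fundamental

/-! ### The Lorentz functional as an integral over level sets. -/

section Lorentz

variable {α : Type*} [MeasurableSpace α] {μ : Measure α} (X : RINorm μ)

/-- The measure `φ_X'(t) dt` on `(0, ∞)`. -/
def RINorm.lorentzMeasure : Measure ℝ :=
  (volume.restrict (Ioi 0)).withDensity
    fun s => ENNReal.ofReal (deriv (fun t => (X.fundamental t).toReal) s)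

instance : SFinite X.lorentzMeasure := by
  rw [RINorm.lorentzMeasure]; infer_instance

theorem RINorm.lintegral_lorentzMeasure {h : ℝ → ℝ≥0∞} (hh : Measurable h) :
    ∫⁻ s, h s ∂X.lorentzMeasure = ∫⁻ s in Ioi (0 : ℝ), h s *
      ENNReal.ofReal (deriv (fun t => (X.fundamental t).toReal) s) := by
  rw [RINorm.lorentzMeasure, lintegral_withDensity_eq_lintegral_mul _
    (measurable_deriv _).ennreal_ofReal hh]
  exact lintegral_congr fun s => mul_comm _ _

/-- The mass that `φ_X'(t) dt` gives to `(0, a)`. -/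
def RINorm.lorentzMass (a : ℝ≥0∞) : ℝ≥0∞ := X.lorentzMeasure {t | ENNReal.ofReal t < a}

theorem RINorm.lorentzMass_mono : Monotone X.lorentzMass := fun _ _ hab =>
  measure_mono fun _ ht => lt_of_lt_of_le ht hab

/-- The functional `∫ f^*(t) φ_X'(t) dt` on nonnegative functions. -/
def RINorm.lorentz (f : α → ℝ≥0∞) : ℝ≥0∞ :=
  ∫⁻ s in Ioi (0 : ℝ), X.lorentzMass (μ {x | ENNReal.ofReal s < f x})

theorem RINorm.lorentz_eq (f : α → ℝ≥0∞) : X.lorentz f = ∫⁻ t, rearr μ f t ∂X.lorentzMeasure :=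
  (lintegral_rearr X.lorentzMeasure).symm

theorem RINorm.lorentzNorm_eq {𝕜 : Type*} [RCLike 𝕜] (hφ : Tendsto X.fundamental (𝓝[>] 0) (𝓝 0))
    (f : α →ₘ[μ] 𝕜) : X.lorentzNorm f = X.lorentz fun x => ‖f x‖ₑ := by
  rw [RINorm.lorentzNorm, rightLim_eq_of_tendsto hφ, mul_zero, zero_add,
    RINorm.lorentz_eq, X.lintegral_lorentzMeasure measurable_rearr]

theorem RINorm.lorentz_mono {f g : α → ℝ≥0∞} (h : f ≤ᵐ[μ] g) : X.lorentz f ≤ X.lorentz g := by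
  rw [RINorm.lorentz_eq, RINorm.lorentz_eq]
  exact lintegral_mono fun t => rearr_mono h t

theorem RINorm.lorentz_const_mul {c : ℝ≥0∞} (h0 : c ≠ 0) (hc : c ≠ ∞) (f : α → ℝ≥0∞) :
    X.lorentz (fun x => c * f x) = c * X.lorentz f := by
  rw [RINorm.lorentz_eq, RINorm.lorentz_eq]
  simp only [rearr_const_mul h0 hc]
  exact lintegral_const_mul _ measurable_rearr

theorem RINorm.lorentzMass_zero : X.lorentzMass 0 = 0 := by simp [RINorm.lorentzMass]

theorem RINorm.lorentz_zero : X.lorentz (fun _ => 0) = 0 := by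
  simp [RINorm.lorentz, X.lorentzMass_zero]

theorem RINorm.measurable_lorentzMass_meas (f : α → ℝ≥0∞) :
    Measurable fun s : ℝ => X.lorentzMass (μ {x | ENNReal.ofReal s < f x}) := by
  refine Antitone.measurable fun s t hst => X.lorentzMass_mono (measure_mono fun x hx => ?_)
  exact (ENNReal.ofReal_le_ofReal hst).trans_lt hx

variable [SigmaFinite μ] (hμ : Nonatomic μ) (hφ : Tendsto X.fundamental (𝓝[>] 0) (𝓝 0))
include hμ hφ

/-- Let `δ → 0` in the fundamental theorem of calculus on `(δ, a)`. Since `φ_X(0+) = 0`, no mass is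
lost at the origin, and the mass of `(0, a)` is all of `φ_X(a)`. -/
theorem RINorm.lorentzMass_measure {E : Set α} (hE : MeasurableSet E) (hfin : μ E ≠ ∞) :
    X.lorentzMass (μ E) = X.norm (E.indicator fun _ => 1) := by
  rw [← X.fundamental_eq_norm hE hfin]
  set a := (μ E).toReal with ha
  have haμ : ENNReal.ofReal a ≤ μ univ := by
    rw [ha, ENNReal.ofReal_toReal hfin]; exact measure_mono (subset_univ _)
  have hμE : μ E = ENNReal.ofReal a := by rw [ha, ENNReal.ofReal_toReal hfin]
  have ha0 : 0 ≤ a := ENNReal.toReal_nonneg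
  clear_value a
  rcases ha0.eq_or_lt with h0 | h0
  · rw [hμE, ← h0, ENNReal.ofReal_zero, X.lorentzMass_zero]
    exact ((X.repNorm_eq_zero_iff hμ (measurable_indicator_one measurableSet_Ioo)).2
      (Eventually.of_forall fun t => by simp)).symm
  let δ : ℕ → ℝ := fun n => a / (n + 1)
  have hδ0 : ∀ n, 0 < δ n := fun n => by positivity
  have hδa : ∀ n, δ n ≤ a := fun n => div_le_self h0.le (by simp)
  have hδanti : Antitone δ := fun m n hmn => by
    change a / (n + 1) ≤ a / (m + 1)
    gcongr
  have hδlim : Tendsto δ atTop (𝓝 0) := by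
    have := (tendsto_one_div_add_atTop_nhds_zero_nat (𝕜 := ℝ)).const_mul a
    simpa [δ, div_eq_mul_inv] using this
  have hIoo : ∀ n, X.lorentzMeasure (Ioo (δ n) a) =
      ENNReal.ofReal ((X.fundamental a).toReal - (X.fundamental (δ n)).toReal) := fun n => by
    have hsub : Ioo (δ n) a ⊆ Ioi 0 := fun x hx => (hδ0 n).trans hx.1
    rw [← X.integral_deriv_fundamental hμ (hδ0 n) (hδa n) haμ, RINorm.lorentzMeasure,
      withDensity_apply _ measurableSet_Ioo, Measure.restrict_restrict measurableSet_Ioo,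
      inter_eq_left.2 hsub]
  have hunion : (⋃ n, Ioo (δ n) a) = Ioo 0 a := by
    ext x
    simp only [mem_iUnion, mem_Ioo]
    refine ⟨fun ⟨n, h1, h2⟩ => ⟨(hδ0 n).trans h1, h2⟩, fun ⟨h1, h2⟩ => ?_⟩
    obtain ⟨n, hn⟩ := (hδlim.eventually (gt_mem_nhds h1)).exists
    exact ⟨n, hn, h2⟩
  have hmass : X.lorentzMass (μ E) = X.lorentzMeasure (Ioo 0 a) := by
    have hset : MeasurableSet {t : ℝ | ENNReal.ofReal t < ENNReal.ofReal a} :=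
      measurableSet_lt ENNReal.measurable_ofReal measurable_const
    rw [hμE, RINorm.lorentzMass, RINorm.lorentzMeasure, withDensity_apply _ hset,
      withDensity_apply _ measurableSet_Ioo, Measure.restrict_restrict hset,
      Measure.restrict_restrict measurableSet_Ioo]
    congr 2
    ext x
    simp only [mem_inter_iff, mem_ofPred_eq, ENNReal.ofReal_lt_ofReal_iff h0, mem_Ioi, mem_Ioo]
    tauto
  have hlim1 := tendsto_measure_iUnion_atTop (μ := X.lorentzMeasure)
    (s := fun n => Ioo (δ n) a) fun m n hmn => Ioo_subset_Ioo_left (hδanti hmn)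
  rw [hunion, ← hmass] at hlim1
  refine tendsto_nhds_unique hlim1 ?_
  simp only [Function.comp_def, hIoo]
  have hlim2 : Tendsto (fun n => (X.fundamental (δ n)).toReal) atTop (𝓝 0) := by
    have h1 : Tendsto δ atTop (𝓝[>] 0) :=
      tendsto_nhdsWithin_iff.2 ⟨hδlim, Eventually.of_forall hδ0⟩
    exact (ENNReal.tendsto_toReal ENNReal.zero_ne_top).comp (hφ.comp h1)
  have hlim3 := ENNReal.tendsto_ofReal (hlim2.const_sub (X.fundamental a).toReal)
  rwa [sub_zero, ENNReal.ofReal_toReal (X.fundamental_lt_top hμ a).ne] at hlim3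

theorem RINorm.lorentzMass_union_le {E F : Set α} (hE : MeasurableSet E) (hF : MeasurableSet F) :
    X.lorentzMass (μ (E ∪ F)) ≤ X.lorentzMass (μ E) + X.lorentzMass (μ F) := by
  rcases eq_or_ne (μ E) ∞ with h1 | h1
  · rw [h1]; exact (X.lorentzMass_mono le_top).trans le_self_add
  rcases eq_or_ne (μ F) ∞ with h2 | h2
  · rw [h2]; exact (X.lorentzMass_mono le_top).trans le_add_self
  rw [X.lorentzMass_measure hμ hφ hE h1, X.lorentzMass_measure hμ hφ hF h2,
    X.lorentzMass_measure hμ hφ (hE.union hF) (measure_union_lt_top h1.lt_top h2.lt_top).ne]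
  refine le_trans (X.norm_mono _ _ (measurable_indicator_one (hE.union hF))
    ((measurable_indicator_one hE).add (measurable_indicator_one hF))
    (Eventually.of_forall fun x => ?_)) (X.norm_add_le _ _ (measurable_indicator_one hE)
      (measurable_indicator_one hF))
  by_cases hx : x ∈ E <;> by_cases hy : x ∈ F <;> simp [hx, hy]

/-- The set `{f + g > s}` lies in `{2f > s} ∪ {2g > s}`, and `φ_X` is subadditive on unions. Without
concavity of `φ_X` this argument yields a quasi-triangle inequality with constant 2. -/
theorem RINorm.lorentz_add_le {f g : α → ℝ≥0∞} (hf : Measurable f) (hg : Measurable g) :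
    X.lorentz (fun x => f x + g x) ≤ 2 * (X.lorentz f + X.lorentz g) := by
  rw [mul_add, ← X.lorentz_const_mul two_ne_zero ENNReal.ofNat_ne_top,
    ← X.lorentz_const_mul two_ne_zero ENNReal.ofNat_ne_top, RINorm.lorentz, RINorm.lorentz,
    RINorm.lorentz, ← lintegral_add_left (X.measurable_lorentzMass_meas _)]
  refine lintegral_mono fun s => ?_
  refine le_trans (X.lorentzMass_mono (measure_mono ?_)) (X.lorentzMass_union_le hμ hφ
    (measurableSet_lt measurable_const (hf.const_mul 2))
    (measurableSet_lt measurable_const (hg.const_mul 2)))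
  intro x (hx : ENNReal.ofReal s < f x + g x)
  by_contra hcon
  simp only [mem_union, mem_ofPred_eq, not_or, not_lt] at hcon
  have h2 := add_le_add hcon.1 hcon.2
  rw [← mul_add, ← two_mul, ENNReal.mul_le_mul_iff_right two_ne_zero ENNReal.ofNat_ne_top] at h2
  exact absurd hx (not_lt.2 h2)

theorem RINorm.lorentz_indicator {E : Set α} (hE : MeasurableSet E) (hfin : μ E ≠ ∞) :
    X.lorentz (E.indicator fun _ => 1) = X.norm (E.indicator fun _ => 1) := by
  rw [← X.lorentzMass_measure hμ hφ hE hfin, RINorm.lorentz]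
  simp only [setOf_lt_indicator_one]
  have : ∀ s : ℝ, X.lorentzMass (μ (if ENNReal.ofReal s < 1 then E else ∅)) =
      (Iio 1).indicator (fun _ => X.lorentzMass (μ E)) s := fun s => by
    by_cases h : s < 1 <;> simp [h, X.lorentzMass_zero]
  simp only [this]
  rw [lintegral_indicator measurableSet_Iio, Measure.restrict_restrict measurableSet_Iio,
    setLIntegral_const, inter_comm, Ioi_inter_Iio]
  simp

end Lorentz

/-! ### Pointwise comparison of the endpoint bounds with `R_{p,q} χ_{(0,a)}`. -/

section Bounds

theorem sawyer_exponent {p q : ℝ} (hp : 0 < p) (hpq : p < q) {t : ℝ} (ht : 0 < t) :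
    (t ^ (q / (q - p)) / t) ^ (1 / p) = t ^ (1 / (q - p)) := by
  have h1 : q - p ≠ 0 := by linarith
  nth_rewrite 2 [← Real.rpow_one t]
  rw [← Real.rpow_sub ht, ← Real.rpow_mul ht.le]
  congr 1
  field_simp
  ring

/-- At `τ = a^{(q-p)/q}` one has `τ^{1/(q-p)} = a^{1/q}`; going back to `τ/2` costs the factor
`2^{1/(q-p)}`. -/
theorem rpow_le_sawyer {p q : ℝ} (hp : 0 < p) (hpq : p < q) {a t : ℝ} (ha : 0 < a) (ht : 0 < t)
    (hat : a ^ ((q - p) / q) / 2 ≤ t) (hta : t ^ (q / (q - p)) ≤ a) :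
    a ^ (1 / q) ≤ 2 ^ (1 / (q - p)) * (min (t ^ (q / (q - p))) a / t) ^ (1 / p) := by
  have h1 : 0 < q - p := by linarith
  rw [min_eq_left hta, sawyer_exponent hp hpq ht, ← Real.mul_rpow (by norm_num) ht.le]
  have h2 : a ^ ((q - p) / q) ≤ 2 * t := by linarith
  calc a ^ (1 / q) = (a ^ ((q - p) / q)) ^ (1 / (q - p)) := by
        rw [← Real.rpow_mul ha.le]
        congr 1
        field_simp
    _ ≤ (2 * t) ^ (1 / (q - p)) := by gcongr

theorem min_le_sawyer {p q : ℝ} (hp : 0 < p) (hpq : p < q) {a t : ℝ} (ha : 0 < a) (ht : 0 < t)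
    (hat : a ^ ((q - p) / q) / 2 ≤ t) :
    min ((a / t) ^ (1 / p)) (a ^ (1 / q)) ≤
      2 ^ (1 / (q - p)) * (min (t ^ (q / (q - p))) a / t) ^ (1 / p) := by
  rcases le_total (t ^ (q / (q - p))) a with h | h
  · exact (min_le_right _ _).trans (rpow_le_sawyer hp hpq ha ht hat h)
  · refine (min_le_left _ _).trans ?_
    rw [min_eq_right h]
    refine le_mul_of_one_le_left (by positivity) ?_
    exact Real.one_le_rpow (by norm_num) (by positivity)

theorem measurable_opR (p q : ℝ) (m : ℝ≥0∞) (g : ℝ → ℝ≥0∞) : Measurable (opR p q m g) := by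
  have h : Monotone fun u : ℝ => ∫⁻ s in Ioo 0 u, rearr (intervalMeasure m) g s ^ p :=
    fun _ _ huv => lintegral_mono_set (Ioo_subset_Ioo_right huv)
  exact ((ENNReal.measurable_ofReal.inv.mul
    (h.measurable.comp (measurable_id.pow_const (q / (q - p))))).pow_const _)

theorem le_opR_indicator {p q : ℝ} (hp : 0 < p) {m : ℝ≥0∞} {a t : ℝ} (ha : 0 < a) (ht : 0 < t)
    (ham : ENNReal.ofReal a ≤ m) :
    ENNReal.ofReal ((min (t ^ (q / (q - p))) a / t) ^ (1 / p)) ≤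
      opR p q m ((Ioo 0 a).indicator fun _ => 1) t := by
  have hr : ∀ s ∈ Ioo 0 (min (t ^ (q / (q - p))) a),
      1 ≤ rearr (intervalMeasure m) ((Ioo 0 a).indicator fun _ => 1) s ^ p := fun s hs => by
    refine ENNReal.one_le_rpow (le_of_forall_lt fun u hu => lt_rearr_iff.2 ?_) hp
    rw [setOf_lt_indicator_one, if_pos hu, intervalMeasure_Ioo, min_eq_left ham]
    exact (ENNReal.ofReal_lt_ofReal_iff ha).2 (hs.2.trans_le (min_le_right _ _))
  rw [← ENNReal.ofReal_rpow_of_nonneg (by positivity) (by positivity), opR]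
  refine ENNReal.rpow_le_rpow ?_ (by positivity)
  rw [ENNReal.ofReal_div_of_pos ht, div_eq_mul_inv, mul_comm]
  refine mul_le_mul_right ?_ _
  calc ENNReal.ofReal (min (t ^ (q / (q - p))) a)
      = ∫⁻ _ in Ioo 0 (min (t ^ (q / (q - p))) a), 1 := by simp
    _ ≤ ∫⁻ s in Ioo 0 (min (t ^ (q / (q - p))) a),
          rearr (intervalMeasure m) ((Ioo 0 a).indicator fun _ => 1) s ^ p :=
        setLIntegral_mono' measurableSet_Ioo hr
    _ ≤ _ := lintegral_mono_set (Ioo_subset_Ioo_right (min_le_left _ _))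

/-- Both halves are the variational bound for `∫_0^t (b^p)^*`: with `c = 0` it uses the integral
bound, with `c` the `p`-th power of the uniform bound the excess vanishes. -/
theorem maxRearr_rpow_le {β : Type*} [MeasurableSpace β] {ν : Measure β} [SFinite ν] {p q a A : ℝ}
    (hp : 0 < p) (ha : 0 < a) (hA : 0 ≤ A) {b : β → ℝ≥0∞} (hb : Measurable b)
    (hb₁ : ∫⁻ x, b x ^ p ∂ν ≤ ENNReal.ofReal (A ^ p * a))
    (hb₂ : ∀ᵐ x ∂ν, b x ≤ ENNReal.ofReal (A * a ^ (1 / q))) {t : ℝ} (ht : 0 < t) :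
    maxRearr ν (fun x => b x ^ p) t ^ (1 / p) ≤
      ENNReal.ofReal (A * min ((a / t) ^ (1 / p)) (a ^ (1 / q))) := by
  rw [mul_min_of_nonneg _ _ hA, ENNReal.ofReal_min, le_min_iff, one_div,
    ENNReal.rpow_inv_le_iff hp, ENNReal.rpow_inv_le_iff hp, maxRearr_eq]
  constructor
  · have h := rearrInt_le (μ := ν) (hb.pow_const p) 0 t
    simp only [mul_zero, tsub_zero, zero_add] at h
    refine (mul_le_mul_right (h.trans hb₁) _).trans (le_of_eq ?_)
    rw [ENNReal.ofReal_rpow_of_nonneg (by positivity) hp.le, Real.mul_rpow hA (by positivity),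
      ← Real.rpow_mul (by positivity), inv_mul_cancel₀ hp.ne', Real.rpow_one, mul_comm,
      ← div_eq_mul_inv, ← ENNReal.ofReal_div_of_pos ht, mul_div_assoc]
  · have h := rearrInt_le (μ := ν) (hb.pow_const p) (ENNReal.ofReal (A * a ^ (1 / q)) ^ p) t
    have h0 : ∫⁻ x, b x ^ p - ENNReal.ofReal (A * a ^ (1 / q)) ^ p ∂ν = 0 := by
      rw [lintegral_eq_zero_iff ((hb.pow_const p).sub_const _)]
      filter_upwards [hb₂] with x hx
      exact tsub_eq_zero_of_le (ENNReal.rpow_le_rpow hx hp.le)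
    rw [h0, add_zero] at h
    refine (mul_le_mul_right h _).trans (le_of_eq ?_)
    rw [← mul_assoc, ENNReal.inv_mul_cancel (by simpa using ht) ENNReal.ofReal_ne_top, one_mul]

variable {α β : Type*} [MeasurableSpace α] [MeasurableSpace β] {μ : Measure α} {ν : Measure β}
  (X : RINorm μ) (Y : RINorm ν)

theorem RINorm.norm_congr_ae {f g : α → ℝ≥0∞} (hf : Measurable f) (hg : Measurable g)
    (h : f =ᵐ[μ] g) : X.norm f = X.norm g :=
  (X.norm_mono f g hf hg h.le).antisymm (X.norm_mono g f hg hf h.symm.le)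

theorem RINorm.fundamental_pos [SigmaFinite μ] (hμ : Nonatomic μ) (h0 : μ univ ≠ 0) {t : ℝ}
    (ht : 0 < t) : 0 < X.fundamental t := by
  rw [pos_iff_ne_zero]
  intro h
  have h1 := (X.repNorm_eq_zero_iff hμ (measurable_indicator_one measurableSet_Ioo)).1 h
  have h2 : intervalMeasure (μ univ) (Ioo 0 t) = 0 := by
    refine measure_mono_null (fun s hs => ?_) h1
    change ¬ (Ioo 0 t).indicator (fun _ => (1 : ℝ≥0∞)) s = 0
    rw [indicator_of_mem hs]
    exact one_ne_zero
  rw [intervalMeasure_Ioo] at h2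
  rcases min_eq_iff.1 h2 with h | h
  · exact absurd h.1 (by simpa using ht)
  · exact h0 h.1

theorem coeFn_chi (𝕜 : Type*) [RCLike 𝕜] (μ : Measure α) (E : Set α) (hE : MeasurableSet E) :
    (chi 𝕜 μ E hE : α → 𝕜) =ᵐ[μ] E.indicator fun _ => 1 := AEEqFun.coeFn_mk _ _

theorem enorm_chi (𝕜 : Type*) [RCLike 𝕜] (μ : Measure α) (E : Set α) (hE : MeasurableSet E) :
    (fun x => ‖chi 𝕜 μ E hE x‖ₑ) =ᵐ[μ] E.indicator fun _ => 1 := by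
  filter_upwards [coeFn_chi 𝕜 μ E hE] with x hx
  rw [hx]
  by_cases h : x ∈ E <;> simp [h]

theorem RINorm.fnorm_chi (𝕜 : Type*) [RCLike 𝕜] (E : Set α) (hE : MeasurableSet E) :
    X.fnorm (chi 𝕜 μ E hE) = X.norm (E.indicator fun _ => 1) :=
  X.norm_congr_ae (chi 𝕜 μ E hE).measurable.enorm (measurable_indicator_one hE) (enorm_chi 𝕜 μ E hE)

/-- If `χ_E = g + h`, then `|g| ≥ 1/2` or `|h| ≥ 1/2` on a set of measure at least `a/2`.
Chebyshev's inequality treats the first case, the weak norm the second; `a ≥ a₀` is what lets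
`a^{1/p}` dominate a multiple of `a^{1/q}`. -/
theorem le_sumNorm_chi (𝕜 : Type*) [RCLike 𝕜] {p q a₀ a : ℝ} (hp : 0 < p) (hpq : p < q)
    (ha₀ : 0 < a₀) (haa : a₀ ≤ a) {E : Set α} (hE : MeasurableSet E)
    (hEa : μ E = ENNReal.ofReal a) :
    ENNReal.ofReal (2⁻¹ * min 1 ((a₀ / 4) ^ (1 / p - 1 / q)) * (a / 4) ^ (1 / q)) ≤
      sumNorm p q (chi 𝕜 μ E hE) := by
  have hq : 0 < q := by linarith
  have ha : 0 < a := by linarith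
  refine le_iInf fun g => le_iInf fun h => le_iInf fun hgh => ?_
  have hcov : E ≤ᵐ[μ] ({x | 2⁻¹ ≤ ‖g x‖ₑ} ∪ {x | 2⁻¹ ≤ ‖h x‖ₑ} : Set α) := by
    filter_upwards [coeFn_chi 𝕜 μ E hE, AEEqFun.coeFn_add g h] with x h1 h2 (hx : x ∈ E)
    by_contra hcon
    have hcon' : ¬ (2⁻¹ ≤ ‖g x‖ₑ ∨ 2⁻¹ ≤ ‖h x‖ₑ) := hcon
    rw [not_or, not_le, not_le] at hcon'
    rw [hgh, h2, Pi.add_apply, indicator_of_mem hx] at h1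
    have h3 := (enorm_add_le (g x) (h x)).trans_lt (ENNReal.add_lt_add hcon'.1 hcon'.2)
    rw [h1, enorm_one, ENNReal.inv_two_add_inv_two] at h3
    exact h3.false
  have hle : ENNReal.ofReal a ≤ μ {x | 2⁻¹ ≤ ‖g x‖ₑ} + μ {x | 2⁻¹ ≤ ‖h x‖ₑ} :=
    hEa ▸ (measure_mono_ae hcov).trans (measure_union_le _ _)
  have hsplit : ENNReal.ofReal (a / 2) ≤ μ {x | 2⁻¹ ≤ ‖g x‖ₑ} ∨
      ENNReal.ofReal (a / 2) ≤ μ {x | 2⁻¹ ≤ ‖h x‖ₑ} := by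
    by_contra! hcon
    have h3 := hle.trans_lt (ENNReal.add_lt_add hcon.1 hcon.2)
    rw [← ENNReal.ofReal_add (by positivity) (by positivity), add_halves] at h3
    exact h3.false
  rcases hsplit with hs | hs
  · refine le_trans ?_ le_self_add
    have hm := mul_meas_ge_le_pow_eLpNorm' μ (p := ENNReal.ofReal p) (by simpa using hp)
      ENNReal.ofReal_ne_top g.aestronglyMeasurable (2⁻¹ : ℝ≥0∞)
    rw [ENNReal.toReal_ofReal hp.le] at hm
    rw [← ENNReal.rpow_le_rpow_iff hp]
    refine le_trans ?_ hm
    have hhalf : (2⁻¹ : ℝ≥0∞) = ENNReal.ofReal 2⁻¹ := by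
      rw [ENNReal.ofReal_inv_of_pos two_pos, ENNReal.ofReal_ofNat]
    refine le_trans ?_ (mul_le_mul_right hs _)
    rw [hhalf, ENNReal.ofReal_rpow_of_nonneg (by positivity) hp.le,
      ENNReal.ofReal_rpow_of_nonneg (by positivity) hp.le, ← ENNReal.ofReal_mul (by positivity)]
    refine ENNReal.ofReal_le_ofReal ?_
    rw [mul_assoc, Real.mul_rpow (by positivity) (by positivity)]
    refine mul_le_mul_of_nonneg_left ?_ (by positivity)
    have hexp : 0 ≤ 1 / p - 1 / q := sub_nonneg.2 (one_div_le_one_div_of_le hp hpq.le)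
    calc (min 1 ((a₀ / 4) ^ (1 / p - 1 / q)) * (a / 4) ^ (1 / q)) ^ p
        ≤ ((a / 4) ^ (1 / p - 1 / q) * (a / 4) ^ (1 / q)) ^ p := by
          gcongr
          exact (min_le_right _ _).trans (by gcongr)
      _ = a / 4 := by
          rw [← Real.rpow_add (by positivity), sub_add_cancel, ← Real.rpow_mul (by positivity),
            one_div_mul_cancel hp.ne', Real.rpow_one]
      _ ≤ a / 2 := by linarith
  · refine le_trans ?_ le_add_self
    -- The supremum is tested at `a/4` and not at `a/2`, because bounding the rearrangement below
    -- takes a level set of strictly larger measure.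
    refine le_trans ?_ (le_iSup (fun t : Ioi (0 : ℝ) => ENNReal.ofReal (t : ℝ) ^ (1 / q) *
      rearr μ (fun x => ‖h x‖ₑ) t) ⟨a / 4, by simpa using ha⟩)
    have hr : (2⁻¹ : ℝ≥0∞) ≤ rearr μ (fun x => ‖h x‖ₑ) (a / 4) := by
      refine le_of_forall_lt fun u hu => lt_rearr_iff.2 ?_
      refine lt_of_lt_of_le ((ENNReal.ofReal_lt_ofReal_iff (by positivity)).2 ?_)
        (hs.trans (measure_mono fun x (hx : 2⁻¹ ≤ ‖h x‖ₑ) => hu.trans_le hx))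
      linarith
    refine le_trans ?_ (mul_le_mul_right hr _)
    have hhalf : (2⁻¹ : ℝ≥0∞) = ENNReal.ofReal 2⁻¹ := by
      rw [ENNReal.ofReal_inv_of_pos two_pos, ENNReal.ofReal_ofNat]
    rw [hhalf, ENNReal.ofReal_rpow_of_nonneg (by positivity) (by positivity),
      ← ENNReal.ofReal_mul (by positivity)]
    refine ENNReal.ofReal_le_ofReal ?_
    rw [mul_comm _ (2⁻¹ : ℝ), mul_assoc]
    refine mul_le_mul_of_nonneg_left ?_ (by positivity)
    exact mul_le_of_le_one_left (by positivity) (min_le_left _ _)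

/-- If `X ⊆ L^p + L^{q,∞}`, then `t^{1/q} ≲ φ_X(t)` away from zero. -/
theorem RINorm.SubsetSum.exists_rpow_le {𝕜 : Type*} [RCLike 𝕜] {X : RINorm μ} {p q : ℝ}
    (hX : X.SubsetSum 𝕜 p q) (hp : 0 < p) (hpq : p < q) {a₀ : ℝ} (ha₀ : 0 < a₀) :
    ∃ K : ℝ≥0, ∀ (E : Set α) (a : ℝ), MeasurableSet E → μ E = ENNReal.ofReal a → a₀ ≤ a →
      ENNReal.ofReal (a ^ (1 / q)) ≤ K * X.norm (E.indicator fun _ => 1) := by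
  obtain ⟨C, hC⟩ := hX
  set c : ℝ := 2⁻¹ * min 1 ((a₀ / 4) ^ (1 / p - 1 / q)) * (1 / 4) ^ (1 / q) with hc
  have hc0 : 0 < c := by
    have : 0 < min 1 ((a₀ / 4) ^ (1 / p - 1 / q)) := lt_min one_pos (by positivity)
    positivity
  refine ⟨(c⁻¹).toNNReal * C, fun E a hE hEa haa => ?_⟩
  have ha : 0 < a := by linarith
  have hlt : X.norm (E.indicator fun _ => 1) < ∞ :=
    X.norm_indicator_lt_top E hE (hEa ▸ ENNReal.ofReal_lt_top)
  have h := (le_sumNorm_chi 𝕜 hp hpq ha₀ haa hE hEa).trans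
    (hC _ (by rwa [X.fnorm_chi 𝕜 E hE]))
  rw [X.fnorm_chi 𝕜 E hE] at h
  have heq : 2⁻¹ * min 1 ((a₀ / 4) ^ (1 / p - 1 / q)) * (a / 4) ^ (1 / q) = c * a ^ (1 / q) := by
    rw [hc, div_eq_mul_one_div a, Real.mul_rpow ha.le (by norm_num)]; ring
  rw [heq] at h
  calc ENNReal.ofReal (a ^ (1 / q)) = ENNReal.ofReal c⁻¹ * ENNReal.ofReal (c * a ^ (1 / q)) := by
        rw [← ENNReal.ofReal_mul (by positivity), inv_mul_cancel_left₀ hc0.ne']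
    _ ≤ ENNReal.ofReal c⁻¹ * (C * X.norm (E.indicator fun _ => 1)) := by gcongr
    _ = _ := by rw [ENNReal.coe_mul, mul_assoc]; rfl

end Bounds

/-! ### The bound on characteristic functions. -/

section Core

variable {α β : Type*} [MeasurableSpace α] [MeasurableSpace β] {μ : Measure α} {ν : Measure β}
  {X : RINorm μ}

/-- The case of sets that are too large for the operator `R_{p,q}` to see. -/
theorem exists_rpow_le_norm {p q : ℝ} {𝕜 : Type*} [RCLike 𝕜] [SigmaFinite μ] (hμ : Nonatomic μ)
    (hp : 0 < p) (hpq : p < q) (hX : μ univ = ∞ → ν univ < ∞ → X.SubsetSum 𝕜 p q) {a₀ : ℝ}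
    (ha₀ : 0 < a₀) (hfin : ν univ ≠ ∞) :
    ∃ K : ℝ≥0, ∀ (E : Set α) (a : ℝ), MeasurableSet E → μ E = ENNReal.ofReal a → a₀ ≤ a →
      ENNReal.ofReal (a ^ (1 / q)) ≤ K * X.norm (E.indicator fun _ => 1) := by
  have hq : 0 < q := by linarith
  rcases eq_or_ne (μ univ) ∞ with hμ' | hμ'
  · exact (hX hμ' hfin.lt_top).exists_rpow_le hp hpq ha₀
  rcases eq_or_ne (μ univ) 0 with h0 | h0
  · refine ⟨0, fun E a _ hEa haa => ?_⟩
    have : μ E = 0 := measure_mono_null (subset_univ E) h0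
    rw [hEa, ENNReal.ofReal_eq_zero] at this
    linarith
  have hφ0 := X.fundamental_pos hμ h0 ha₀
  have hφt := X.fundamental_lt_top hμ a₀
  set M := (μ univ).toReal with hM
  -- If `μ` is finite, `a` ranges over `[a₀, M]`, where `a^{1/q} ≤ M^{1/q}` and `φ_X(a) ≥ φ_X(a₀) >
  -- 0`.
  refine ⟨(ENNReal.ofReal (M ^ (1 / q)) / X.fundamental a₀).toNNReal, fun E a hE hEa haa => ?_⟩
  have ha : 0 < a := by linarith
  rw [ENNReal.coe_toNNReal (ENNReal.div_ne_top ENNReal.ofReal_ne_top hφ0.ne')]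
  have hEfin : μ E ≠ ∞ := hEa ▸ ENNReal.ofReal_ne_top
  have haE : (μ E).toReal = a := by rw [hEa, ENNReal.toReal_ofReal ha.le]
  have haM : a ≤ M := haE ▸ ENNReal.toReal_mono hμ' (measure_mono (subset_univ E))
  rw [← X.fundamental_eq_norm hE hEfin, haE]
  calc ENNReal.ofReal (a ^ (1 / q)) ≤ ENNReal.ofReal (M ^ (1 / q)) :=
        ENNReal.ofReal_le_ofReal (by gcongr)
    _ = ENNReal.ofReal (M ^ (1 / q)) / X.fundamental a₀ * X.fundamental a₀ :=
        (ENNReal.div_mul_cancel hφ0.ne' hφt.ne).symm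
    _ ≤ _ := mul_le_mul_right (X.fundamental_mono hμ haa) _

variable [SigmaFinite ν] {Y : RINorm ν} (hν : Nonatomic ν) {p q a : ℝ}
include hν

/-- Rearrangement invariance replaces `(0, τ/2)` by `[τ/2, τ)`, on which `R_{p,q} χ_{(0,a)}` is at
least a multiple of `a^{1/q}`. The condition `τ ≤ ν(S)` keeps the translated interval inside `(0,
ν(S))`. -/
theorem repNorm_half_le_opR (hp : 0 < p) (hpq : p < q) (ha : 0 < a)
    (haμ : ENNReal.ofReal a ≤ μ univ) (haν : ENNReal.ofReal (a ^ ((q - p) / q)) ≤ ν univ) :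
    ENNReal.ofReal (a ^ (1 / q)) * Y.fundamental (a ^ ((q - p) / q) / 2) ≤
      ENNReal.ofReal (2 ^ (1 / (q - p))) *
        Y.repNorm (opR p q (μ univ) ((Ioo 0 a).indicator fun _ => 1)) := by
  have h1 : 0 < q - p := by linarith
  have hq : 0 < q := by linarith
  set τ := a ^ ((q - p) / q) with hτ
  have hτ0 : 0 < τ := by positivity
  have hshift : Y.fundamental (τ / 2) = Y.repNorm ((Ico (τ / 2) τ).indicator fun _ => 1) := by
    refine Y.repNorm_congr (equimeasurable_indicator ?_)
    rw [intervalMeasure_apply_of_subset haν measurableSet_Ioo (Ioo_subset_Ioo_right (by linarith)),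
      intervalMeasure_apply_of_subset haν measurableSet_Ico
        (fun x hx => ⟨by linarith [hx.1], hx.2⟩), Real.volume_Ioo, Real.volume_Ico]
    congr 1
    ring
  have hsm1 := Y.repNorm_smul hν (a ^ (1 / q)).toNNReal
    (measurable_indicator_one (measurableSet_Ico (a := τ / 2) (b := τ)))
  have hsm2 := Y.repNorm_smul hν ((2 : ℝ) ^ (1 / (q - p))).toNNReal
    (measurable_opR p q (μ univ) ((Ioo 0 a).indicator fun _ => 1))
  rw [hshift]
  refine hsm1.symm.trans_le (le_trans ?_ hsm2.le)
  refine Y.repNorm_mono hν ((measurable_indicator_one measurableSet_Ico).const_mul _)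
    ((measurable_opR _ _ _ _).const_mul _) (Eventually.of_forall fun t => ?_)
  by_cases ht : t ∈ Ico (τ / 2) τ
  · have ht0 : 0 < t := by linarith [ht.1]
    have hta : t ^ (q / (q - p)) ≤ a := by
      calc t ^ (q / (q - p)) ≤ τ ^ (q / (q - p)) :=
            Real.rpow_le_rpow ht0.le ht.2.le (by positivity)
        _ = a := by
          rw [hτ, ← Real.rpow_mul ha.le]
          convert Real.rpow_one a using 2
          field_simp
    beta_reduce
    rw [indicator_of_mem ht, mul_one]
    change ENNReal.ofReal (a ^ (1 / q)) ≤ ENNReal.ofReal (2 ^ (1 / (q - p))) * _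
    refine le_trans ?_ (mul_le_mul_right (le_opR_indicator hp ha ht0 haμ) _)
    rw [← ENNReal.ofReal_mul (by positivity)]
    exact ENNReal.ofReal_le_ofReal (rpow_le_sawyer hp hpq ha ht0 ht.1 hta)
  · simp [indicator_of_notMem ht]

/-- Split at `τ/2`: to the right the comparison with `R_{p,q} χ_{(0,a)}` is pointwise, to the left
it holds only in norm, after the translation. The two pieces give the factor 2. -/
theorem maxNorm_le_opR {A : ℝ} (hp : 0 < p) (hpq : p < q) (ha : 0 < a) (hA : 0 ≤ A)
    (haμ : ENNReal.ofReal a ≤ μ univ) (haν : ENNReal.ofReal (a ^ ((q - p) / q)) ≤ ν univ)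
    {b : β → ℝ≥0∞} (hb : Measurable b)
    (hb₁ : ∫⁻ x, b x ^ p ∂ν ≤ ENNReal.ofReal (A ^ p * a))
    (hb₂ : ∀ᵐ x ∂ν, b x ≤ ENNReal.ofReal (A * a ^ (1 / q))) :
    Y.maxNorm p b ≤ ENNReal.ofReal (2 * A * 2 ^ (1 / (q - p))) *
      Y.repNorm (opR p q (μ univ) ((Ioo 0 a).indicator fun _ => 1)) := by
  set τ := a ^ ((q - p) / q) with hτ
  set R := opR p q (μ univ) ((Ioo 0 a).indicator fun _ => 1) with hR
  have hRm : Measurable R := measurable_opR _ _ _ _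
  set c : ℝ := 2 ^ (1 / (q - p)) with hc
  have hI : Measurable ((Ioo 0 (τ / 2)).indicator fun _ => (1 : ℝ≥0∞)) :=
    measurable_indicator_one measurableSet_Ioo
  have hpt : ∀ t, 0 < t → maxRearr ν (fun x => b x ^ p) t ^ (1 / p) ≤
      ((A * a ^ (1 / q)).toNNReal : ℝ≥0∞) * (Ioo 0 (τ / 2)).indicator (fun _ => 1) t +
        ((A * c).toNNReal : ℝ≥0∞) * R t := fun t ht => by
    refine (maxRearr_rpow_le hp ha hA hb hb₁ hb₂ ht).trans ?_
    rcases lt_or_ge t (τ / 2) with h | h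
    · refine le_trans ?_ le_self_add
      rw [indicator_of_mem (show t ∈ Ioo 0 (τ / 2) from ⟨ht, h⟩), mul_one]
      exact ENNReal.ofReal_le_ofReal (mul_le_mul_of_nonneg_left (min_le_right _ _) hA)
    · refine le_trans ?_ le_add_self
      change _ ≤ ENNReal.ofReal (A * c) * R t
      refine le_trans ?_ (mul_le_mul_right (le_opR_indicator hp ha ht haμ) _)
      rw [← ENNReal.ofReal_mul (by positivity), mul_assoc]
      exact ENNReal.ofReal_le_ofReal
        (mul_le_mul_of_nonneg_left (min_le_sawyer hp hpq ha ht h) hA)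
  have hae : (fun t => maxRearr ν (fun x => b x ^ p) t ^ (1 / p)) ≤ᵐ[intervalMeasure (ν univ)]
      fun t => ((A * a ^ (1 / q)).toNNReal : ℝ≥0∞) * (Ioo 0 (τ / 2)).indicator (fun _ => 1) t +
        ((A * c).toNNReal : ℝ≥0∞) * R t := by
    have hmem : ∀ᵐ t ∂(intervalMeasure (ν univ)), 0 < t ∧ ENNReal.ofReal t < ν univ :=
      ae_restrict_mem (measurableSet_interval (ν univ))
    exact hmem.mono fun t ht => hpt t ht.1
  calc Y.maxNorm p b
      ≤ Y.repNorm fun t => ((A * a ^ (1 / q)).toNNReal : ℝ≥0∞) *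
          (Ioo 0 (τ / 2)).indicator (fun _ => 1) t + ((A * c).toNNReal : ℝ≥0∞) * R t :=
        Y.repNorm_mono hν (measurable_maxRearr_rpow _ _)
          ((hI.const_mul _).add (hRm.const_mul _)) hae
    _ ≤ ((A * a ^ (1 / q)).toNNReal : ℝ≥0∞) * Y.fundamental (τ / 2) +
          ((A * c).toNNReal : ℝ≥0∞) * Y.repNorm R := by
        refine (Y.repNorm_add_le hν (hI.const_mul _) (hRm.const_mul _)).trans (le_of_eq ?_)
        rw [Y.repNorm_smul hν _ hI, Y.repNorm_smul hν _ hRm]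
        rfl
    _ ≤ ENNReal.ofReal (A * c) * Y.repNorm R + ENNReal.ofReal (A * c) * Y.repNorm R := by
        refine add_le_add ?_ le_rfl
        change ENNReal.ofReal (A * a ^ (1 / q)) * _ ≤ _
        rw [ENNReal.ofReal_mul hA, ENNReal.ofReal_mul hA, mul_assoc, mul_assoc]
        exact mul_le_mul_right (repNorm_half_le_opR hν hp hpq ha haμ haν) _
    _ = _ := by
        rw [← two_mul, ← mul_assoc, mul_assoc 2 A c, ENNReal.ofReal_mul two_pos.le,
          ENNReal.ofReal_ofNat]

/-- Functions that satisfy the two endpoint estimates for a set of measure `a` are bounded in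
`Y^⟨p⟩` by the fundamental function of `X`. -/
theorem exists_maxNorm_le {𝕜 : Type*} [RCLike 𝕜] [SigmaFinite μ] (hμ : Nonatomic μ)
    (hp : 1 ≤ p) (hpq : p < q) (hX : μ univ = ∞ → ν univ < ∞ → X.SubsetSum 𝕜 p q)
    (hR : OpRBounded p q X Y) {A : ℝ} (hA : 0 ≤ A) :
    ∃ K : ℝ≥0, ∀ (E : Set α) (a : ℝ) (b : β → ℝ≥0∞), MeasurableSet E → 0 < a →
      μ E = ENNReal.ofReal a → Measurable b → ∫⁻ x, b x ^ p ∂ν ≤ ENNReal.ofReal (A ^ p * a) →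
      (∀ᵐ x ∂ν, b x ≤ ENNReal.ofReal (A * a ^ (1 / q))) →
      Y.maxNorm p b ≤ K * X.norm (E.indicator fun _ => 1) := by
  have hp0 : 0 < p := by linarith
  have hq : 0 < q := by linarith
  have hqp : 0 < q - p := by linarith
  obtain ⟨C, hC⟩ := hR
  -- The sets with `τ > ν(S)`. Here the constant majorant `a^{1/q}` is used on all of `(0, ν(S))`;
  -- such `a` are at least `ν(S)^{q/(q-p)}`, so `a^{1/q} ≲ φ_X(a)` is available.
  obtain ⟨K₂, hK₂⟩ : ∃ K : ℝ≥0, ∀ (E : Set α) (a : ℝ), MeasurableSet E → 0 < a →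
      μ E = ENNReal.ofReal a → ν univ < ENNReal.ofReal (a ^ ((q - p) / q)) →
      ENNReal.ofReal (a ^ (1 / q)) * Y.fundamental (ν univ).toReal ≤
        K * X.norm (E.indicator fun _ => 1) := by
    rcases eq_or_ne (ν univ) 0 with h0 | h0
    · refine ⟨0, fun E a _ _ _ _ => ?_⟩
      have : Y.fundamental (ν univ).toReal = 0 := by
        rw [h0, RINorm.fundamental,
          Y.repNorm_eq_zero_iff hν (measurable_indicator_one measurableSet_Ioo)]
        simp
      simp [this]
    rcases eq_or_ne (ν univ) ∞ with h1 | h1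
    · exact ⟨0, fun E a _ _ _ h => absurd h (by simp [h1])⟩
    set N := (ν univ).toReal with hN
    have hN0 : 0 < N := ENNReal.toReal_pos h0 h1
    obtain ⟨K, hK⟩ := exists_rpow_le_norm (X := X) (𝕜 := 𝕜) hμ hp0 hpq hX
      (a₀ := N ^ (q / (q - p))) (by positivity) h1
    refine ⟨K * (Y.fundamental N).toNNReal, fun E a hE ha hEa hlt => ?_⟩
    have hNa : N ^ (q / (q - p)) ≤ a := by
      rw [← ENNReal.ofReal_toReal h1, ENNReal.ofReal_lt_ofReal_iff (by positivity)] at hlt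
      calc N ^ (q / (q - p)) ≤ (a ^ ((q - p) / q)) ^ (q / (q - p)) :=
            Real.rpow_le_rpow hN0.le hlt.le (by positivity)
        _ = a := by
          rw [← Real.rpow_mul ha.le]
          convert Real.rpow_one a using 2
          field_simp
    rw [ENNReal.coe_mul, ENNReal.coe_toNNReal (Y.fundamental_lt_top hν N).ne, mul_right_comm]
    exact mul_le_mul_left (hK E a hE hEa hNa) _
  refine ⟨(2 * A * 2 ^ (1 / (q - p))).toNNReal * C + A.toNNReal * K₂,
    fun E a b hE ha hEa hb hb₁ hb₂ => ?_⟩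
  have haμ : ENNReal.ofReal a ≤ μ univ := hEa ▸ measure_mono (subset_univ E)
  have hφE : X.repNorm ((Ioo 0 a).indicator fun _ => 1) = X.norm (E.indicator fun _ => 1) := by
    rw [← X.fundamental_eq_norm hE (hEa ▸ ENNReal.ofReal_ne_top), hEa, ENNReal.toReal_ofReal ha.le]
    rfl
  rw [ENNReal.coe_add, ENNReal.coe_mul, ENNReal.coe_mul, add_mul]
  rcases le_or_gt (ENNReal.ofReal (a ^ ((q - p) / q))) (ν univ) with h | h
  · refine le_trans ?_ le_self_add
    refine (maxNorm_le_opR hν hp0 hpq ha hA haμ h hb hb₁ hb₂).trans ?_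
    rw [mul_assoc _ (C : ℝ≥0∞)]
    refine mul_le_mul_right ?_ _
    rw [← hφE]
    refine hC _ (measurable_indicator_one measurableSet_Ioo) ?_
    exact X.fundamental_lt_top hμ a
  · refine le_trans ?_ le_add_self
    have hν' : ν univ ≠ ∞ := ne_top_of_lt h
    have hI : Measurable ((Ioo 0 (ν univ).toReal).indicator fun _ => (1 : ℝ≥0∞)) :=
      measurable_indicator_one measurableSet_Ioo
    have hmem : ∀ᵐ t ∂(intervalMeasure (ν univ)), 0 < t ∧ ENNReal.ofReal t < ν univ :=
      ae_restrict_mem (measurableSet_interval (ν univ))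
    calc Y.maxNorm p b ≤ Y.repNorm fun t => ((A * a ^ (1 / q)).toNNReal : ℝ≥0∞) *
          (Ioo 0 (ν univ).toReal).indicator (fun _ => 1) t := by
          refine Y.repNorm_mono hν (measurable_maxRearr_rpow _ _) (hI.const_mul _)
            (hmem.mono fun t ht => ?_)
          have htmem : t ∈ Ioo 0 (ν univ).toReal :=
            ⟨ht.1, (ENNReal.ofReal_lt_iff_lt_toReal ht.1.le hν').1 ht.2⟩
          beta_reduce
          rw [indicator_of_mem htmem, mul_one]
          refine (maxRearr_rpow_le hp0 ha hA hb hb₁ hb₂ ht.1).trans ?_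
          exact ENNReal.ofReal_le_ofReal (mul_le_mul_of_nonneg_left (min_le_right _ _) hA)
      _ = ENNReal.ofReal A * (ENNReal.ofReal (a ^ (1 / q)) * Y.fundamental (ν univ).toReal) := by
          rw [Y.repNorm_smul hν _ hI, ← mul_assoc, ← ENNReal.ofReal_mul hA]
          rfl
      _ ≤ ENNReal.ofReal A * (K₂ * X.norm (E.indicator fun _ => 1)) :=
          mul_le_mul_right (hK₂ E a hE ha hEa h) _
      _ = _ := by rw [← mul_assoc]; rfl

/-- On a space of infinite measure the fundamental function of `X` grows at least like `t^{1/q}`. -/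
theorem exists_rpow_le_norm_of_infinite {𝕜 : Type*} [RCLike 𝕜] [SigmaFinite μ] (hμ : Nonatomic μ)
    (hp : 0 < p) (hpq : p < q) (hX : μ univ = ∞ → ν univ < ∞ → X.SubsetSum 𝕜 p q)
    (hR : OpRBounded p q X Y) :
    ∃ K : ℝ≥0, ∀ (E : Set α) (a : ℝ), MeasurableSet E → μ E = ENNReal.ofReal a → 1 ≤ a →
      ENNReal.ofReal (a ^ (1 / q)) ≤ K * X.norm (E.indicator fun _ => 1) := by
  have hq : 0 < q := by linarith
  by_cases hfin : ν univ = ∞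
  swap
  · exact exists_rpow_le_norm hμ hp hpq hX one_pos hfin
  obtain ⟨C, hC⟩ := hR
  -- For infinite `ν` the growth of `φ_X` comes from `R_{p,q}` itself: `a ≥ 1` gives `τ/2 ≥ 1/2`, so
  -- `a^{1/q} φ_Y(1/2) ≤ a^{1/q} φ_Y(τ/2) ≲ φ_X(a)`.
  have hy0 := Y.fundamental_pos hν (by simp [hfin]) (t := 1 / 2) (by norm_num)
  have hyt := Y.fundamental_lt_top hν (1 / 2)
  set y := Y.fundamental (1 / 2)
  refine ⟨((2 : ℝ) ^ (1 / (q - p))).toNNReal * C * (y⁻¹).toNNReal, fun E a hE hEa haa => ?_⟩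
  have ha : 0 < a := by linarith
  have haμ : ENNReal.ofReal a ≤ μ univ := hEa ▸ measure_mono (subset_univ E)
  have hφE : X.repNorm ((Ioo 0 a).indicator fun _ => 1) = X.norm (E.indicator fun _ => 1) := by
    rw [← X.fundamental_eq_norm hE (hEa ▸ ENNReal.ofReal_ne_top), hEa, ENNReal.toReal_ofReal ha.le]
    rfl
  have h1 := repNorm_half_le_opR (Y := Y) hν hp hpq ha haμ (by simp [hfin])
  have h2 := hC _ (measurable_indicator_one (measurableSet_Ioo (a := (0 : ℝ)) (b := a)))
    (X.fundamental_lt_top hμ a)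
  rw [hφE] at h2
  have h3 : y ≤ Y.fundamental (a ^ ((q - p) / q) / 2) := by
    refine Y.fundamental_mono hν ?_
    have : 1 ≤ a ^ ((q - p) / q) := Real.one_le_rpow haa (by positivity)
    linarith
  have h4 : ENNReal.ofReal (a ^ (1 / q)) * y ≤
      ENNReal.ofReal (2 ^ (1 / (q - p))) * (C * X.norm (E.indicator fun _ => 1)) :=
    (mul_le_mul_right h3 _).trans (h1.trans (mul_le_mul_right h2 _))
  rw [ENNReal.coe_mul, ENNReal.coe_mul, ENNReal.coe_toNNReal (ENNReal.inv_ne_top.2 hy0.ne')]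
  calc ENNReal.ofReal (a ^ (1 / q)) = ENNReal.ofReal (a ^ (1 / q)) * y * y⁻¹ := by
        rw [mul_assoc, ENNReal.mul_inv_cancel hy0.ne' hyt.ne, mul_one]
    _ ≤ ENNReal.ofReal (2 ^ (1 / (q - p))) * (C * X.norm (E.indicator fun _ => 1)) * y⁻¹ := by
        gcongr
    _ = _ := by rw [ENNReal.ofReal]; ring

end Core

/-! ### Extension of bounded linear maps from a dense subspace. -/

section Extension

theorem le_of_forall_pos_le_add_mul {x y : ℝ≥0∞} {c : ℝ≥0} (h : ∀ ε : ℝ≥0∞, 0 < ε → x ≤ y + c * ε) :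
    x ≤ y := by
  have h0 : Tendsto (fun n : ℕ => y + c * ((n : ℝ≥0∞))⁻¹) atTop (𝓝 (y + c * 0)) :=
    tendsto_const_nhds.add (ENNReal.Tendsto.const_mul ENNReal.tendsto_inv_nat_nhds_zero
      (Or.inr ENNReal.coe_ne_top))
  rw [mul_zero, add_zero] at h0
  exact ge_of_tendsto' h0 fun n => h _ (by simp)

variable {𝕜 V W : Type*} [NormedField 𝕜] [AddCommGroup V] [Module 𝕜 V] [AddCommGroup W] [Module 𝕜 W]

/-- A linear map that is bounded on a dense subspace of a quasinormed space and takes its values in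
a complete normed space has exactly one bounded linear extension. The (quasi)norms may be infinite
and are given as functionals. -/
theorem existsUnique_extension {n : V → ℝ≥0∞} {N : W → ℝ≥0∞}
    (n_zero : n 0 = 0) (n_add : ∀ f g, n (f + g) ≤ 2 * (n f + n g))
    (n_smul : ∀ (c : 𝕜) (f), n (c • f) ≤ ‖c‖ₑ * n f)
    (N_zero : N 0 = 0) (N_add : ∀ f g, N (f + g) ≤ N f + N g)
    (N_smul : ∀ (c : 𝕜) (f), N (c • f) ≤ ‖c‖ₑ * N f) (N_eq_zero : ∀ f, N f = 0 → f = 0)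
    (N_complete : ∀ v : ℕ → W, ∑' k, N (v (k + 1) - v k) < ∞ →
      ∃ g, ∀ k, N (g - v k) ≤ ∑' m, N (v (k + m + 1) - v (k + m)))
    {L S : Submodule 𝕜 V} (hSL : S ≤ L)
    (hdense : ∀ f ∈ L, ∀ ε : ℝ≥0∞, 0 < ε → ∃ s ∈ S, n (f - s) ≤ ε)
    (B : V →ₗ[𝕜] W) {K : ℝ≥0} (hB : ∀ s ∈ S, N (B s) ≤ K * n s) :
    ∃! T : L →ₗ[𝕜] W, (∃ K : ℝ≥0, ∀ f : L, N (T f) ≤ K * n f) ∧ ∀ s (hs : s ∈ S),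
      T ⟨s, hSL hs⟩ = B s := by
  have n_neg : ∀ f, n (-f) ≤ n f := fun f => by
    have := n_smul (-1) f
    rwa [neg_one_smul, enorm_neg, enorm_one, one_mul] at this
  have N_neg : ∀ f, N (-f) ≤ N f := fun f => by
    have := N_smul (-1) f
    rwa [neg_one_smul, enorm_neg, enorm_one, one_mul] at this
  have n_sub : ∀ f g h, n (f - h) ≤ 2 * (n (f - g) + n (h - g)) := fun f g h => by
    calc n (f - h) = n ((f - g) + -(h - g)) := by congr 1; abel
      _ ≤ 2 * (n (f - g) + n (-(h - g))) := n_add _ _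
      _ ≤ _ := by gcongr; exact n_neg _
  -- The graph of the extension: `g` is the value at `f` if some `s` in the subspace approximates
  -- `f` while `B s` approximates `g`. The free constant `c` absorbs the quasi-triangle constants,
  -- so no topology on `V` or `W` is needed.
  let R : V → W → Prop := fun f g => ∃ c : ℝ≥0, ∀ ε : ℝ≥0∞, 0 < ε →
    ∃ s ∈ S, n (f - s) ≤ c * ε ∧ N (g - B s) ≤ c * ε
  have R_add : ∀ f g f' g', R f g → R f' g' → R (f + f') (g + g') := by
    rintro f g f' g' ⟨c, hc⟩ ⟨c', hc'⟩
    refine ⟨2 * (c + c'), fun ε hε => ?_⟩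
    obtain ⟨s, hs, h1, h2⟩ := hc ε hε
    obtain ⟨s', hs', h1', h2'⟩ := hc' ε hε
    refine ⟨s + s', S.add_mem hs hs', ?_, ?_⟩
    · calc n (f + f' - (s + s')) = n ((f - s) + (f' - s')) := by congr 1; abel
        _ ≤ 2 * (n (f - s) + n (f' - s')) := n_add _ _
        _ ≤ 2 * (c * ε + c' * ε) := by gcongr
        _ = _ := by push_cast; ring
    · calc N (g + g' - B (s + s')) = N ((g - B s) + (g' - B s')) := by
            rw [map_add]; congr 1; abel
        _ ≤ N (g - B s) + N (g' - B s') := N_add _ _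
        _ ≤ 1 * (c * ε + c' * ε) := by rw [one_mul]; gcongr
        _ ≤ 2 * (c * ε + c' * ε) := by gcongr; exact one_le_two
        _ = _ := by push_cast; ring
  have R_smul : ∀ (a : 𝕜) f g, R f g → R (a • f) (a • g) := by
    rintro a f g ⟨c, hc⟩
    refine ⟨‖a‖₊ * c, fun ε hε => ?_⟩
    obtain ⟨s, hs, h1, h2⟩ := hc ε hε
    refine ⟨a • s, S.smul_mem a hs, ?_, ?_⟩
    · rw [← smul_sub, ENNReal.coe_mul, mul_assoc, ← enorm_eq_nnnorm]
      exact (n_smul _ _).trans (by gcongr)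
    · rw [map_smul, ← smul_sub, ENNReal.coe_mul, mul_assoc, ← enorm_eq_nnnorm]
      exact (N_smul _ _).trans (by gcongr)
  have R_bound : ∀ f g, R f g → N g ≤ (2 * K : ℝ≥0) * n f := by
    rintro f g ⟨c, hc⟩
    refine le_of_forall_pos_le_add_mul (c := c + K * 2 * c) fun ε hε => ?_
    obtain ⟨s, hs, h1, h2⟩ := hc ε hε
    have h3 : n s ≤ 2 * (n f + c * ε) := by
      have := n_sub s f 0
      rw [sub_zero, zero_sub] at this
      refine this.trans ?_
      rw [add_comm]
      gcongr
      · exact n_neg f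
      · rw [← neg_sub]; exact (n_neg _).trans h1
    calc N g = N ((g - B s) + B s) := by rw [sub_add_cancel]
      _ ≤ N (g - B s) + N (B s) := N_add _ _
      _ ≤ c * ε + K * (2 * (n f + c * ε)) := add_le_add h2 ((hB s hs).trans (by gcongr))
      _ = _ := by push_cast; ring
  have R_unique : ∀ f g g', R f g → R f g' → g = g' := by
    intro f g g' h h'
    have h0 := R_add _ _ _ _ h (R_smul (-1) _ _ h')
    rw [neg_one_smul, neg_one_smul, add_neg_cancel] at h0
    have h1 := R_bound _ _ h0
    rw [n_zero, mul_zero, nonpos_iff_eq_zero] at h1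
    exact eq_of_sub_eq_zero (by rw [sub_eq_add_neg]; exact N_eq_zero _ h1)
  have R_total : ∀ f ∈ L, ∃ g, R f g := by
    intro f hf
    have hε : ∀ k : ℕ, (0 : ℝ≥0∞) < 2⁻¹ ^ k := fun k => by
      rw [← ENNReal.inv_pow]; simp
    -- A geometric rate makes the increments of `B (s k)` summable, as completeness demands; their
    -- tail from `k` on is at most `8 K 2^{-k}`.
    choose s hs hsf using fun k => hdense f hf (2⁻¹ ^ k) (hε k)
    have hstep : ∀ k, N (B (s (k + 1)) - B (s k)) ≤ 4 * K * 2⁻¹ ^ k := fun k => by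
      have h1 : n (s (k + 1) - s k) ≤ 2 * (2⁻¹ ^ k + 2⁻¹ ^ k) := by
        refine (n_sub _ f _).trans ?_
        gcongr
        · rw [← neg_sub]
          refine (n_neg _).trans ((hsf (k + 1)).trans ?_)
          exact pow_le_pow_of_le_one (by simp) (by simp) k.le_succ
        · rw [← neg_sub]
          exact (n_neg _).trans (hsf k)
      rw [← map_sub]
      calc _ ≤ K * n (s (k + 1) - s k) := hB _ (S.sub_mem (hs _) (hs _))
        _ ≤ K * (2 * (2⁻¹ ^ k + 2⁻¹ ^ k)) := by gcongr
        _ = _ := by ring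
    have hgeo : ∀ k, ∑' m, 4 * (K : ℝ≥0∞) * 2⁻¹ ^ (k + m) =
        ((8 * K : ℝ≥0) : ℝ≥0∞) * 2⁻¹ ^ k := fun k => by
      simp only [pow_add]
      rw [ENNReal.tsum_mul_left, ENNReal.tsum_mul_left, ENNReal.tsum_geometric,
        ENNReal.one_sub_inv_two, inv_inv]
      push_cast
      ring
    obtain ⟨g, hg⟩ := N_complete (fun k => B (s k)) (by
      refine (ENNReal.tsum_le_tsum hstep).trans_lt ?_
      have := hgeo 0
      simp only [zero_add] at this
      rw [this]
      exact ENNReal.mul_lt_top ENNReal.coe_lt_top (by simp))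
    refine ⟨g, 1 + 8 * K, fun ε hε0 => ?_⟩
    obtain ⟨k, hk⟩ : ∃ k : ℕ, (2⁻¹ : ℝ≥0∞) ^ k < ε :=
      ((ENNReal.tendsto_pow_atTop_nhds_zero_of_lt_one (by simp)).eventually
        (gt_mem_nhds hε0)).exists
    refine ⟨s k, hs k, ?_, ?_⟩
    · refine ((hsf k).trans hk.le).trans ?_
      rw [ENNReal.coe_add, add_mul, ENNReal.coe_one, one_mul]
      exact le_self_add
    · calc N (g - B (s k)) ≤ ∑' m, 4 * (K : ℝ≥0∞) * 2⁻¹ ^ (k + m) :=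
            (hg k).trans (ENNReal.tsum_le_tsum fun m => hstep (k + m))
        _ = ((8 * K : ℝ≥0) : ℝ≥0∞) * 2⁻¹ ^ k := hgeo k
        _ ≤ ((8 * K : ℝ≥0) : ℝ≥0∞) * ε := by gcongr
        _ ≤ _ := by
          rw [ENNReal.coe_add, add_mul]
          exact le_add_self
  have R_self : ∀ s ∈ S, R s (B s) := fun s hs =>
    ⟨0, fun ε _ => ⟨s, hs, by simp [n_zero], by simp [N_zero]⟩⟩
  choose T hT using fun f : L => R_total f f.2
  refine ⟨{ toFun := T
            map_add' := fun f g => R_unique _ _ _ (hT (f + g)) (R_add _ _ _ _ (hT f) (hT g))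
            map_smul' := fun c f => R_unique _ _ _ (hT (c • f)) (R_smul c _ _ (hT f)) },
    ⟨⟨2 * K, fun f => R_bound _ _ (hT f)⟩,
      fun s hs => R_unique _ _ _ (hT ⟨s, hSL hs⟩) (R_self s hs)⟩, ?_⟩
  rintro T' ⟨⟨K', hK'⟩, hT'⟩
  -- The graph of any bounded extension is contained in `R`, and `R` is single-valued.
  refine LinearMap.ext fun f => R_unique f _ _ ?_ (hT f)
  refine ⟨1 + K', fun ε hε => ?_⟩
  obtain ⟨s, hs, h1⟩ := hdense f f.2 ε hε
  refine ⟨s, hs, h1.trans ?_, ?_⟩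
  · rw [ENNReal.coe_add, add_mul, ENNReal.coe_one, one_mul]
    exact le_self_add
  · rw [← hT' s hs, ← map_sub]
    calc N (T' (f - ⟨s, hSL hs⟩)) ≤ K' * n (f - s) := hK' _
      _ ≤ K' * ε := by gcongr
      _ ≤ _ := by
        rw [ENNReal.coe_add, add_mul]
        exact le_add_self

end Extension

/-! ### Endpoint estimates for functions dominated by a power of `|G χ_E|`. -/

section Endpoint

variable {α β : Type*} [MeasurableSpace α] [MeasurableSpace β] {μ : Measure α} {ν : Measure β}
  {𝕜 : Type*} [RCLike 𝕜]

theorem eLpNorm_chi {r a : ℝ} (hr : 0 < r) (E : Set α) (hE : MeasurableSet E)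
    (hEa : μ E = ENNReal.ofReal a) :
    eLpNorm (chi 𝕜 μ E hE) (ENNReal.ofReal r) μ = ENNReal.ofReal a ^ (1 / r) := by
  rw [eLpNorm_congr_ae (coeFn_chi 𝕜 μ E hE), eLpNorm_indicator_const hE (by simpa using hr)
    ENNReal.ofReal_ne_top, enorm_one, one_mul, ENNReal.toReal_ofReal hr.le, hEa]

theorem weakNorm_chi_le {r a : ℝ} (hr : 0 < r) (E : Set α) (hE : MeasurableSet E)
    (hEa : μ E = ENNReal.ofReal a) :
    weakNorm r (chi 𝕜 μ E hE) ≤ ENNReal.ofReal a ^ (1 / r) := by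
  refine iSup_le fun t => ?_
  rw [rearr_congr (enorm_chi 𝕜 μ E hE)]
  have hle : rearr μ (E.indicator fun _ => 1) t ≤ 1 := by
    refine not_lt.1 fun h => ?_
    rw [lt_rearr_iff, setOf_lt_indicator_one, if_neg (lt_irrefl _)] at h
    simp at h
  rcases lt_or_ge (ENNReal.ofReal t) (ENNReal.ofReal a) with h | h
  · calc _ ≤ ENNReal.ofReal t ^ (1 / r) * 1 := by gcongr
      _ ≤ _ := by rw [mul_one]; gcongr
  · have h0 : rearr μ (E.indicator fun _ => 1) (t : ℝ) = 0 := by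
      rw [← nonpos_iff_eq_zero, ← not_lt, lt_rearr_iff, setOf_lt_indicator_one, if_pos one_pos, hEa]
      exact not_lt.2 h
    simp [h0]

/-- The two endpoint estimates for functions dominated by the `l`-th power of `|G χ_E|`. -/
theorem Sawyerable.exists_endpoint_bounds {p q l C : ℝ} (hp : 0 < p) (hq : 0 < q) (hl : 0 < l)
    (hC : 0 < C) {G : (α →ₘ[μ] 𝕜) → (β →ₘ[ν] 𝕜)} (hG : Sawyerable (l * p) (l * q) G) :
    ∃ A : ℝ, 0 ≤ A ∧ ∀ (E : Set α) (hE : MeasurableSet E) (a : ℝ) (f : β →ₘ[ν] 𝕜), 0 < a →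
      μ E = ENNReal.ofReal a → (∀ᵐ x ∂ν, ‖f x‖ ≤ C * ‖G (chi 𝕜 μ E hE) x‖ ^ l) →
      ∫⁻ x, ‖f x‖ₑ ^ p ∂ν ≤ ENNReal.ofReal (A ^ p * a) ∧
        ∀ᵐ x ∂ν, ‖f x‖ₑ ≤ ENNReal.ofReal (A * a ^ (1 / q)) := by
  obtain ⟨-, ⟨C₁, hC₁⟩, ⟨C₂, hC₂⟩⟩ := hG
  have hlp : 0 < l * p := by positivity
  have hlq : 0 < l * q := by positivity
  set M : ℝ := max C₁ C₂ with hM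
  have hM0 : 0 ≤ M := C₁.2.trans (le_max_left _ _)
  have hM₁ : (C₁ : ℝ≥0∞) ≤ ENNReal.ofReal M := by
    rw [← ENNReal.ofReal_coe_nnreal]; exact ENNReal.ofReal_le_ofReal (le_max_left _ _)
  have hM₂ : (C₂ : ℝ≥0∞) ≤ ENNReal.ofReal M := by
    rw [← ENNReal.ofReal_coe_nnreal]; exact ENNReal.ofReal_le_ofReal (le_max_right _ _)
  -- `M` bounds both endpoint norms of `G`. The power `l` turns the exponents `l * p` and `l * q`
  -- into `p` and `q` and the operator norm into `M ^ l`.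
  refine ⟨C * M ^ l, by positivity, fun E hE a f ha hEa hf => ?_⟩
  set g := G (chi 𝕜 μ E hE)
  have hfg : ∀ᵐ x ∂ν, ‖f x‖ₑ ≤ ENNReal.ofReal C * ‖g x‖ₑ ^ l := by
    filter_upwards [hf] with x hx
    rw [← ofReal_norm, ← ofReal_norm, ENNReal.ofReal_rpow_of_nonneg (norm_nonneg _) hl.le,
      ← ENNReal.ofReal_mul hC.le]
    exact ENNReal.ofReal_le_ofReal hx
  have hnorm := eLpNorm_chi (𝕜 := 𝕜) hlp E hE hEa
  have hfin : ENNReal.ofReal a ^ (1 / (l * p)) < ∞ :=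
    ENNReal.rpow_lt_top_of_nonneg (by positivity) ENNReal.ofReal_ne_top
  have hfin' : ENNReal.ofReal a ^ (1 / (l * q)) < ∞ :=
    ENNReal.rpow_lt_top_of_nonneg (by positivity) ENNReal.ofReal_ne_top
  constructor
  · have h1 : eLpNorm g (ENNReal.ofReal (l * p)) ν ≤
        ENNReal.ofReal M * ENNReal.ofReal a ^ (1 / (l * p)) := by
      have := hC₁ (chi 𝕜 μ E hE) (hnorm ▸ hfin)
      rw [hnorm] at this
      exact this.trans (by gcongr)
    have h2 : ∫⁻ x, ‖g x‖ₑ ^ (l * p) ∂ν = eLpNorm g (ENNReal.ofReal (l * p)) ν ^ (l * p) := by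
      rw [eLpNorm_eq_lintegral_rpow_enorm_toReal (by simpa using hlp) ENNReal.ofReal_ne_top,
        ENNReal.toReal_ofReal hlp.le, ← ENNReal.rpow_mul, one_div_mul_cancel hlp.ne',
        ENNReal.rpow_one]
    calc ∫⁻ x, ‖f x‖ₑ ^ p ∂ν ≤ ∫⁻ x, ENNReal.ofReal C ^ p * ‖g x‖ₑ ^ (l * p) ∂ν := by
          refine lintegral_mono_ae (hfg.mono fun x hx => ?_)
          rw [ENNReal.rpow_mul, ← ENNReal.mul_rpow_of_nonneg _ _ hp.le]
          exact ENNReal.rpow_le_rpow hx hp.le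
      _ = ENNReal.ofReal C ^ p * eLpNorm g (ENNReal.ofReal (l * p)) ν ^ (l * p) := by
          rw [lintegral_const_mul _ (g.measurable.enorm.pow_const _), h2]
      _ ≤ ENNReal.ofReal C ^ p *
          (ENNReal.ofReal M * ENNReal.ofReal a ^ (1 / (l * p))) ^ (l * p) := by
          gcongr
      _ = ENNReal.ofReal ((C * M ^ l) ^ p * a) := by
          rw [ENNReal.mul_rpow_of_nonneg _ _ hlp.le, ← ENNReal.rpow_mul, one_div_mul_cancel hlp.ne',
            ENNReal.rpow_one, ENNReal.rpow_mul, ← mul_assoc, ← ENNReal.mul_rpow_of_nonneg _ _ hp.le,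
            ENNReal.ofReal_rpow_of_nonneg hM0 hl.le, ← ENNReal.ofReal_mul hC.le,
            ENNReal.ofReal_rpow_of_nonneg (by positivity) hp.le,
            ← ENNReal.ofReal_mul (by positivity)]
  · have hw := weakNorm_chi_le (𝕜 := 𝕜) hlq E hE hEa
    have h1 : eLpNorm g ∞ ν ≤ ENNReal.ofReal M * ENNReal.ofReal a ^ (1 / (l * q)) :=
      (hC₂ (chi 𝕜 μ E hE) (hw.trans_lt hfin')).trans (by gcongr)
    have h2 : ∀ᵐ x ∂ν, ‖g x‖ₑ ≤ eLpNorm g ∞ ν := by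
      rw [eLpNorm_exponent_top]; exact ae_le_eLpNormEssSup
    filter_upwards [hfg, h2] with x hx hx'
    refine hx.trans ?_
    calc ENNReal.ofReal C * ‖g x‖ₑ ^ l
        ≤ ENNReal.ofReal C * (ENNReal.ofReal M * ENNReal.ofReal a ^ (1 / (l * q))) ^ l := by
          gcongr
          exact hx'.trans h1
      _ = ENNReal.ofReal (C * M ^ l * a ^ (1 / q)) := by
          rw [ENNReal.mul_rpow_of_nonneg _ _ hl.le, ← ENNReal.rpow_mul,
            ENNReal.ofReal_rpow_of_nonneg hM0 hl.le, ENNReal.ofReal_rpow_of_pos ha,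
            ← ENNReal.ofReal_mul (by positivity), ← ENNReal.ofReal_mul hC.le, mul_assoc]
          congr 4
          field_simp

end Endpoint

/-! ### From characteristic functions to simple functions. -/

section Simple

variable {α β : Type*} [MeasurableSpace α] [MeasurableSpace β] {μ : Measure α} {ν : Measure β}
  {𝕜 : Type*} [RCLike 𝕜]

/-- The space of simple functions that vanish outside a set of finite measure. -/
def simpleSpan (𝕜 : Type*) [RCLike 𝕜] (μ : Measure α) : Submodule 𝕜 (α →ₘ[μ] 𝕜) :=
  Submodule.span 𝕜 {f | ∃ (E : Set α) (hE : MeasurableSet E), μ E < ∞ ∧ f = chi 𝕜 μ E hE}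

theorem chi_mem_simpleSpan {E : Set α} (hE : MeasurableSet E) (h : μ E < ∞) :
    chi 𝕜 μ E hE ∈ simpleSpan 𝕜 μ := Submodule.subset_span ⟨E, hE, h, rfl⟩

theorem coeFn_smul_apply (c : 𝕜) (f : α →ₘ[μ] 𝕜) : ∀ᵐ x ∂μ, (c • f) x = c * f x := by
  filter_upwards [AEEqFun.coeFn_smul c f] with x hx
  rw [hx]; rfl

/-- The lowest layer of a nonnegative simple function, and what remains above it. -/
theorem RINorm.mul_lorentzMass_add_lorentz_le (X : RINorm μ) {f : α → ℝ≥0∞} {v : ℝ≥0∞}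
    (hv : ∀ x, f x ≠ 0 → v ≤ f x) :
    v * X.lorentzMass (μ {x | f x ≠ 0}) + X.lorentz (fun x => f x - v) ≤ X.lorentz f := by
  set m := μ {x | f x ≠ 0}
  have hset : MeasurableSet {t : ℝ | ENNReal.ofReal t < m} :=
    measurableSet_lt ENNReal.measurable_ofReal measurable_const
  have hpt : ∀ t, {t : ℝ | ENNReal.ofReal t < m}.indicator (fun _ => v) t +
      rearr μ (fun x => f x - v) t ≤ rearr μ f t := fun t => by
    by_cases ht : ENNReal.ofReal t < m
    · rw [indicator_of_mem (show t ∈ {t : ℝ | ENNReal.ofReal t < m} from ht)]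
      -- For `t` below the measure of the support, `f^*(t) ≥ v`, so the layer of height `v` fits
      -- under `f^*`.
      refine add_rearr_tsub_le (le_of_forall_lt fun u hu => lt_rearr_iff.2 (ht.trans_le ?_))
      exact measure_mono fun x hx => hu.trans_le (hv x hx)
    · rw [indicator_of_notMem (show t ∉ {t : ℝ | ENNReal.ofReal t < m} from ht), zero_add]
      exact rearr_mono (Eventually.of_forall fun x => tsub_le_self) t
  rw [X.lorentz_eq, X.lorentz_eq]
  calc _ = ∫⁻ t, {t : ℝ | ENNReal.ofReal t < m}.indicator (fun _ => v) t +
        rearr μ (fun x => f x - v) t ∂X.lorentzMeasure := by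
        rw [lintegral_add_left (measurable_const.indicator hset), lintegral_indicator hset,
          setLIntegral_const]
        rfl
    _ ≤ _ := lintegral_mono hpt

/-- A nonnegative simple function as an element of the space of `𝕜`-valued functions. -/
def ofNNRealSimple (𝕜 : Type*) [RCLike 𝕜] (μ : Measure α) (s : SimpleFunc α ℝ≥0) : α →ₘ[μ] 𝕜 :=
  AEEqFun.mk (s.map fun y : ℝ≥0 => ((y : ℝ) : 𝕜)) (SimpleFunc.aestronglyMeasurable _)

theorem coeFn_ofNNRealSimple (s : SimpleFunc α ℝ≥0) :
    ∀ᵐ x ∂μ, ofNNRealSimple 𝕜 μ s x = ((s x : ℝ) : 𝕜) := by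
  filter_upwards [AEEqFun.coeFn_mk (μ := μ) (s.map fun y : ℝ≥0 => ((y : ℝ) : 𝕜))
    (SimpleFunc.aestronglyMeasurable _)] with x hx
  exact hx

/-- Induction on the number of nonzero values, peeling off the lowest layer `v χ_E` with `E` the
support. The Lorentz functional is superadditive along this splitting, so `K` does not grow with the
number of layers. -/
theorem ofNNRealSimple_bound {X : RINorm μ} {Y : RINorm ν} [SigmaFinite μ] [SigmaFinite ν]
    (hμ : Nonatomic μ) (hν : Nonatomic ν) (hφ : Tendsto X.fundamental (𝓝[>] 0) (𝓝 0))
    {p : ℝ} (hp : 1 ≤ p) (B : (α →ₘ[μ] 𝕜) →ₗ[𝕜] (β →ₘ[ν] 𝕜)) {K : ℝ≥0}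
    (hB : ∀ (E : Set α) (hE : MeasurableSet E), μ E < ∞ →
      Y.powNorm p (B (chi 𝕜 μ E hE)) ≤ K * X.norm (E.indicator fun _ => 1)) (n : ℕ) :
    ∀ s : SimpleFunc α ℝ≥0, (s.range.erase 0).card ≤ n → μ {x | s x ≠ 0} < ∞ →
      ofNNRealSimple 𝕜 μ s ∈ simpleSpan 𝕜 μ ∧
        Y.powNorm p (B (ofNNRealSimple 𝕜 μ s)) ≤ K * X.lorentz fun x => (s x : ℝ≥0∞) := by
  induction n with
  | zero =>
    intro s hs _
    have hs0 : ∀ x, s x = 0 := fun x => by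
      by_contra hx
      have : s x ∈ s.range.erase 0 := Finset.mem_erase.2 ⟨hx, s.mem_range_self x⟩
      rw [Finset.card_eq_zero.1 (Nat.le_zero.1 hs)] at this
      simp at this
    have hz : ofNNRealSimple 𝕜 μ s = 0 := by
      refine AEEqFun.ext ?_
      filter_upwards [coeFn_ofNNRealSimple (𝕜 := 𝕜) s, AEEqFun.coeFn_zero (μ := μ) (β := 𝕜)]
        with x h1 h2
      rw [h1, h2, hs0]; simp
    rw [hz, map_zero]
    refine ⟨zero_mem _, ?_⟩
    rw [Y.powNorm_zero hν hp]
    exact bot_le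
  | succ n ih =>
    intro s hs hfin
    rcases (s.range.erase 0).eq_empty_or_nonempty with hemp | hne
    · exact ih s (by simp [hemp]) hfin
    set v := (s.range.erase 0).min' hne with hv
    have hvmem := (s.range.erase 0).min'_mem hne
    have hvle : ∀ x, s x ≠ 0 → v ≤ s x := fun x hx =>
      Finset.min'_le _ _ (Finset.mem_erase.2 ⟨hx, s.mem_range_self x⟩)
    set E : Set α := {x | s x ≠ 0} with hE
    have hEm : MeasurableSet E := (s.measurableSet_fiber 0).compl
    set s' : SimpleFunc α ℝ≥0 := s.map fun y => y - v with hs'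
    have hs'x : ∀ x, s' x = s x - v := fun x => rfl
    have hcard : (s'.range.erase 0).card ≤ n := by
      have hsub : s'.range.erase 0 ⊆ ((s.range.erase 0).erase v).image fun y => y - v := by
        intro y hy
        obtain ⟨hy0, hy⟩ := Finset.mem_erase.1 hy
        obtain ⟨x, rfl⟩ := SimpleFunc.mem_range.1 hy
        refine Finset.mem_image.2 ⟨s x, ?_, rfl⟩
        refine Finset.mem_erase.2 ⟨fun h => hy0 ?_, Finset.mem_erase.2
          ⟨fun h => hy0 ?_, s.mem_range_self x⟩⟩
        · rw [hs'x, h, tsub_self]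
        · rw [hs'x, h, zero_tsub]
      have h1 := (Finset.card_le_card hsub).trans Finset.card_image_le
      rw [Finset.card_erase_of_mem hvmem] at h1
      omega
    have hfin' : μ {x | s' x ≠ 0} < ∞ := by
      refine (measure_mono fun x (hx : s' x ≠ 0) => ?_).trans_lt hfin
      intro h
      exact hx (by rw [hs'x, h, zero_tsub])
    obtain ⟨hmem', hb'⟩ := ih s' hcard hfin'
    have hdecomp : ofNNRealSimple 𝕜 μ s =
        ((v : ℝ) : 𝕜) • chi 𝕜 μ E hEm + ofNNRealSimple 𝕜 μ s' := by
      refine AEEqFun.ext ?_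
      filter_upwards [coeFn_ofNNRealSimple (𝕜 := 𝕜) (μ := μ) s,
        coeFn_ofNNRealSimple (𝕜 := 𝕜) (μ := μ) s', coeFn_chi 𝕜 μ E hEm,
        coeFn_smul_apply ((v : ℝ) : 𝕜) (chi 𝕜 μ E hEm),
        AEEqFun.coeFn_add (((v : ℝ) : 𝕜) • chi 𝕜 μ E hEm) (ofNNRealSimple 𝕜 μ s')]
        with x h1 h2 h3 h4 h5
      rw [h1, h5, Pi.add_apply, h4, h3, h2, hs'x]
      by_cases hx : s x = 0
      · have : x ∉ E := fun h => h hx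
        rw [indicator_of_notMem this, hx]
        simp
      · rw [indicator_of_mem (show x ∈ E from hx), NNReal.coe_sub (hvle x hx)]
        simp
    rw [hdecomp]
    refine ⟨add_mem (Submodule.smul_mem _ _ (chi_mem_simpleSpan hEm hfin)) hmem', ?_⟩
    have hl := X.mul_lorentzMass_add_lorentz_le (f := fun x => (s x : ℝ≥0∞)) (v := v)
      (fun x hx => by exact_mod_cast hvle x (by simpa using hx))
    have hsupp : {x | (s x : ℝ≥0∞) ≠ 0} = E := by ext x; simp [hE]
    rw [hsupp, X.lorentzMass_measure hμ hφ hEm hfin.ne] at hl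
    have hBsplit : B (((v : ℝ) : 𝕜) • chi 𝕜 μ E hEm + ofNNRealSimple 𝕜 μ s') =
        ((v : ℝ) : 𝕜) • B (chi 𝕜 μ E hEm) + B (ofNNRealSimple 𝕜 μ s') := by
      rw [map_add]; congr 1; exact map_smul B _ _
    have hvn : ‖((v : ℝ) : 𝕜)‖ₑ = v := by
      rw [← ofReal_norm, RCLike.norm_ofReal, NNReal.abs_eq, ENNReal.ofReal_coe_nnreal]
    rw [hBsplit]
    calc _ ≤ Y.powNorm p (((v : ℝ) : 𝕜) • B (chi 𝕜 μ E hEm)) +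
          Y.powNorm p (B (ofNNRealSimple 𝕜 μ s')) := Y.powNorm_add_le hν hp _ _
      _ = v * Y.powNorm p (B (chi 𝕜 μ E hEm)) + Y.powNorm p (B (ofNNRealSimple 𝕜 μ s')) := by
          rw [Y.powNorm_smul hν hp, hvn]
      _ ≤ v * (K * X.norm (E.indicator fun _ => 1)) + K * X.lorentz fun x => (s' x : ℝ≥0∞) := by
          gcongr
          exact hB E hEm hfin
      _ = K * (v * X.norm (E.indicator fun _ => 1) + X.lorentz fun x => (s' x : ℝ≥0∞)) := by ring
      _ ≤ K * X.lorentz fun x => (s x : ℝ≥0∞) := by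
          gcongr
          simpa [hs'x, ENNReal.coe_sub] using hl

/-- A simple function as an element of the space of measurable functions. -/
def ofSimple (μ : Measure α) (s : SimpleFunc α 𝕜) : α →ₘ[μ] 𝕜 :=
  AEEqFun.mk s s.aestronglyMeasurable

theorem coeFn_ofSimple (s : SimpleFunc α 𝕜) : ∀ᵐ x ∂μ, ofSimple μ s x = s x :=
  AEEqFun.coeFn_mk _ _

/-- The positive and negative parts of the real and imaginary parts are four nonnegative simple
functions dominated by `|s|`, whence the factor 4. -/
theorem ofSimple_bound {X : RINorm μ} {Y : RINorm ν} [SigmaFinite μ] [SigmaFinite ν]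
    (hμ : Nonatomic μ) (hν : Nonatomic ν) (hφ : Tendsto X.fundamental (𝓝[>] 0) (𝓝 0))
    {p : ℝ} (hp : 1 ≤ p) (B : (α →ₘ[μ] 𝕜) →ₗ[𝕜] (β →ₘ[ν] 𝕜)) {K : ℝ≥0}
    (hB : ∀ (E : Set α) (hE : MeasurableSet E), μ E < ∞ →
      Y.powNorm p (B (chi 𝕜 μ E hE)) ≤ K * X.norm (E.indicator fun _ => 1))
    (s : SimpleFunc α 𝕜) (hfin : μ {x | s x ≠ 0} < ∞) :
    ofSimple μ s ∈ simpleSpan 𝕜 μ ∧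
      Y.powNorm p (B (ofSimple μ s)) ≤ (4 * K : ℝ≥0) * X.lorentz fun x => ‖s x‖ₑ := by
  let r : (𝕜 → ℝ) → SimpleFunc α ℝ≥0 := fun φ => s.map fun z => (φ z).toNNReal
  have hr : ∀ φ : 𝕜 → ℝ, (∀ z, |φ z| ≤ ‖z‖) → ofNNRealSimple 𝕜 μ (r φ) ∈ simpleSpan 𝕜 μ ∧
      Y.powNorm p (B (ofNNRealSimple 𝕜 μ (r φ))) ≤ K * X.lorentz fun x => ‖s x‖ₑ := by
    intro φ hφz
    have hle : ∀ x, (r φ x : ℝ≥0∞) ≤ ‖s x‖ₑ := fun x => by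
      rw [← ofReal_norm]
      exact ENNReal.ofReal_le_ofReal ((le_abs_self _).trans (hφz (s x)))
    have hsupp : μ {x | r φ x ≠ 0} < ∞ := by
      refine (measure_mono fun x (hx : r φ x ≠ 0) => ?_).trans_lt hfin
      intro h
      have := hle x
      rw [h, enorm_zero] at this
      exact hx (by simpa using this)
    obtain ⟨h1, h2⟩ := ofNNRealSimple_bound hμ hν hφ hp B hB _ (r φ) le_rfl hsupp
    exact ⟨h1, h2.trans (by gcongr; exact X.lorentz_mono (Eventually.of_forall hle))⟩
  have h1 := hr (fun z => RCLike.re z) fun z => RCLike.abs_re_le_norm z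
  have h2 := hr (fun z => -RCLike.re z) fun z => by rw [abs_neg]; exact RCLike.abs_re_le_norm z
  have h3 := hr (fun z => RCLike.im z) fun z => RCLike.abs_im_le_norm z
  have h4 := hr (fun z => -RCLike.im z) fun z => by rw [abs_neg]; exact RCLike.abs_im_le_norm z
  set f₁ := ofNNRealSimple 𝕜 μ (r fun z => RCLike.re z) with hf₁
  set f₂ := ofNNRealSimple 𝕜 μ (r fun z => -RCLike.re z) with hf₂
  set f₃ := ofNNRealSimple 𝕜 μ (r fun z => RCLike.im z) with hf₃
  set f₄ := ofNNRealSimple 𝕜 μ (r fun z => -RCLike.im z) with hf₄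
  have hdecomp : ofSimple μ s = (f₁ - f₂) + (RCLike.I : 𝕜) • (f₃ - f₄) := by
    refine AEEqFun.ext ?_
    filter_upwards [coeFn_ofSimple (μ := μ) s,
      coeFn_ofNNRealSimple (𝕜 := 𝕜) (μ := μ) (r fun z => RCLike.re z),
      coeFn_ofNNRealSimple (𝕜 := 𝕜) (μ := μ) (r fun z => -RCLike.re z),
      coeFn_ofNNRealSimple (𝕜 := 𝕜) (μ := μ) (r fun z => RCLike.im z),
      coeFn_ofNNRealSimple (𝕜 := 𝕜) (μ := μ) (r fun z => -RCLike.im z),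
      AEEqFun.coeFn_add (f₁ - f₂) ((RCLike.I : 𝕜) • (f₃ - f₄)),
      AEEqFun.coeFn_sub f₁ f₂, AEEqFun.coeFn_sub f₃ f₄,
      coeFn_smul_apply (RCLike.I : 𝕜) (f₃ - f₄)] with x e0 e1 e2 e3 e4 e5 e6 e7 e8
    rw [e0, e5, Pi.add_apply, e8, e6, e7, Pi.sub_apply, Pi.sub_apply, e1, e2, e3, e4]
    have hpn : ∀ y : ℝ, ((y.toNNReal : ℝ) : 𝕜) - (((-y).toNNReal : ℝ) : 𝕜) = (y : 𝕜) := fun y => by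
      rw [← RCLike.ofReal_sub, Real.coe_toNNReal', Real.coe_toNNReal', max_zero_sub_eq_self]
    change s x =
      ((((RCLike.re (s x)).toNNReal : ℝ) : 𝕜) - (((-RCLike.re (s x)).toNNReal : ℝ) : 𝕜)) +
      RCLike.I * ((((RCLike.im (s x)).toNNReal : ℝ) : 𝕜) - (((-RCLike.im (s x)).toNNReal : ℝ) : 𝕜))
    rw [hpn, hpn, mul_comm, RCLike.re_add_im]
  have hBsplit : B ((f₁ - f₂) + (RCLike.I : 𝕜) • (f₃ - f₄)) =
      (B f₁ - B f₂) + (RCLike.I : 𝕜) • (B f₃ - B f₄) := by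
    rw [map_add, map_sub, ← map_sub B f₃]; congr 1; exact map_smul B _ _
  rw [hdecomp]
  refine ⟨add_mem (sub_mem h1.1 h2.1) (Submodule.smul_mem _ _ (sub_mem h3.1 h4.1)), ?_⟩
  have hI : ‖(RCLike.I : 𝕜)‖ₑ ≤ 1 := by
    rw [← ofReal_norm, ← ENNReal.ofReal_one]
    refine ENNReal.ofReal_le_ofReal ?_
    -- For real scalars `RCLike.I` is zero, so only the bound by 1 holds in both cases.
    by_cases h : (RCLike.I : 𝕜) = 0
    · simp [h]
    · rw [RCLike.norm_I_of_ne_zero h]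
  rw [hBsplit]
  set Λ := X.lorentz fun x => ‖s x‖ₑ
  calc _ ≤ Y.powNorm p (B f₁ - B f₂) + Y.powNorm p ((RCLike.I : 𝕜) • (B f₃ - B f₄)) :=
        Y.powNorm_add_le hν hp _ _
    _ ≤ (K * Λ + K * Λ) + 1 * (K * Λ + K * Λ) := by
        rw [Y.powNorm_smul hν hp]
        gcongr
        · exact (Y.powNorm_sub_le hν hp _ _).trans (add_le_add h1.2 h2.2)
        · exact (Y.powNorm_sub_le hν hp _ _).trans (add_le_add h3.2 h4.2)
    _ = _ := by push_cast; ring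

theorem exists_eq_ofSimple {f : α →ₘ[μ] 𝕜} (hf : f ∈ simpleSpan 𝕜 μ) :
    ∃ s : SimpleFunc α 𝕜, μ {x | s x ≠ 0} < ∞ ∧ f = ofSimple μ s := by
  induction hf using Submodule.span_induction with
  | mem f hf =>
    obtain ⟨E, hE, hfin, rfl⟩ := hf
    refine ⟨SimpleFunc.piecewise E hE (SimpleFunc.const α 1) (SimpleFunc.const α 0), ?_, ?_⟩
    · refine (measure_mono fun x hx => ?_).trans_lt hfin
      by_contra hxE
      exact hx (by simp [hxE])
    · refine AEEqFun.mk_eq_mk.2 (Eventually.of_forall fun x => ?_)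
      by_cases hx : x ∈ E <;> simp [hx]
  | zero => exact ⟨0, by simp, rfl⟩
  | add f g _ _ ihf ihg =>
    obtain ⟨s, hs, rfl⟩ := ihf
    obtain ⟨t, ht, rfl⟩ := ihg
    refine ⟨s + t, ?_, rfl⟩
    refine (measure_mono fun x hx => ?_).trans_lt (measure_union_lt_top hs ht)
    by_contra hcon
    simp only [mem_union, mem_ofPred_eq, not_or, not_not] at hcon
    exact hx (by simp [hcon.1, hcon.2])
  | smul c f _ ih =>
    obtain ⟨s, hs, rfl⟩ := ih
    refine ⟨c • s, ?_, rfl⟩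
    refine (measure_mono fun x hx => ?_).trans_lt hs
    intro h
    exact hx (by simp [h])

end Simple

theorem eqOn_span {R V W : Type*} [Semiring R] [AddCommMonoid V] [Module R V] [AddCommMonoid W]
    [Module R W] {s : Set V} {L : Submodule R V} (hL : Submodule.span R s ≤ L) (T : L →ₗ[R] W)
    (B : V →ₗ[R] W) (h : ∀ x (hx : x ∈ s), T ⟨x, hL (Submodule.subset_span hx)⟩ = B x) {x : V}
    (hx : x ∈ Submodule.span R s) : T ⟨x, hL hx⟩ = B x := by
  induction hx using Submodule.span_induction with
  | mem x hx => exact h x hx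
  | zero => exact (map_zero T).trans (map_zero B).symm
  | add x y hx hy h1 h2 =>
    rw [map_add, ← h1, ← h2, ← map_add]; rfl
  | smul c x hx h1 => rw [map_smul, ← h1, ← map_smul]; rfl

/-! ### Density of simple functions in `Λ_X`, and extension to it. -/

section Density

variable {α β : Type*} [MeasurableSpace α] [MeasurableSpace β] {μ : Measure α} {ν : Measure β}
  {𝕜 : Type*} [RCLike 𝕜] {X : RINorm μ} [SigmaFinite μ] (hμ : Nonatomic μ)
  (hφ : Tendsto X.fundamental (𝓝[>] 0) (𝓝 0))
include hμ hφ

/-- This is continuity of `φ_X` at 0. Some of the sets may be null, so the one-sided limit has to be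
completed by `φ_X(0) = 0`. -/
theorem lorentzMass_tendsto_zero {E : ℕ → Set α} (hE : ∀ n, MeasurableSet (E n))
    (hfin : ∀ n, μ (E n) ≠ ∞) (h : Tendsto (fun n => μ (E n)) atTop (𝓝 0)) :
    Tendsto (fun n => X.lorentzMass (μ (E n))) atTop (𝓝 0) := by
  simp only [fun n => X.lorentzMass_measure hμ hφ (hE n) (hfin n),
    ← fun n => X.fundamental_eq_norm (hE n) (hfin n)]
  have hzero : X.fundamental 0 = 0 :=
    (X.repNorm_eq_zero_iff hμ (measurable_indicator_one measurableSet_Ioo)).2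
      (Eventually.of_forall fun t => by simp)
  have hcont : Tendsto X.fundamental (𝓝[≥] 0) (𝓝 0) := by
    have h1 : ContinuousWithinAt X.fundamental (Ioi 0) 0 := by
      rw [ContinuousWithinAt, hzero]; exact hφ
    have h2 := continuousWithinAt_Ioi_iff_Ici.1 h1
    rwa [ContinuousWithinAt, hzero] at h2
  refine hcont.comp (tendsto_nhdsWithin_iff.2 ⟨?_, Eventually.of_forall fun n =>
    ENNReal.toReal_nonneg⟩)
  exact (ENNReal.tendsto_toReal ENNReal.zero_ne_top).comp h

/-- The preimages of `(0, n)` under a measure-preserving map have measure `n`, so the total mass is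
at least a multiple of `n^{1/q}` for every `n`. -/
theorem lorentzMass_top {q : ℝ} (hq : 0 < q) (hinf : μ univ = ∞) {K : ℝ≥0}
    (hK : ∀ (E : Set α) (a : ℝ), MeasurableSet E → μ E = ENNReal.ofReal a → 1 ≤ a →
      ENNReal.ofReal (a ^ (1 / q)) ≤ K * X.norm (E.indicator fun _ => 1)) :
    X.lorentzMass ∞ = ∞ := by
  obtain ⟨σ, hσ, hmap⟩ := hμ.exists_map_eq
  by_contra hne
  have hb : ∀ n : ℕ, 1 ≤ n → ENNReal.ofReal ((n : ℝ) ^ (1 / q)) ≤ K * X.lorentzMass ∞ := by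
    intro n hn
    have hE : MeasurableSet (σ ⁻¹' Ioo 0 (n : ℝ)) := hσ measurableSet_Ioo
    have hEn : μ (σ ⁻¹' Ioo 0 (n : ℝ)) = ENNReal.ofReal n := by
      rw [← Measure.map_apply hσ measurableSet_Ioo, hmap, intervalMeasure_Ioo, hinf]
      simp
    refine (hK _ n hE hEn (by exact_mod_cast hn)).trans ?_
    rw [← X.lorentzMass_measure hμ hφ hE (hEn ▸ ENNReal.ofReal_ne_top)]
    exact mul_le_mul_right (X.lorentzMass_mono le_top) _
  have hlim : Tendsto (fun n : ℕ => ENNReal.ofReal ((n : ℝ) ^ (1 / q))) atTop (𝓝 ∞) :=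
    ENNReal.tendsto_ofReal_atTop.comp ((tendsto_rpow_atTop (by positivity)).comp
      tendsto_natCast_atTop_atTop)
  have htop := le_of_tendsto hlim (eventually_atTop.2 ⟨1, hb⟩)
  exact ENNReal.mul_ne_top ENNReal.coe_ne_top hne (top_le_iff.1 htop)

omit hμ hφ [SigmaFinite μ] in
-- A level set of infinite measure at height `u` forces infinite mass at all heights below `u`. This
-- excludes functions such as nonzero constants on an infinite space, out of reach of simple
-- functions supported on sets of finite measure.
theorem measure_lt_top_of_lorentz (htop : μ univ = ∞ → X.lorentzMass ∞ = ∞) {h : α → ℝ≥0∞}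
    (hfin : X.lorentz h < ∞) {u : ℝ} (hu : 0 < u) : μ {x | ENNReal.ofReal u < h x} < ∞ := by
  by_contra hcon
  rw [not_lt, top_le_iff] at hcon
  have hμ' : μ univ = ∞ := top_le_iff.1 (hcon ▸ measure_mono (subset_univ _))
  refine hfin.not_ge ?_
  calc ∞ = ∫⁻ s in Ioo 0 u, ∞ := by simp [hu]
    _ ≤ ∫⁻ s in Ioo 0 u, X.lorentzMass (μ {x | ENNReal.ofReal s < h x}) := by
        refine setLIntegral_mono' measurableSet_Ioo fun s hs => ?_
        rw [← htop hμ', ← hcon]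
        refine X.lorentzMass_mono (measure_mono fun x hx => ?_)
        exact (ENNReal.ofReal_le_ofReal hs.2.le).trans_lt hx
    _ ≤ X.lorentz h := lintegral_mono_set Ioo_subset_Ioi_self

/-- Simple functions are dense in `Λ_X`. -/
theorem exists_simple_lorentzNorm_sub_le (htop : μ univ = ∞ → X.lorentzMass ∞ = ∞)
    {f : α →ₘ[μ] 𝕜} (hf : X.lorentzNorm f < ∞) {ε : ℝ≥0∞} (hε : 0 < ε) :
    ∃ s : SimpleFunc α 𝕜, μ {x | s x ≠ 0} < ∞ ∧ X.lorentzNorm (f - ofSimple μ s) ≤ ε := by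
  rw [X.lorentzNorm_eq hφ] at hf
  have hfm : Measurable f := f.measurable
  let s : ℕ → SimpleFunc α 𝕜 := SimpleFunc.approxOn f hfm univ 0 (mem_univ _)
  have hs2 : ∀ n x, ‖s n x‖ₑ ≤ 2 * ‖f x‖ₑ := fun n x => by
    have h := SimpleFunc.norm_approxOn_zero_le hfm (mem_univ (0 : 𝕜)) x n
    rw [two_mul, ← ofReal_norm, ← ofReal_norm, ← ENNReal.ofReal_add (norm_nonneg _) (norm_nonneg _)]
    exact ENNReal.ofReal_le_ofReal h
  have hd3 : ∀ n x, ‖f x - s n x‖ₑ ≤ 3 * ‖f x‖ₑ := fun n x => by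
    calc ‖f x - s n x‖ₑ ≤ ‖f x‖ₑ + ‖s n x‖ₑ := enorm_sub_le
      _ ≤ ‖f x‖ₑ + 2 * ‖f x‖ₑ := by gcongr; exact hs2 n x
      _ = 3 * ‖f x‖ₑ := by ring
  have hlim : ∀ x, Tendsto (fun n => s n x) atTop (𝓝 (f x)) := fun x =>
    SimpleFunc.tendsto_approxOn hfm (mem_univ _) (by simp)
  have hsupp : ∀ n, μ {x | s n x ≠ 0} < ∞ := fun n => by
    have h : (s n).FinMeasSupp μ := by
      refine SimpleFunc.finMeasSupp_iff.2 fun y hy => ?_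
      have hy0 : 0 < ‖y‖ := norm_pos_iff.2 hy
      -- From `|s_n| ≤ 2 |f|`, the value `y` is taken only where `|f| ≥ ‖y‖/2`; the 4 makes the
      -- inequality strict.
      refine (measure_mono fun x (hx : s n x = y) => ?_).trans_lt
        (measure_lt_top_of_lorentz htop hf (u := ‖y‖ / 4) (by positivity))
      change ENNReal.ofReal (‖y‖ / 4) < ‖f x‖ₑ
      have h1 := SimpleFunc.norm_approxOn_zero_le hfm (mem_univ (0 : 𝕜)) x n
      rw [show SimpleFunc.approxOn f hfm univ 0 (mem_univ _) n x = y from hx] at h1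
      rw [← ofReal_norm, ENNReal.ofReal_lt_ofReal_iff (by linarith)]
      linarith
    exact (SimpleFunc.finMeasSupp_iff_support).1 h
  have h3 : X.lorentz (fun x => 3 * ‖f x‖ₑ) < ∞ := by
    rw [X.lorentz_const_mul (by norm_num) (by norm_num)]
    exact ENNReal.mul_lt_top (by norm_num) hf
  have hdm : ∀ n, Measurable fun x => ‖f x - s n x‖ₑ := fun n =>
    (hfm.sub (s n).measurable).enorm
  have hconv : Tendsto (fun n => X.lorentz fun x => ‖f x - s n x‖ₑ) atTop
      (𝓝 (∫⁻ _ in Ioi (0 : ℝ), 0)) := by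
    -- Dominated convergence in the height `u`, with the level function of `3 |f|` as majorant. At
    -- fixed `u > 0` the level sets of `|f - s_n|` lie in a set of finite measure, so pointwise
    -- convergence makes their measures, hence their masses, tend to zero.
    refine tendsto_lintegral_of_dominated_convergence
      (fun u => X.lorentzMass (μ {x | ENNReal.ofReal u < 3 * ‖f x‖ₑ}))
      (fun n => X.measurable_lorentzMass_meas _) (fun n => Eventually.of_forall fun u => ?_)
      h3.ne ?_
    · exact X.lorentzMass_mono (measure_mono fun x hx => lt_of_lt_of_le hx (hd3 n x))
    · filter_upwards [ae_restrict_mem measurableSet_Ioi] with u (hu : 0 < u)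
      have hb := measure_lt_top_of_lorentz htop h3 hu
      have hsub : ∀ n, {x | ENNReal.ofReal u < ‖f x - s n x‖ₑ} ⊆
          {x | ENNReal.ofReal u < 3 * ‖f x‖ₑ} := fun n x hx => lt_of_lt_of_le hx (hd3 n x)
      have hm : ∀ n, MeasurableSet {x | ENNReal.ofReal u < ‖f x - s n x‖ₑ} := fun n =>
        measurableSet_lt measurable_const (hdm n)
      refine lorentzMass_tendsto_zero hμ hφ hm
        (fun n => ((measure_mono (hsub n)).trans_lt hb).ne) ?_
      have := tendsto_measure_of_ae_tendsto_indicator atTop MeasurableSet.empty hm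
        (measurableSet_lt measurable_const (hfm.enorm.const_mul 3)) hb.ne
        (Eventually.of_forall hsub) (Eventually.of_forall fun x => ?_)
      · rwa [measure_empty] at this
      · have h0 : Tendsto (fun n => ‖f x - s n x‖ₑ) atTop (𝓝 0) := by
          have := ((hlim x).const_sub (f x)).enorm
          rwa [sub_self, enorm_zero] at this
        filter_upwards [h0.eventually (gt_mem_nhds (ENNReal.ofReal_pos.2 hu))] with n hn
        simp [hn.le]
  rw [lintegral_zero] at hconv
  obtain ⟨n, hn⟩ := (hconv.eventually (gt_mem_nhds hε)).exists
  refine ⟨s n, hsupp n, ?_⟩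
  rw [X.lorentzNorm_eq hφ]
  refine (X.lorentz_mono (EventuallyEq.le ?_)).trans hn.le
  filter_upwards [AEEqFun.coeFn_sub f (ofSimple μ (s n)),
    coeFn_ofSimple (μ := μ) (s n)] with x h1 h2
  rw [h1, Pi.sub_apply, h2]

omit hμ [SigmaFinite μ] in
theorem lorentzNorm_zero : X.lorentzNorm (0 : α →ₘ[μ] 𝕜) = 0 := by
  rw [X.lorentzNorm_eq hφ, ← nonpos_iff_eq_zero, ← X.lorentz_zero]
  refine X.lorentz_mono ?_
  filter_upwards [AEEqFun.coeFn_zero (μ := μ) (β := 𝕜)] with x hx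
  simp [hx]

theorem lorentzNorm_add_le (f g : α →ₘ[μ] 𝕜) :
    X.lorentzNorm (f + g) ≤ 2 * (X.lorentzNorm f + X.lorentzNorm g) := by
  simp only [X.lorentzNorm_eq hφ]
  refine le_trans (X.lorentz_mono ?_)
    (X.lorentz_add_le hμ hφ f.measurable.enorm g.measurable.enorm)
  filter_upwards [AEEqFun.coeFn_add f g] with x hx
  rw [hx]
  exact enorm_add_le _ _

omit hμ [SigmaFinite μ] in
theorem lorentzNorm_smul_le (c : 𝕜) (f : α →ₘ[μ] 𝕜) :
    X.lorentzNorm (c • f) ≤ ‖c‖ₑ * X.lorentzNorm f := by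
  rcases eq_or_ne c 0 with rfl | hc
  · have h0 : (0 : 𝕜) • f = 0 := zero_smul 𝕜 f
    rw [h0, lorentzNorm_zero hφ]
    exact bot_le
  · simp only [X.lorentzNorm_eq hφ]
    rw [← X.lorentz_const_mul (by simpa using hc) enorm_ne_top]
    refine X.lorentz_mono ?_
    filter_upwards [coeFn_smul_apply c f] with x hx
    rw [hx, enorm_mul]

/-- The space `Λ_X`. -/
def lorentzSpace (𝕜 : Type*) [RCLike 𝕜] : Submodule 𝕜 (α →ₘ[μ] 𝕜) where
  carrier := {f | X.lorentzNorm f < ∞}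
  zero_mem' := by
    change X.lorentzNorm (0 : α →ₘ[μ] 𝕜) < ∞
    rw [lorentzNorm_zero hφ]
    exact ENNReal.zero_lt_top
  add_mem' := fun {f g} hf hg => (lorentzNorm_add_le hμ hφ f g).trans_lt
    (ENNReal.mul_lt_top (by norm_num) (ENNReal.add_lt_top.2 ⟨hf, hg⟩))
  smul_mem' := fun c f hf => (lorentzNorm_smul_le hφ c f).trans_lt (ENNReal.mul_lt_top (by simp) hf)

theorem lorentzNorm_chi_lt_top (𝕜 : Type*) [RCLike 𝕜] {E : Set α} (hE : MeasurableSet E)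
    (hfin : μ E < ∞) : X.lorentzNorm (chi 𝕜 μ E hE) < ∞ := by
  rw [X.lorentzNorm_eq hφ]
  refine (X.lorentz_mono (enorm_chi 𝕜 μ E hE).le).trans_lt ?_
  rw [X.lorentz_indicator hμ hφ hE hfin.ne]
  exact X.norm_indicator_lt_top E hE hfin

theorem simpleSpan_le_lorentzSpace (𝕜 : Type*) [RCLike 𝕜] :
    simpleSpan 𝕜 μ ≤ lorentzSpace hμ hφ 𝕜 := by
  refine Submodule.span_le.2 ?_
  rintro _ ⟨E, hE, hfin, rfl⟩
  exact lorentzNorm_chi_lt_top hμ hφ 𝕜 hE hfin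

/-- A linear map whose bound on characteristic functions is that of `X` extends to `Λ_X`. -/
theorem existsUnique_lorentz_extension {Y : RINorm ν} [SigmaFinite ν] (hν : Nonatomic ν) {p : ℝ}
    (hp : 1 ≤ p) (htop : μ univ = ∞ → X.lorentzMass ∞ = ∞)
    (B : (α →ₘ[μ] 𝕜) →ₗ[𝕜] (β →ₘ[ν] 𝕜)) {K : ℝ≥0}
    (hchi : ∀ (E : Set α) (hE : MeasurableSet E), μ E < ∞ →
      Y.powNorm p (B (chi 𝕜 μ E hE)) ≤ K * X.norm (E.indicator fun _ => 1)) :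
    ∃! T : lorentzSpace hμ hφ 𝕜 →ₗ[𝕜] (β →ₘ[ν] 𝕜),
      (∃ K : ℝ≥0, ∀ f : lorentzSpace hμ hφ 𝕜,
        Y.powNorm p (T f) ≤ K * X.lorentzNorm (f : α →ₘ[μ] 𝕜)) ∧
      ∀ s (hs : s ∈ simpleSpan 𝕜 μ), T ⟨s, simpleSpan_le_lorentzSpace hμ hφ 𝕜 hs⟩ = B s := by
  have hsimple := ofSimple_bound hμ hν hφ hp B hchi
  have h1 : ∀ (c : 𝕜) (f : α →ₘ[μ] 𝕜), X.lorentzNorm (c • f) ≤ ‖c‖ₑ * X.lorentzNorm f :=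
    lorentzNorm_smul_le hφ
  have h2 : ∀ (c : 𝕜) (f : β →ₘ[ν] 𝕜), Y.powNorm p (c • f) ≤ ‖c‖ₑ * Y.powNorm p f :=
    fun c f => (Y.powNorm_smul hν hp c f).le
  have h3 : ∀ v : ℕ → β →ₘ[ν] 𝕜, ∑' k, Y.powNorm p (v (k + 1) - v k) < ∞ →
      ∃ g, ∀ k, Y.powNorm p (g - v k) ≤ ∑' m, Y.powNorm p (v (k + m + 1) - v (k + m)) :=
    Y.exists_powNorm_sub_le_tsum hν hp
  have h4 : ∀ f ∈ lorentzSpace hμ hφ 𝕜, ∀ ε : ℝ≥0∞, 0 < ε →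
      ∃ s ∈ simpleSpan 𝕜 μ, X.lorentzNorm (f - s) ≤ ε := fun f hf ε hε => by
    obtain ⟨s, hs, hsf⟩ := exists_simple_lorentzNorm_sub_le hμ hφ htop hf hε
    exact ⟨_, (hsimple s hs).1, hsf⟩
  have h5 : ∀ f ∈ simpleSpan 𝕜 μ, Y.powNorm p (B f) ≤ (4 * K : ℝ≥0) * X.lorentzNorm f := by
    intro f hf
    obtain ⟨s, hs, rfl⟩ := exists_eq_ofSimple hf
    refine (hsimple s hs).2.trans ?_
    rw [X.lorentzNorm_eq hφ]
    refine mul_le_mul_right (X.lorentz_mono (EventuallyEq.le ?_)) _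
    filter_upwards [coeFn_ofSimple (μ := μ) s] with x hx
    rw [hx]
  have h6 : ∀ f g : α →ₘ[μ] 𝕜, X.lorentzNorm (f + g) ≤ 2 * (X.lorentzNorm f + X.lorentzNorm g) :=
    lorentzNorm_add_le hμ hφ
  have h7 : ∀ f g : β →ₘ[ν] 𝕜, Y.powNorm p (f + g) ≤ Y.powNorm p f + Y.powNorm p g :=
    Y.powNorm_add_le hν hp
  refine existsUnique_extension (𝕜 := 𝕜) (V := α →ₘ[μ] 𝕜) (W := β →ₘ[ν] 𝕜)
    (n := X.lorentzNorm) (N := Y.powNorm p) ?_ ?_ ?_ ?_ ?_ ?_ ?_ ?_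
    (simpleSpan_le_lorentzSpace hμ hφ 𝕜) ?_ B (K := 4 * K) ?_
  exacts [lorentzNorm_zero hφ, h6, h1, Y.powNorm_zero hν hp, h7, h2,
    fun f hf => Y.powNorm_eq_zero hν hp hf, h3, h4, h5]

end Density

end Sawyer

end

/-! ### The extension theorem. -/

theorem theorem1p2 {𝕜 : Type*} [RCLike 𝕜]
    {α β : Type*} [MeasurableSpace α] [MeasurableSpace β]
    (μ : Measure α) (ν : Measure β) [SigmaFinite μ] [SigmaFinite ν]
    (hμ : Sawyer.Nonatomic μ) (hν : Sawyer.Nonatomic ν)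
    (X : Sawyer.RINorm μ) (Y : Sawyer.RINorm ν)
    (hφ : Tendsto X.fundamental (𝓝[>] 0) (𝓝 0))
    (p q l : ℝ) (hp : 1 < p) (hpq : p < q) (hl0 : 0 < l) (hl1 : l < 1) (hlp : 1 < l * p)
    -- The inclusion is needed (and not automatic) only in the following case.
    (hX : μ univ = ∞ → ν univ < ∞ → X.SubsetSum 𝕜 p q)
    (hR : Sawyer.OpRBounded p q X Y)
    (D : Submodule 𝕜 (α →ₘ[μ] 𝕜))
    (hD : ∀ (E : Set α) (hE : MeasurableSet E), μ E < ∞ → Sawyer.chi 𝕜 μ E hE ∈ D)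
    (B : D →ₗ[𝕜] (β →ₘ[ν] 𝕜))
    (G : (α →ₘ[μ] 𝕜) → (β →ₘ[ν] 𝕜)) (hG : Sawyer.Sawyerable (l * p) (l * q) G)
    (C : ℝ) (hC : 0 < C)
    (hBG : ∀ (E : Set α) (hE : MeasurableSet E) (hfin : μ E < ∞), ∀ᵐ x ∂ν,
      ‖B ⟨Sawyer.chi 𝕜 μ E hE, hD E hE hfin⟩ x‖ ≤ C * ‖G (Sawyer.chi 𝕜 μ E hE) x‖ ^ l) :
    -- `Λ_X` is a linear space, and `B` on simple functions has a unique bounded linear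
    -- extension to it.
    ∃ L : Submodule 𝕜 (α →ₘ[μ] 𝕜), (∀ f, f ∈ L ↔ X.lorentzNorm f < ∞) ∧
      ∃! T : L →ₗ[𝕜] (β →ₘ[ν] 𝕜),
        (∃ K : ℝ≥0, ∀ f : L, Y.powNorm p (T f) ≤ K * X.lorentzNorm (f : α →ₘ[μ] 𝕜)) ∧
        ∀ (E : Set α) (hE : MeasurableSet E) (hfin : μ E < ∞),
          ∃ hEL : Sawyer.chi 𝕜 μ E hE ∈ L,
            T ⟨Sawyer.chi 𝕜 μ E hE, hEL⟩ = B ⟨Sawyer.chi 𝕜 μ E hE, hD E hE hfin⟩ := by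
  have hp0 : 0 < p := by linarith
  have hq0 : 0 < q := by linarith
  -- An algebraic extension to all functions, a mere convenience: only its values on simple
  -- functions enter.
  obtain ⟨B', hB'⟩ := B.exists_extend
  have hB'eq : ∀ (f) (hf : f ∈ D), B' f = B ⟨f, hf⟩ := fun f hf => by rw [← hB']; rfl
  obtain ⟨A, hA, hbd⟩ := hG.exists_endpoint_bounds hp0 hq0 hl0 hC
  obtain ⟨K, hK⟩ := Sawyer.exists_maxNorm_le (𝕜 := 𝕜) (X := X) (Y := Y) hν hμ hp.le hpq hX hR hA
  have hchi : ∀ (E : Set α) (hE : MeasurableSet E), μ E < ∞ →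
      Y.powNorm p (B' (Sawyer.chi 𝕜 μ E hE)) ≤ K * X.norm (E.indicator fun _ => 1) := by
    intro E hE hfin
    -- Null sets are separate because the endpoint estimates are stated for `a > 0`.
    rcases eq_or_ne (μ E) 0 with h0 | h0
    · have hz : Sawyer.chi 𝕜 μ E hE = 0 := by
        refine AEEqFun.ext ?_
        filter_upwards [Sawyer.coeFn_chi 𝕜 μ E hE, AEEqFun.coeFn_zero (μ := μ) (β := 𝕜),
          measure_eq_zero_iff_ae_notMem.1 h0] with x h1 h2 h3
        rw [h1, h2, indicator_of_notMem h3]; rfl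
      rw [hz, map_zero, Y.powNorm_zero hν hp.le]
      exact bot_le
    have hEa : μ E = ENNReal.ofReal (μ E).toReal := (ENNReal.ofReal_toReal hfin.ne).symm
    have ha : 0 < (μ E).toReal := ENNReal.toReal_pos h0 hfin.ne
    rw [hB'eq _ (hD E hE hfin)]
    obtain ⟨h1, h2⟩ := hbd E hE _ (B ⟨Sawyer.chi 𝕜 μ E hE, hD E hE hfin⟩) ha hEa (hBG E hE hfin)
    exact hK E _ _ hE ha hEa (AEEqFun.measurable _).enorm h1 h2
  have htop : μ univ = ∞ → X.lorentzMass ∞ = ∞ := fun hinf => by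
    obtain ⟨K', hK'⟩ := Sawyer.exists_rpow_le_norm_of_infinite (𝕜 := 𝕜) hν hμ hp0 hpq hX hR
    exact Sawyer.lorentzMass_top hμ hφ hq0 hinf hK'
  have hSL := Sawyer.simpleSpan_le_lorentzSpace hμ hφ 𝕜
  obtain ⟨T, ⟨hTb, hTs⟩, hTu⟩ :=
    Sawyer.existsUnique_lorentz_extension hμ hφ hν hp.le htop B' hchi
  refine ⟨Sawyer.lorentzSpace hμ hφ 𝕜, fun f => Iff.rfl, T, ⟨hTb, fun E hE hfin => ?_⟩, ?_⟩
  · have hmem := Sawyer.chi_mem_simpleSpan (𝕜 := 𝕜) hE hfin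
    exact ⟨hSL hmem, (hTs _ hmem).trans (hB'eq _ (hD E hE hfin))⟩
  · rintro T' ⟨hTb', hTs'⟩
    -- By linearity, agreement on characteristic functions is agreement on simple functions, to
    -- which uniqueness of the extension applies.
    refine hTu T' ⟨hTb', fun s hs => Sawyer.eqOn_span hSL T' B' ?_ hs⟩
    rintro _ ⟨E, hE, hfin, rfl⟩
    obtain ⟨_, hT⟩ := hTs' E hE hfin
    exact hT.trans (hB'eq _ (hD E hE hfin)).symm
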